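/- **Setting.** Let $C$ be a smooth projective geometrically irreducible curve over $\mathbb F_q$ with function field $Q$, let $\infty\in C(\mathbb F_q)$ be a rational point, let $L\supset\mathbb F_q$ be a field, $C_L=C\times_{\mathbb F_q}L$, $\sigma=\mathrm{id}_C\times\mathrm{Spec}(\mathrm{Frob}_q)$ the endomorphism of $C_L$ which is the identity on $C$ and the $q$-Frobenius on $L$. Fix an $\mathbb F_q$-morphism $c:\operatorname{Spec}L\to C$ and let $\mathcal I\subset\mathcal O_{C_L}$ be the ideal sheaf of its graph. For a divisor $D$ on $C$ and a sheaf $\mathcal M$ on $C_L$ put $\mathcal M(D)=\mathcal M\otimes\mathcal O_{C_L}(D)$. An *abelian $\tau$-sheaf* $\underline{\mathcal F}=(\mathcal F_i,\Pi_i,\tau_i)_{i\in\mathbb Z}$ of rank $r\ge 0$, dimension $d\ge 0$ and characteristic $c$ consists of locally free sheaves $\mathcal F_i$ of rank $r$ on $C_L$ and injective morphisms $\Pi_i:\mathcal F_i\to\mathcal F_{i+1}$, $\tau_i:\sigma^*\mathcal F_i\to\mathcal F_{i+1}$ such that 1. $\Pi_{i+1}\circ\tau_i=\tau_{i+1}\circ\sigma^*\Pi_i$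 for all $i$; 2. there are integers $k,l>0$ with $ld=kr$ such that $\Pi_{i+l-1}\circ\cdots\circ\Pi_i$ identifies $\mathcal F_i$ with $\mathcal F_{i+l}(-k\cdot\infty)\subset\mathcal F_{i+l}$ for all $i$; 3. $\dim_L\operatorname{coker}\Pi_i=d$ for all $i$; 4. $\operatorname{coker}\tau_i$ is annihilated by $\mathcal I^d$ and $\dim_L\operatorname{coker}\tau_i=d$ for all $i$. Its characteristic is *different from $\infty$* if $c(\operatorname{Spec}L)\neq\infty$. A *morphism* $\underline{\mathcal F}\to\underline{\mathcal F}'$ of abelian $\tau$-sheaves of characteristic $c$ is a family of morphisms $f_i:\mathcal F_i\to\mathcal F_i'$ commuting with the $\Pi$'s and the $\tau$'s; it is injective (surjective, an isomorphism) if all $f_i$ are. A *quotient* of $\underline{\mathcal F}$ is an abelian $\tau$-sheaf onto which $\underline{\mathcal F}$ has a surjective morphism. $\underline{\mathcal F}$ is *simple* if $\underline{\mathcal F}\ne 0$ and every quotient of $\underline{\mathcal F}$ is $0$ or isomorphic to $\underline{\mathcal F}$. An *isogeny* is an injective morphism $f$ for which the supports of all $\operatorname{coker}f_i$ are contained in $S\times\operatorname{Spec}L$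 for one finite closed subscheme $S\subset C$. A *quasi-morphism* (respectively *quasi-isogeny*) from $\underline{\mathcal F}$ to $\underline{\mathcal F}'$ is a morphism (respectively isogeny) $\underline{\mathcal F}\to\underline{\mathcal F}'(D)$ for some effective divisor $D$ on $C$; two quasi-morphisms with divisors $D_1,D_2$ are identified if they agree as maps to $\underline{\mathcal F}'(D_1+D_2)$. Write $\underline{\mathcal F}\approx\underline{\mathcal F}'$ if there is a quasi-isogeny from $\underline{\mathcal F}$ to $\underline{\mathcal F}'$. The set $\operatorname{QEnd}(\underline{\mathcal F})$ of classes of quasi-morphisms from $\underline{\mathcal F}$ to itself is a $Q$-algebra with addition and composition of maps and multiplication by the elements of $Q$. $\underline{\mathcal F}$ is *semisimple with decomposition* $\underline{\mathcal F}\approx\underline{\mathcal F}_1\oplus\cdots\oplus\underline{\mathcal F}_n$ if the $\underline{\mathcal F}_j$ are simple abelian $\tau$-sheaves whose direct sum is an abelian $\tau$-sheaf and there is such a quasi-isogeny. **Theorem.** Let $\underline{\mathcal F}$ be an abelian $\tau$-sheaf of characteristic different from $\infty$. 1. If $\underline{\mathcal F}$ is simple, then $\operatorname{QEnd}(\underline{\mathcal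 F})$ is a division algebra over $Q$, that is, a nonzero $Q$-algebra in which every nonzero element is invertible. 2. If $\underline{\mathcal F}$ is semisimple with decomposition $\underline{\mathcal F}\approx\underline{\mathcal F}_1\oplus\cdots\oplus\underline{\mathcal F}_n$ into simple abelian $\tau$-sheaves $\underline{\mathcal F}_j$, then all $\operatorname{QEnd}(\underline{\mathcal F}_j)$ are division algebras over $Q$, and there are $m\ge 0$, indices $j_1,\dots,j_m\in\{1,\dots,n\}$ and integers $\mu_1,\dots,\mu_m\ge 1$ with an isomorphism of $Q$-algebras $$\operatorname{QEnd}(\underline{\mathcal F})\;\cong\;\prod_{\nu=1}^m M_{\mu_\nu}\bigl(\operatorname{QEnd}(\underline{\mathcal F}_{j_\nu})\bigr).$$ -/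

import Mathlib

open scoped TensorProduct DirectSum

universe u

namespace TauSheaf

/-! ### The curve `C` and its base change `C_L`

A smooth projective geometrically irreducible curve `C` over the finite field `k = 𝔽_q` is given by
its function field `Q`.  Its points are the valuation subrings of `Q` (they contain `k`
automatically since `k` is finite): `⊤ = Q` is the generic point, the others are the local rings at
the closed points. -/

/-- `Q` is the function field of a smooth projective geometrically irreducible curve over `k`:
a finitely generated extension of transcendence degree one such that all base changes of the curve
to field extensions `E` of `k` are integral. -/
class IsCurve (k Q : Type u) [Field k] [Field Q] [Algebra k Q] : Prop where
  essFiniteType : Algebra.EssFiniteType k Q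
  trdeg_eq_one : Algebra.trdeg k Q = 1
  geometricallyIntegral : ∀ (E : Type u) [Field E] [Algebra k E], IsDomain (E ⊗[k] Q)

/-- `v` is (the local ring at) a `k`-rational closed point of the curve. -/
def IsRationalPoint (k : Type u) {Q : Type u} [Field k] [Field Q] [Algebra k Q]
    (v : ValuationSubring Q) : Prop :=
  v ≠ ⊤ ∧ ∀ a ∈ v, ∃ s : k, a - algebraMap k Q s ∈ v.nonunits

/-! ### Finiteness of the set of poles -/


theorem dvd_or_dvd_away {B : Type u} [CommRing B] [IsDedekindDomain B] (P : Ideal B) [P.IsPrime]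
    (hP : P ≠ ⊥) (p q : B) : (∃ s ∉ P, ∃ c, s * p = c * q) ∨ (∃ s ∉ P, ∃ c, s * q = c * p) := by
  have := IsLocalization.AtPrime.isDiscreteValuationRing_of_dedekind_domain B hP
    (Localization.AtPrime P)
  have key : ∀ p q : B, algebraMap B (Localization.AtPrime P) q ∣ algebraMap B _ p →
      ∃ s ∉ P, ∃ c, s * p = c * q := by
    rintro p q ⟨e, he⟩
    obtain ⟨⟨c, s⟩, hs⟩ := IsLocalization.surj P.primeCompl e
    refine ⟨s, s.2, c, ?_⟩
    apply IsLocalization.injective (Localization.AtPrime P) P.primeCompl_le_nonZeroDivisors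
    rw [map_mul, map_mul, he, ← hs]; ring
  rcases ValuationRing.dvd_total (algebraMap B (Localization.AtPrime P) q) (algebraMap B _ p) with h | h
  · exact Or.inl (key _ _ h)
  · exact Or.inr (key _ _ h)

theorem finite_poles_aux {B Q : Type u} [CommRing B] [IsDedekindDomain B] [Field Q] [Algebra B Q]
    [IsFractionRing B Q] (a : Q) :
    {v : ValuationSubring Q | (∀ b : B, algebraMap B Q b ∈ v) ∧ a ∉ v}.Finite := by
  obtain ⟨n, d, hd, rfl⟩ := IsFractionRing.div_surjective (A := B) a
  have hd0 : d ≠ 0 := nonZeroDivisors.ne_zero hd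
  have hdQ : algebraMap B Q d ≠ 0 := by simpa using hd0
  let S := {v : ValuationSubring Q | (∀ b : B, algebraMap B Q b ∈ v) ∧
    algebraMap B Q n / algebraMap B Q d ∉ v}
  let φ : ∀ v : S, B →+* v.1 := fun v => (algebraMap B Q).codRestrict v.1.toSubring v.2.1
  let I : S → Ideal B := fun v => (IsLocalRing.maximalIdeal v.1).comap (φ v)
  have hmem : ∀ (v : S) (b : B), b ∉ I v → (algebraMap B Q b)⁻¹ ∈ v.1 := by
    intro v b hb
    have h1 : IsUnit (φ v b) := by
      by_contra h; exact hb (by simpa [I] using h)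
    obtain ⟨e, he⟩ := h1.exists_right_inv
    have : (algebraMap B Q b) * (e : Q) = 1 := congrArg Subtype.val he
    rw [inv_eq_of_mul_eq_one_right this]; exact e.2
  have hdI : ∀ v : S, d ∈ I v := by
    intro v
    by_contra h
    exact v.2.2 (by rw [div_eq_mul_inv]; exact v.1.mul_mem _ _ (v.2.1 n) (hmem v d h))
  have hprime : ∀ v, (I v).IsPrime := fun v => Ideal.comap_isPrime _ _
  have hbot : ∀ v, I v ≠ ⊥ := fun v h => hd0 (by simpa [h] using hdI v)
  have hle : ∀ v w : S, I v = I w → v.1 ≤ w.1 := by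
    intro v w hvw x hx
    obtain ⟨p, q, hq, rfl⟩ := IsFractionRing.div_surjective (A := B) x
    have hq0 : algebraMap B Q q ≠ 0 := by simpa using nonZeroDivisors.ne_zero hq
    have := hprime v
    rcases dvd_or_dvd_away (I v) (hbot v) p q with ⟨s, hs, c, h⟩ | ⟨s, hs, c, h⟩
    · have hs' := hmem w s (hvw ▸ hs)
      have hs0 : algebraMap B Q s ≠ 0 := by
        intro h0; apply hs; rw [(by simpa using h0 : s = 0)]; exact zero_mem _
      have : algebraMap B Q p / algebraMap B Q q = algebraMap B Q c * (algebraMap B Q s)⁻¹ := by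
        have := congrArg (algebraMap B Q) h
        simp only [map_mul] at this
        field_simp; rw [mul_comm, this, mul_comm]
      rw [this]; exact w.1.mul_mem _ _ (w.2.1 c) hs'
    · have hs0 : algebraMap B Q s ≠ 0 := by
        intro h0; apply hs; rw [(by simpa using h0 : s = 0)]; exact zero_mem _
      have h' := congrArg (algebraMap B Q) h
      simp only [map_mul] at h'
      have hc : c ∉ I v := by
        intro hc
        apply hs
        have e : φ v s = φ v c * ⟨_, hx⟩ := by
          apply Subtype.ext
          change algebraMap B Q s = algebraMap B Q c * (algebraMap B Q p / algebraMap B Q q)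
          field_simp; exact h'
        change φ v s ∈ IsLocalRing.maximalIdeal v.1
        rw [e]; exact Ideal.mul_mem_right _ _ hc
      have hc0 : algebraMap B Q c ≠ 0 := by
        intro h0; apply hc; rw [(by simpa using h0 : c = 0)]; exact zero_mem _
      have : algebraMap B Q p / algebraMap B Q q = algebraMap B Q s * (algebraMap B Q c)⁻¹ := by
        field_simp; rw [mul_comm, ← h']; ring
      rw [this]; exact w.1.mul_mem _ _ (w.2.1 s) (hmem w c (hvw ▸ hc))
  have hfin : {P : IsDedekindDomain.HeightOneSpectrum B | P.asIdeal ∣ Ideal.span {d}}.Finite :=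
    Ideal.finite_factors (by simpa using hd0)
  have : Finite S := by
    have := hfin.to_subtype
    refine Finite.of_injective (β := {P : IsDedekindDomain.HeightOneSpectrum B |
      P.asIdeal ∣ Ideal.span {d}}) (fun v => ⟨⟨I v, hprime v, hbot v⟩, ?_⟩) ?_
    · exact Ideal.dvd_span_singleton.2 (hdI v)
    · intro v w h
      have h' : I v = I w := by simpa using h
      exact Subtype.ext (le_antisymm (hle v w h') (hle w v h'.symm))
  exact Set.toFinite S

open scoped IntermediateField.algebraAdjoinAdjoin in
theorem finite_poles_aux2 {k Q : Type u} [Field k] [Field Q] [Algebra k Q]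
    [Algebra.EssFiniteType k Q] (t : Q) (ht : Transcendental k t)
    [Algebra.IsAlgebraic (IntermediateField.adjoin k {t}) Q]
    [Algebra.IsSeparable (IntermediateField.adjoin k {t}) Q] (a : Q) :
    {v : ValuationSubring Q | (∀ c : k, algebraMap k Q c ∈ v) ∧ t ∈ v ∧ a ∉ v}.Finite := by
  let A := Algebra.adjoin k {t}
  let F := IntermediateField.adjoin k {t}
  have e : Polynomial k ≃ₐ[k] A :=
    AlgEquiv.ofInjective (Polynomial.aeval t) (transcendental_iff_injective.1 ht) |>.trans
      (Subalgebra.equivOfEq _ _ (Algebra.adjoin_singleton_eq_range_aeval k t).symm)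
  have : IsPrincipalIdealRing A := IsPrincipalIdealRing.of_surjective e.toRingEquiv e.surjective
  have : Algebra.EssFiniteType F Q := Algebra.EssFiniteType.of_comp k F Q
  have : FiniteDimensional F Q := Algebra.finite_of_essFiniteType_of_isAlgebraic
  have : IsScalarTower A F Q := inferInstance
  have := integralClosure.isDedekindDomain A F (L := Q)
  have := IsIntegralClosure.isFractionRing_of_finite_extension A F Q (integralClosure A Q)
  refine (finite_poles_aux (B := integralClosure A Q) a).subset ?_
  rintro v ⟨h1, h2, h3⟩
  refine ⟨fun b => ?_, h3⟩
  have hA : ∀ x : A, (x : Q) ∈ v := by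
    rintro ⟨x, hx⟩
    induction hx using Algebra.adjoin_induction with
    | mem x hx => exact (Set.mem_singleton_iff.1 hx : x = t) ▸ h2
    | algebraMap r => exact h1 r
    | add x y _ _ hx hy => exact v.add_mem _ _ hx hy
    | mul x y _ _ hx hy => exact v.mul_mem _ _ hx hy
  obtain ⟨p, hp, hpe⟩ := b.2
  have hint : IsIntegral v (b : Q) := by
    let ψ : A →+* v := A.val.toRingHom.codRestrict v.toSubring hA
    refine ⟨p.map ψ, hp.map _, ?_⟩
    rw [Polynomial.eval₂_map]
    exact hpe
  obtain ⟨y, hy⟩ := IsIntegrallyClosed.isIntegral_iff.1 hint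
  rw [show algebraMap (integralClosure A Q) Q b = y from hy.symm]
  exact y.2

/-- An element of a function field of one variable over a finite field has only finitely many
poles. -/
theorem finite_poles {k Q : Type u} [Field k] [Finite k] [Field Q] [Algebra k Q]
    [Algebra.EssFiniteType k Q] (htr : Algebra.trdeg k Q = 1) (a : Q) :
    {v : ValuationSubring Q | a ∉ v}.Finite := by
  have hk : ∀ (v : ValuationSubring Q) (c : k), algebraMap k Q c ∈ v := by
    intro v c
    have : Fintype k := Fintype.ofFinite k
    rcases eq_or_ne c 0 with rfl | hc
    · rw [map_zero]; exact v.zero_mem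
    rcases v.mem_or_inv_mem (algebraMap k Q c) with h | h
    · exact h
    · have h1 := FiniteField.pow_card_sub_one_eq_one (K := k) c⁻¹ (inv_ne_zero hc)
      have h2 : 2 ≤ Fintype.card k := Fintype.one_lt_card
      have h3 : c = (c⁻¹) ^ (Fintype.card k - 2) := by
        have : (c⁻¹) ^ (Fintype.card k - 1) = c⁻¹ ^ (Fintype.card k - 2) * c⁻¹ := by
          rw [← pow_succ]; congr 1; omega
        rw [this] at h1
        field_simp at h1 ⊢
        simpa using h1.symm
      rw [h3, map_pow, map_inv₀]
      exact pow_mem h _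
  obtain ⟨s, hs, hsep⟩ := exists_isTranscendenceBasis_and_isSeparable_of_perfectField k Q
  have hcard : s.card = 1 := by
    have := hs.cardinalMk_eq_trdeg
    rw [htr] at this
    simpa using this
  obtain ⟨t, rfl⟩ := Finset.card_eq_one.1 hcard
  have ht : Transcendental k t := by
    have := hs.1.transcendental ⟨t, by simp⟩
    simpa using this
  have halg := hs.isAlgebraic_field
  rw [Finset.coe_singleton] at hsep
  have hrange : Set.range ((↑) : ({t} : Finset Q) → Q) = {t} := by
    ext x; simp
  rw [hrange] at halg
  have hinv : IntermediateField.adjoin k {t⁻¹} = IntermediateField.adjoin k {t} := by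
    apply le_antisymm <;> rw [IntermediateField.adjoin_simple_le_iff]
    · exact inv_mem (IntermediateField.mem_adjoin_simple_self k t)
    · have := inv_mem (IntermediateField.mem_adjoin_simple_self k t⁻¹)
      rwa [inv_inv] at this
  have h1 := finite_poles_aux2 t ht a
  have h2 : {v : ValuationSubring Q |
      (∀ c : k, algebraMap k Q c ∈ v) ∧ t⁻¹ ∈ v ∧ a ∉ v}.Finite := by
    have : Algebra.IsAlgebraic (IntermediateField.adjoin k {t⁻¹}) Q := by rw [hinv]; exact halg
    have : Algebra.IsSeparable (IntermediateField.adjoin k {t⁻¹}) Q := by rw [hinv]; exact hsep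
    refine finite_poles_aux2 t⁻¹ ?_ a
    exact fun h => ht (by simpa using h.inv)
  refine (h1.union h2).subset ?_
  intro v hv
  rcases v.mem_or_inv_mem t with h | h
  · exact Or.inl ⟨hk v, h, hv⟩
  · exact Or.inr ⟨hk v, h, hv⟩

/-! ### The function field of `C_L`, its points and the endomorphism `σ` -/

section BaseChange

variable (k Q L : Type u) [Field k] [Field Q] [Algebra k Q] [IsCurve k Q] [Field L] [Algebra k L]

instance : IsDomain (L ⊗[k] Q) := IsCurve.geometricallyIntegral L

/-- The function field of `C_L = C ×_k L`, the field of fractions of `L ⊗ Q`. -/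
def FunField : Type u := FractionRing (L ⊗[k] Q)

noncomputable instance : Field (FunField k Q L) := inferInstanceAs (Field (FractionRing (L ⊗[k] Q)))

noncomputable instance : Algebra L (FunField k Q L) :=
  inferInstanceAs (Algebra L (FractionRing (L ⊗[k] Q)))

noncomputable instance : Algebra (L ⊗[k] Q) (FunField k Q L) :=
  inferInstanceAs (Algebra (L ⊗[k] Q) (FractionRing (L ⊗[k] Q)))

instance : IsFractionRing (L ⊗[k] Q) (FunField k Q L) :=
  inferInstanceAs (IsFractionRing (L ⊗[k] Q) (FractionRing (L ⊗[k] Q)))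

instance : IsScalarTower L (L ⊗[k] Q) (FunField k Q L) :=
  inferInstanceAs (IsScalarTower L (L ⊗[k] Q) (FractionRing (L ⊗[k] Q)))

/-- The inclusion `Q → Frac (L ⊗ Q)`, that is, the pull back of functions from `C` to `C_L`. -/
noncomputable def ofQ : Q →+* FunField k Q L :=
  (algebraMap (L ⊗[k] Q) (FunField k Q L)).comp
    (Algebra.TensorProduct.includeRight : Q →ₐ[k] L ⊗[k] Q).toRingHom

variable [Fintype k]

/-- The endomorphism `b ⊗ a ↦ b ^ q ⊗ a` of `L ⊗ Q`. -/
noncomputable def sigmaTensor : L ⊗[k] Q →ₐ[k] L ⊗[k] Q :=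
  Algebra.TensorProduct.map (FiniteField.frobeniusAlgHom k L) (AlgHom.id k Q)

set_option linter.unusedSectionVars false in
theorem sigmaTensor_injective : Function.Injective (sigmaTensor k Q L) :=
  Module.Flat.rTensor_preserves_injective_linearMap (M := Q)
    (FiniteField.frobeniusAlgHom k L).toLinearMap (FiniteField.frobeniusAlgHom k L).injective

/-- The endomorphism of the function field of `C_L` induced by `σ = id_C × Frob_q`: the identity on
`Q` and the `q`-Frobenius on `L`. -/
noncomputable def sigma : FunField k Q L →+* FunField k Q L :=
  IsFractionRing.map (A := L ⊗[k] Q) (B := L ⊗[k] Q) (j := (sigmaTensor k Q L).toRingHom)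
    (sigmaTensor_injective k Q L)

theorem sigma_tensor (y : L ⊗[k] Q) : sigma k Q L (algebraMap (L ⊗[k] Q) (FunField k Q L) y) =
    algebraMap (L ⊗[k] Q) (FunField k Q L) (sigmaTensor k Q L y) :=
  by
  unfold sigma IsFractionRing.map
  exact IsLocalization.map_eq (M := nonZeroDivisors (L ⊗[k] Q)) (S := FunField k Q L) _ y

theorem sigma_ofQ (a : Q) : sigma k Q L (ofQ k Q L a) = ofQ k Q L a := by
  change sigma k Q L (algebraMap (L ⊗[k] Q) (FunField k Q L) ((1 : L) ⊗ₜ[k] a)) =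
    algebraMap (L ⊗[k] Q) (FunField k Q L) ((1 : L) ⊗ₜ[k] a)
  rw [sigma_tensor]
  simp [sigmaTensor]

theorem sigma_algebraMap (l : L) : sigma k Q L (algebraMap L (FunField k Q L) l) =
    algebraMap L (FunField k Q L) (l ^ Fintype.card k) := by
  rw [IsScalarTower.algebraMap_apply L (L ⊗[k] Q) (FunField k Q L),
    IsScalarTower.algebraMap_apply L (L ⊗[k] Q) (FunField k Q L), sigma_tensor]
  simp [sigmaTensor, Algebra.TensorProduct.algebraMap_apply]

/-- A point of `C_L`, given by its local ring: a valuation subring of the function field containing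
`L`.  The generic point is the whole function field, all other points are closed; a set of points is
open if and only if it is empty or contains the generic point and has finite complement. -/
@[ext]
structure Point where
  ring : ValuationSubring (FunField k Q L)
  algebraMap_mem : ∀ l : L, algebraMap L (FunField k Q L) l ∈ ring

variable {k Q L}

/-- The image in `C` of a point of `C_L`. -/
noncomputable def Point.toCurve (x : Point k Q L) : ValuationSubring Q :=
  x.ring.comap (ofQ k Q L)

/-- The image of a point of `C_L` under `σ : C_L → C_L`. -/
noncomputable def Point.frob (x : Point k Q L) : Point k Q L where
  ring := x.ring.comap (sigma k Q L)
  algebraMap_mem l := by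
    rw [ValuationSubring.mem_comap, sigma_algebraMap]
    exact x.algebraMap_mem _

/-- The inclusion of the constant field `L` in the local ring at a point. -/
noncomputable def Point.constants (x : Point k Q L) : L →+* x.ring :=
  (algebraMap L (FunField k Q L)).codRestrict x.ring.toSubring x.algebraMap_mem

end BaseChange

/-! ### Locally free sheaves on `C_L`

A locally free sheaf of finite rank is given by its generic fibre `V`, a vector space over the
function field, together with its stalks at all points, which are submodules of `V`.  A morphism of
such sheaves is a linear map of the generic fibres which maps stalks to stalks. -/

section Sheaves

variable {k Q L : Type u} [Field k] [Fintype k] [Field Q] [Algebra k Q] [IsCurve k Q]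
  [Field L] [Algebra k L]

/-- A family of submodules of `V` over the local rings of `C_L`. -/
abbrev StalkFamily (k Q L V : Type u) [Field k] [Fintype k] [Field Q] [Algebra k Q] [IsCurve k Q]
    [Field L] [Algebra k L] [AddCommGroup V] [Module (FunField k Q L) V] : Type u :=
  ∀ x : Point k Q L, Submodule x.ring V

variable {V W : Type u} [AddCommGroup V] [Module (FunField k Q L) V]
  [AddCommGroup W] [Module (FunField k Q L) W]

/-- The family of stalks `M` is a locally free sheaf of rank `r` with generic fibre `V`: around
every point `x` there is an open neighbourhood (a set with finite complement) on which some basis of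
`V` is a basis of the sheaf. -/
def IsLocallyFree (r : ℕ) (M : StalkFamily k Q L V) : Prop :=
  ∀ x : Point k Q L, ∃ b : Module.Basis (Fin r) (FunField k Q L) V,
    M x = Submodule.span x.ring (Set.range b) ∧
      {y : Point k Q L | M y ≠ Submodule.span y.ring (Set.range b)}.Finite

/-- The image of a sheaf under a linear map of generic fibres. -/
noncomputable def StalkFamily.map (f : V →ₗ[FunField k Q L] W) (M : StalkFamily k Q L V) :
    StalkFamily k Q L W :=
  fun x => (M x).map (f.restrictScalars x.ring)

/-- The image of `σ^* M` under the linear map `σ^* V → W` which corresponds to the `σ`-semilinear map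
`f : V → W`.  The stalk of `σ^* M` at `x` is generated by the stalk of `M` at `σ(x)`. -/
noncomputable def StalkFamily.mapSigma (f : V →ₛₗ[sigma k Q L] W) (M : StalkFamily k Q L V) :
    StalkFamily k Q L W :=
  fun x => Submodule.span x.ring (f '' (M x.frob : Set V))

/-- The stalk at `x` of the cokernel of an inclusion `N ⊆ M` of sheaves. -/
abbrev CokerStalk (N M : StalkFamily k Q L V) (x : Point k Q L) : Type u :=
  M x ⧸ (N x).submoduleOf (M x)

noncomputable instance (N M : StalkFamily k Q L V) (x : Point k Q L) :
    Module L (CokerStalk N M x) :=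
  Module.compHom _ x.constants

/-- The dimension over `L` of the cokernel of an inclusion `N ⊆ M` of locally free sheaves of the
same rank.  The cokernel is a skyscraper sheaf, hence the direct sum of its stalks. -/
noncomputable def cokerDim (N M : StalkFamily k Q L V) : Cardinal.{u} :=
  Module.rank L (⨁ x : Point k Q L, CokerStalk N M x)

/-! Divisors on `C` and twists -/

/-- An effective divisor `D` on `C` in terms of the stalks of the invertible ideal sheaf `𝒪_C(-D)`:
nonzero ideals of the local rings, almost all of them trivial. -/
structure EffDivisor (Q : Type u) [Field Q] where
  ideal : ∀ v : ValuationSubring Q, Ideal v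
  ne_bot : ∀ v, ideal v ≠ ⊥
  finite : {v | ideal v ≠ ⊤}.Finite

/-- The sum of two effective divisors. -/
def EffDivisor.add (D E : EffDivisor Q) : EffDivisor Q where
  ideal v := D.ideal v * E.ideal v
  ne_bot v := mul_ne_zero (D.ne_bot v) (E.ne_bot v)
  finite := by
    refine (D.finite.union E.finite).subset fun v hv => ?_
    by_contra h
    simp only [Set.mem_union, Set.mem_ofPred_eq, not_or, not_not] at h
    exact hv (by rw [h.1, h.2, Ideal.mul_top])

/-- The divisor of poles of an element of `Q`. -/
noncomputable def EffDivisor.poles (k : Type u) {Q : Type u} [Field k] [Finite k]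
    [Field Q] [Algebra k Q] [IsCurve k Q] (a : Q) : EffDivisor Q where
  ideal v :=
    { carrier := {g | (g : Q) * a ∈ v}
      add_mem' := fun {x y} hx hy => by
        change ((x : Q) + (y : Q)) * a ∈ v
        rw [add_mul]; exact v.add_mem _ _ hx hy
      zero_mem' := by
        change (0 : Q) * a ∈ v
        rw [zero_mul]; exact v.zero_mem
      smul_mem' := fun x y hy => by
        change ((x : Q) * (y : Q)) * a ∈ v
        rw [mul_assoc]; exact v.mul_mem _ _ x.2 hy }
  ne_bot v h := by
    rcases v.mem_or_inv_mem a with ha | ha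
    · have h1 : (1 : v) ∈ (⊥ : Ideal v) := by
        rw [← h]
        change (1 : Q) * a ∈ v
        rwa [one_mul]
      exact one_ne_zero (Ideal.mem_bot.1 h1)
    · rcases eq_or_ne a 0 with rfl | h0
      · have h1 : (1 : v) ∈ (⊥ : Ideal v) := by
          rw [← h]
          change (1 : Q) * 0 ∈ v
          rw [mul_zero]; exact v.zero_mem
        exact one_ne_zero (Ideal.mem_bot.1 h1)
      · have h1 : (⟨a⁻¹, ha⟩ : v) ∈ (⊥ : Ideal v) := by
          rw [← h]
          change a⁻¹ * a ∈ v
          rw [inv_mul_cancel₀ h0]; exact v.one_mem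
        exact inv_ne_zero h0 (congrArg Subtype.val (Ideal.mem_bot.1 h1))
  finite := by
    have := IsCurve.essFiniteType (k := k) (Q := Q)
    refine (finite_poles (IsCurve.trdeg_eq_one (k := k) (Q := Q)) a).subset fun v hv ha => hv ?_
    rw [Ideal.eq_top_iff_one]
    change (1 : Q) * a ∈ v
    rwa [one_mul]

/-- The sheaf `M(D)`. -/
noncomputable def EffDivisor.twist (D : EffDivisor Q) (M : StalkFamily k Q L V) : StalkFamily k Q L V :=
  fun x =>
    { carrier := {m | ∀ g ∈ D.ideal x.toCurve, ofQ k Q L g • m ∈ M x}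
      add_mem' := fun {a b} ha hb g hg => by
        rw [smul_add]; exact (M x).add_mem (ha g hg) (hb g hg)
      zero_mem' := fun g _ => by rw [smul_zero]; exact (M x).zero_mem
      smul_mem' := fun c m hm g hg => by
        rw [smul_comm]; exact (M x).smul_mem c (hm g hg) }

/-- The subsheaf `M(-n·v)` of `M`, for a closed point `v` of `C`: the stalk at a point `x` over `v` is
`𝔪_v ^ n · M_x`, where `𝔪_v` is the maximal ideal of the local ring of `C` at `v`. -/
noncomputable def negTwist (v : ValuationSubring Q) (n : ℕ) (M : StalkFamily k Q L V) :
    StalkFamily k Q L V :=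
  fun x =>
    open scoped Classical in
    if x.toCurve = v then
      Submodule.span x.ring {m | ∃ g ∈ IsLocalRing.maximalIdeal v ^ n, ∃ m' ∈ M x,
        m = ofQ k Q L (g : Q) • m'}
    else M x

/-! The characteristic -/

variable (k Q L) in
/-- A morphism `c : Spec L → C` of schemes over `k`: its image, a point of `C`, together with a local
`k`-homomorphism from the local ring at this point to `L`. -/
structure Characteristic where
  point : ValuationSubring Q
  hom : point →+* L
  isLocalHom : IsLocalHom hom
  commutes : ∀ (s : k) (hs : algebraMap k Q s ∈ point), hom ⟨algebraMap k Q s, hs⟩ = algebraMap k L s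

/-- The stalk at `x` of the ideal sheaf on `C_L` of the graph of `c`.  If `x` lies over a point of `C`
which specializes to the image of `c`, it is generated by all `a ⊗ 1 - 1 ⊗ c^*(a)`; the
other points do not lie on the graph. -/
noncomputable def Characteristic.graphIdeal (c : Characteristic k Q L) (x : Point k Q L) :
    Ideal x.ring :=
  open scoped Classical in
  if c.point ≤ x.toCurve then
    Ideal.span {h | ∃ a : c.point,
      (h : FunField k Q L) = ofQ k Q L (a : Q) - algebraMap L (FunField k Q L) (c.hom a)}
  else ⊤

end Sheaves

/-! ### Abelian `τ`-sheaves -/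

section Iterate

variable {R : Type u} [Ring R] {V : ℤ → Type u} [∀ i, AddCommGroup (V i)] [∀ i, Module R (V i)]

/-- The identification of two members of a family whose indices are equal. -/
def castEquiv {i j : ℤ} (h : i = j) : V i ≃ₗ[R] V j := h ▸ LinearEquiv.refl R (V i)

/-- The composition `P (i + n - 1) ∘ ⋯ ∘ P i`. -/
def iter (P : ∀ i, V i →ₗ[R] V (i + 1)) (i : ℤ) : (n : ℕ) → (V i →ₗ[R] V (i + n))
  | 0 => (castEquiv (by simp) : V i ≃ₗ[R] V (i + (0 : ℕ))).toLinearMap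
  | n + 1 => (castEquiv (by push_cast; ring) : V (i + n + 1) ≃ₗ[R] V (i + (n + 1 : ℕ))).toLinearMap ∘ₗ
      P (i + n) ∘ₗ iter P i n

end Iterate

variable {k Q L : Type u} [Field k] [Fintype k] [Field Q] [Algebra k Q] [IsCurve k Q]
  [Field L] [Algebra k L]

/-- An abelian `τ`-sheaf on `C_L` of characteristic `c`, where `inf` is the point `∞` of `C`. -/
structure AbelianTauSheaf (inf : ValuationSubring Q) (c : Characteristic k Q L) where
  rank : ℕ
  dim : ℕ
  /-- the generic fibre of `ℱ_i` -/
  V : ℤ → Type u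
  [addCommGroup : ∀ i, AddCommGroup (V i)]
  [module : ∀ i, Module (FunField k Q L) (V i)]
  /-- the stalks of `ℱ_i` -/
  F : ∀ i, StalkFamily k Q L (V i)
  locallyFree : ∀ i, IsLocallyFree rank (F i)
  /-- `Π_i : ℱ_i → ℱ_{i+1}` -/
  P : ∀ i, V i →ₗ[FunField k Q L] V (i + 1)
  P_le : ∀ i, (F i).map (P i) ≤ F (i + 1)
  P_injective : ∀ i, Function.Injective (P i)
  /-- `τ_i : σ^* ℱ_i → ℱ_{i+1}`, regarded as a `σ`-semilinear map -/
  tau : ∀ i, V i →ₛₗ[sigma k Q L] V (i + 1)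
  tau_le : ∀ i, (F i).mapSigma (tau i) ≤ F (i + 1)
  /-- injectivity of the linear map `σ^* V_i → V_{i+1}` -/
  tau_injective : ∀ i (n : ℕ) (s : Fin n → V i), LinearIndependent (FunField k Q L) s →
    LinearIndependent (FunField k Q L) fun j => tau i (s j)
  comm : ∀ i (m : V i), P (i + 1) (tau i m) = tau (i + 1) (P i m)
  periodic : ∃ m l : ℕ, 0 < m ∧ 0 < l ∧ l * dim = m * rank ∧
    ∀ i, (F i).map (iter P i l) = negTwist inf m (F (i + l))
  coker_P : ∀ i, cokerDim ((F i).map (P i)) (F (i + 1)) = dim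
  coker_tau : ∀ i, cokerDim ((F i).mapSigma (tau i)) (F (i + 1)) = dim
  coker_tau_graph : ∀ i (x : Point k Q L), ∀ h ∈ c.graphIdeal x ^ dim, ∀ m ∈ F (i + 1) x,
    h • m ∈ (F i).mapSigma (tau i) x

namespace AbelianTauSheaf

attribute [instance] AbelianTauSheaf.addCommGroup AbelianTauSheaf.module

variable {inf : ValuationSubring Q} {c : Characteristic k Q L}

/-- `F` is the zero sheaf. -/
def IsZero (F : AbelianTauSheaf inf c) : Prop := F.rank = 0

/-- Families of linear maps between the generic fibres of `F` and `G`. -/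
abbrev GenericMap (F G : AbelianTauSheaf inf c) : Type u :=
  ∀ i, F.V i →ₗ[FunField k Q L] G.V i

variable {F G : AbelianTauSheaf inf c}

/-- `f` is a morphism from `F` to the sheaves `N i` with the same generic fibres as `G` and with the
maps `Π`, `τ` of `G`: it maps stalks to stalks and commutes with the `Π`'s and the `τ`'s. -/
structure IsHomTo (N : ∀ i, StalkFamily k Q L (G.V i)) (f : GenericMap F G) : Prop where
  map_le : ∀ i, (F.F i).map (f i) ≤ N i
  comm_P : ∀ i (m : F.V i), f (i + 1) (F.P i m) = G.P i (f i m)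
  comm_tau : ∀ i (m : F.V i), f (i + 1) (F.tau i m) = G.tau i (f i m)

/-- `f` is a morphism `F → G`. -/
def IsHom (f : GenericMap F G) : Prop := IsHomTo G.F f

/-- `f` is injective (a morphism of locally free sheaves is injective if and only if it is so on the
generic fibre). -/
def IsInjective (f : GenericMap F G) : Prop := ∀ i, Function.Injective (f i)

/-- `f` is surjective on all stalks. -/
def IsSurjective (f : GenericMap F G) : Prop := ∀ i, (F.F i).map (f i) = G.F i

/-- `F` and `G` are isomorphic. -/
def IsIsomorphic (F G : AbelianTauSheaf inf c) : Prop :=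
  ∃ f : GenericMap F G, IsHom f ∧ IsInjective f ∧ IsSurjective f

/-- `F ≠ 0` has no abelian quotient `τ`-sheaves other than `0` and `F`. -/
def IsSimple (F : AbelianTauSheaf inf c) : Prop :=
  ¬ F.IsZero ∧ ∀ (G : AbelianTauSheaf inf c) (f : GenericMap F G), IsHom f → IsSurjective f →
    G.IsZero ∨ IsIsomorphic F G

/-- `S` is the direct sum of the `G j`. -/
def IsDirectSum {n : ℕ} (S : AbelianTauSheaf inf c) (G : Fin n → AbelianTauSheaf inf c) : Prop :=
  ∃ (incl : ∀ j, GenericMap (G j) S) (proj : ∀ j, GenericMap S (G j)),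
    (∀ j, IsHom (incl j)) ∧ (∀ j, IsHom (proj j)) ∧
    (∀ j i (m : (G j).V i), proj j i (incl j i m) = m) ∧
    (∀ j j', j ≠ j' → ∀ i (m : (G j).V i), proj j' i (incl j i m) = 0) ∧
    ∀ i (m : S.V i), ∑ j, incl j i (proj j i m) = m

/-- `f` represents a quasi-morphism from `F` to `G`: it is a morphism `F → G(D)` for some effective
divisor `D` on `C`.  Two quasi-morphisms are equivalent if and only if they have
the same maps on the generic fibres. -/
def IsQuasiHom (f : GenericMap F G) : Prop :=
  ∃ D : EffDivisor Q, IsHomTo (fun i => D.twist (G.F i)) f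

/-- `f` represents a quasi-isogeny from `F` to `G`: for some effective divisor `D` on `C` it is an
injective morphism `F → G(D)` whose cokernels are all supported on `S × Spec L` for a finite
set `S` of closed points of `C`. -/
def IsQuasiIsogeny (f : GenericMap F G) : Prop :=
  ∃ D : EffDivisor Q, IsHomTo (fun i => D.twist (G.F i)) f ∧ IsInjective f ∧
    ∃ S : Set (ValuationSubring Q), S.Finite ∧ ⊤ ∉ S ∧
      ∀ i (x : Point k Q L), x.toCurve ∉ S → (F.F i).map (f i) x = D.twist (G.F i) x

/-- `F` and `G` are quasi-isogenous. -/
def IsQuasiIsogenous (F G : AbelianTauSheaf inf c) : Prop :=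
  ∃ f : GenericMap F G, IsQuasiIsogeny f

/-- `F` is semisimple with decomposition `F ≈ G 0 ⊕ ⋯ ⊕ G (n - 1)` up to quasi-isogeny into simple
abelian `τ`-sheaves. -/
def IsSimpleDecomposition {n : ℕ} (F : AbelianTauSheaf inf c)
    (G : Fin n → AbelianTauSheaf inf c) : Prop :=
  (∀ j, (G j).IsSimple) ∧ ∃ S : AbelianTauSheaf inf c, IsDirectSum S G ∧ IsQuasiIsogenous F S

/-! ### The `Q`-algebra `QEnd(F)` -/

theorem mem_twist (D : EffDivisor Q) {V : Type u} [AddCommGroup V] [Module (FunField k Q L) V]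
    (M : StalkFamily k Q L V) (x : Point k Q L) (m : V) :
    m ∈ D.twist M x ↔ ∀ g ∈ D.ideal x.toCurve, ofQ k Q L (g : Q) • m ∈ M x := Iff.rfl

theorem isHomTo_iff (N : ∀ i, StalkFamily k Q L (G.V i)) (f : GenericMap F G) :
    IsHomTo N f ↔ (∀ i x, ∀ m ∈ F.F i x, f i m ∈ N i x) ∧
      (∀ i (m : F.V i), f (i + 1) (F.P i m) = G.P i (f i m)) ∧
      ∀ i (m : F.V i), f (i + 1) (F.tau i m) = G.tau i (f i m) := by
  constructor
  · rintro ⟨h1, h2, h3⟩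
    exact ⟨fun i x m hm => h1 i x ⟨m, hm, rfl⟩, h2, h3⟩
  · rintro ⟨h1, h2, h3⟩
    refine ⟨?_, h2, h3⟩
    rintro i x _ ⟨m, hm, rfl⟩
    exact h1 i x m hm

theorem IsQuasiHom.comp {H : AbelianTauSheaf inf c} {f : GenericMap G H} {g : GenericMap F G}
    (hf : IsQuasiHom f) (hg : IsQuasiHom g) :
    IsQuasiHom (F := F) (G := H) fun i => f i ∘ₗ g i := by
  obtain ⟨D, hD⟩ := hf
  obtain ⟨E, hE⟩ := hg
  rw [isHomTo_iff] at hD hE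
  obtain ⟨hD, hD', hD''⟩ := hD
  obtain ⟨hE, hE', hE''⟩ := hE
  refine ⟨D.add E, (isHomTo_iff _ _).2 ⟨fun i x m hm => ?_, fun i m => ?_, fun i m => ?_⟩⟩
  · rw [mem_twist, LinearMap.comp_apply]
    intro h hh
    refine Submodule.mul_induction_on hh (fun a ha b hb => ?_) (fun a b ha hb => ?_)
    · have h1 : ofQ k Q L b • g i m ∈ G.F i x := hE i x m hm b hb
      have h2 : ofQ k Q L a • f i (ofQ k Q L b • g i m) ∈ H.F i x := hD i x _ h1 a ha
      rw [map_smul, smul_smul, ← map_mul] at h2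
      exact h2
    · have h1 : ofQ k Q L ((a + b : x.toCurve) : Q) • f i (g i m) =
          ofQ k Q L (a : Q) • f i (g i m) + ofQ k Q L (b : Q) • f i (g i m) := by
        rw [← add_smul, ← map_add]; rfl
      rw [h1]
      exact (H.F i x).add_mem ha hb
  · rw [LinearMap.comp_apply, LinearMap.comp_apply, hE', hD']
  · rw [LinearMap.comp_apply, LinearMap.comp_apply, hE'', hD'']

theorem IsQuasiHom.add {f g : GenericMap F G} (hf : IsQuasiHom f) (hg : IsQuasiHom g) :
    IsQuasiHom (F := F) (G := G) fun i => f i + g i := by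
  obtain ⟨D, hD⟩ := hf
  obtain ⟨E, hE⟩ := hg
  rw [isHomTo_iff] at hD hE
  obtain ⟨hD, hD', hD''⟩ := hD
  obtain ⟨hE, hE', hE''⟩ := hE
  refine ⟨D.add E, (isHomTo_iff _ _).2 ⟨fun i x m hm => ?_, fun i m => ?_, fun i m => ?_⟩⟩
  · rw [mem_twist, LinearMap.add_apply]
    intro h hh
    rw [smul_add]
    have h1 : h ∈ D.ideal x.toCurve * E.ideal x.toCurve := hh
    have h2 : h ∈ D.ideal x.toCurve := Ideal.mul_le_left h1
    have h3 : h ∈ E.ideal x.toCurve := Ideal.mul_le_right h1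
    exact (G.F i x).add_mem (hD i x m hm h h2) (hE i x m hm h h3)
  · rw [LinearMap.add_apply, LinearMap.add_apply, hE', hD', map_add]
  · rw [LinearMap.add_apply, LinearMap.add_apply, hE'', hD'', map_add]

theorem IsQuasiHom.neg {f : GenericMap F G} (hf : IsQuasiHom f) :
    IsQuasiHom (F := F) (G := G) fun i => -f i := by
  obtain ⟨D, hD⟩ := hf
  rw [isHomTo_iff] at hD
  obtain ⟨hD, hD', hD''⟩ := hD
  refine ⟨D, (isHomTo_iff _ _).2 ⟨fun i x m hm => ?_, fun i m => ?_, fun i m => ?_⟩⟩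
  · rw [LinearMap.neg_apply]
    exact neg_mem (hD i x m hm)
  · rw [LinearMap.neg_apply, LinearMap.neg_apply, hD', map_neg]
  · rw [LinearMap.neg_apply, LinearMap.neg_apply, hD'', map_neg]

theorem isQuasiHom_zero : IsQuasiHom (F := F) (G := G) fun _ => 0 := by
  refine ⟨EffDivisor.poles k 1, (isHomTo_iff _ _).2
    ⟨fun i x m hm => ?_, fun i m => ?_, fun i m => ?_⟩⟩
  · rw [LinearMap.zero_apply]
    exact zero_mem _
  · rw [LinearMap.zero_apply, LinearMap.zero_apply, map_zero]
  · rw [LinearMap.zero_apply, LinearMap.zero_apply, map_zero]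

theorem isQuasiHom_scalar (a : Q) :
    IsQuasiHom (F := F) (G := F) fun _ => ofQ k Q L a • LinearMap.id := by
  refine ⟨EffDivisor.poles k a, (isHomTo_iff _ _).2
    ⟨fun i x m hm => ?_, fun i m => ?_, fun i m => ?_⟩⟩
  · rw [mem_twist, LinearMap.smul_apply, LinearMap.id_apply]
    intro h hh
    rw [smul_smul, ← map_mul]
    exact (F.F i x).smul_mem (⟨ofQ k Q L (h * a), hh⟩ : x.ring) hm
  · rw [LinearMap.smul_apply, LinearMap.id_apply, LinearMap.smul_apply, LinearMap.id_apply,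
      map_smul]
  · rw [LinearMap.smul_apply, LinearMap.id_apply, LinearMap.smul_apply, LinearMap.id_apply,
      LinearMap.map_smulₛₗ, sigma_ofQ]

variable (F)

/-- The ring `QEnd(F)` of quasi-endomorphisms, with composition as multiplication. -/
def QEnd : Subring (∀ i, Module.End (FunField k Q L) (F.V i)) where
  carrier := {f | IsQuasiHom (F := F) (G := F) f}
  mul_mem' hf hg := IsQuasiHom.comp hf hg
  one_mem' := by
    have h := isQuasiHom_scalar (F := F) (1 : Q)
    simp only [map_one, one_smul] at h
    exact h
  add_mem' hf hg := IsQuasiHom.add hf hg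
  zero_mem' := isQuasiHom_zero
  neg_mem' hf := IsQuasiHom.neg hf

theorem scalar_mem_QEnd (a : Q) :
    algebraMap (FunField k Q L) (∀ i, Module.End (FunField k Q L) (F.V i)) (ofQ k Q L a) ∈
      F.QEnd :=
  isQuasiHom_scalar a

/-- The structure of a `Q`-algebra on `QEnd(F)`. -/
noncomputable instance : Algebra Q F.QEnd :=
  RingHom.toAlgebra'
    (((algebraMap (FunField k Q L) (∀ i, Module.End (FunField k Q L) (F.V i))).comp
      (ofQ k Q L)).codRestrict F.QEnd F.scalar_mem_QEnd)
    fun a f => Subtype.ext (Algebra.commutes (ofQ k Q L a)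
      (f : ∀ i, Module.End (FunField k Q L) (F.V i)))

end AbelianTauSheaf

end TauSheaf

namespace TauSheaf

/-! ### Euler characteristics of families of subspaces -/

section Index

open Module

theorem finrank_ker_comp_add {L V X Y : Type*} [Field L] [AddCommGroup V] [Module L V]
    [AddCommGroup X] [Module L X] [AddCommGroup Y] [Module L Y] (f : V →ₗ[L] X) (g : X →ₗ[L] Y)
    (hg : Function.Surjective g) [Module.Finite L (LinearMap.ker (g ∘ₗ f))]
    [Module.Finite L (X ⧸ LinearMap.range f)] :
    Module.Finite L (LinearMap.ker g) ∧ Module.Finite L (Y ⧸ LinearMap.range (g ∘ₗ f)) ∧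
    finrank L (LinearMap.ker (g ∘ₗ f)) + finrank L (X ⧸ LinearMap.range f) =
      finrank L (LinearMap.ker f) + finrank L (Y ⧸ LinearMap.range (g ∘ₗ f)) +
        finrank L (LinearMap.ker g) := by
  let p : LinearMap.ker (g ∘ₗ f) →ₗ[L] LinearMap.ker g :=
    (f.comp (LinearMap.ker (g ∘ₗ f)).subtype).codRestrict _ fun x => x.2
  let q : LinearMap.ker g →ₗ[L] X ⧸ LinearMap.range f :=
    (LinearMap.range f).mkQ ∘ₗ (LinearMap.ker g).subtype
  have hle : LinearMap.range f ≤ (LinearMap.range (g ∘ₗ f)).comap g := by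
    rintro _ ⟨v, rfl⟩; exact ⟨v, rfl⟩
  let s : (X ⧸ LinearMap.range f) →ₗ[L] Y ⧸ LinearMap.range (g ∘ₗ f) :=
    Submodule.mapQ _ _ g hle
  have hs : Function.Surjective s := by
    intro y
    obtain ⟨y, rfl⟩ := Submodule.Quotient.mk_surjective _ y
    obtain ⟨x, rfl⟩ := hg y
    exact ⟨Submodule.Quotient.mk x, rfl⟩
  have hpq : LinearMap.ker q = LinearMap.range p := by
    ext x
    constructor
    · intro hx
      obtain ⟨v, hv⟩ := (Submodule.Quotient.mk_eq_zero _).1 (show Submodule.Quotient.mk (x : X) = 0 from hx)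
      exact ⟨⟨v, by change g (f v) = 0; rw [hv]; exact x.2⟩, Subtype.ext hv⟩
    · rintro ⟨v, rfl⟩
      exact (Submodule.Quotient.mk_eq_zero _).2 ⟨v, rfl⟩
  have hqs : LinearMap.ker s = LinearMap.range q := by
    ext x
    constructor
    · intro hx
      obtain ⟨x, rfl⟩ := Submodule.Quotient.mk_surjective _ x
      obtain ⟨v, hv⟩ := (Submodule.Quotient.mk_eq_zero _).1 (show Submodule.Quotient.mk (g x) = 0 from hx)
      refine ⟨⟨x - f v, by rw [LinearMap.mem_ker, map_sub, ← hv]; exact sub_self _⟩, ?_⟩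
      exact (Submodule.Quotient.eq _).2 ⟨-v, by simp⟩
    · rintro ⟨v, rfl⟩
      change Submodule.Quotient.mk (g v) = 0
      rw [v.2]; rfl
  have fY : Module.Finite L (Y ⧸ LinearMap.range (g ∘ₗ f)) := Module.Finite.of_surjective s hs
  have fq : Module.Finite L (LinearMap.range q) := inferInstance
  have fk : Module.Finite L (LinearMap.ker q) := by rw [hpq]; infer_instance
  have fqk : Module.Finite L (LinearMap.ker g ⧸ LinearMap.ker q) :=
    Module.Finite.equiv q.quotKerEquivRange.symm
  have fg : Module.Finite L (LinearMap.ker g) :=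
    Module.Finite.of_submodule_quotient (LinearMap.ker q)
  refine ⟨fg, fY, ?_⟩
  have hkp : finrank L (LinearMap.ker p) = finrank L (LinearMap.ker f) := by
    refine LinearEquiv.finrank_eq ?_
    refine LinearEquiv.ofBijective
      (((LinearMap.ker (g ∘ₗ f)).subtype.comp (LinearMap.ker p).subtype).codRestrict _ ?_) ⟨?_, ?_⟩
    · intro x
      exact congrArg Subtype.val (show p x.1 = 0 from x.2)
    · intro x y h
      exact Subtype.ext (Subtype.ext (congrArg (fun z : LinearMap.ker f => (z : V)) h))
    · intro x
      exact ⟨⟨⟨x, by change g (f x) = 0; rw [x.2, map_zero]⟩, Subtype.ext x.2⟩, rfl⟩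
  have h1 := p.finrank_range_add_finrank_ker
  have h2 := q.finrank_range_add_finrank_ker
  have h3 := s.finrank_range_add_finrank_ker
  rw [LinearMap.range_eq_top.2 hs, finrank_top] at h3
  rw [hqs] at h3
  rw [hpq] at h2
  omega

variable {L V W X : Type*} [Field L] [AddCommGroup V] [Module L V] [AddCommGroup W] [Module L W]

/-- The diagonal map `V → ⨁ V / A x` for a family of subspaces almost all of which contain any given
vector. -/
noncomputable def quotDiag (A : X → Submodule L V) (hA : ∀ v, {x | v ∉ A x}.Finite) :
    V →ₗ[L] Π₀ x, V ⧸ A x where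
  toFun v :=
    { toFun x := (A x).mkQ v
      support' := Trunc.mk ⟨(hA v).toFinset.val, fun x => by
        by_cases h : v ∈ A x
        · exact Or.inr ((Submodule.Quotient.mk_eq_zero _).2 h)
        · exact Or.inl ((hA v).mem_toFinset.2 h)⟩ }
  map_add' v w := by ext x; exact map_add (A x).mkQ v w
  map_smul' a v := by ext x; exact map_smul (A x).mkQ a v

theorem quotDiag_apply (A : X → Submodule L V) (hA : ∀ v, {x | v ∉ A x}.Finite) (v : V) (x : X) :
    quotDiag A hA v x = (A x).mkQ v := rfl

theorem ker_quotDiag (A : X → Submodule L V) (hA : ∀ v, {x | v ∉ A x}.Finite) :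
    LinearMap.ker (quotDiag A hA) = ⨅ x, A x := by
  ext v
  rw [LinearMap.mem_ker, DFinsupp.ext_iff, Submodule.mem_iInf]
  refine forall_congr' fun x => ?_
  rw [quotDiag_apply]
  exact Submodule.Quotient.mk_eq_zero _

/-- The first cohomology of a family of subspaces. -/
abbrev H1 (A : X → Submodule L V) (hA : ∀ v, {x | v ∉ A x}.Finite) :=
  (Π₀ x, V ⧸ A x) ⧸ LinearMap.range (quotDiag A hA)

theorem euler_add (A A' : X → Submodule L V) (hA : ∀ v, {x | v ∉ A x}.Finite)
    (hA' : ∀ v, {x | v ∉ A' x}.Finite) (hle : ∀ x, A x ≤ A' x)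
    [Module.Finite L (⨅ x, A' x : Submodule L V)] [Module.Finite L (H1 A hA)] :
    Module.Finite L (Π₀ x, (A' x ⧸ (A x).submoduleOf (A' x))) ∧
    Module.Finite L (H1 A' hA') ∧
    finrank L (⨅ x, A' x : Submodule L V) + finrank L (H1 A hA) =
      finrank L (⨅ x, A x : Submodule L V) + finrank L (H1 A' hA') +
        finrank L (Π₀ x, (A' x ⧸ (A x).submoduleOf (A' x))) := by
  let g : (Π₀ x, V ⧸ A x) →ₗ[L] Π₀ x, V ⧸ A' x :=
    DFinsupp.mapRange.linearMap fun x => Submodule.factor (hle x)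
  let ι : (Π₀ x, (A' x ⧸ (A x).submoduleOf (A' x))) →ₗ[L] Π₀ x, V ⧸ A x :=
    DFinsupp.mapRange.linearMap fun x => Submodule.mapQ _ _ (A' x).subtype le_rfl
  have hcomp : g ∘ₗ quotDiag A hA = quotDiag A' hA' := by
    ext v x
    change Submodule.factor (hle x) (quotDiag A hA v x) = quotDiag A' hA' v x
    rw [quotDiag_apply, quotDiag_apply]; rfl
  have hg : Function.Surjective g := by
    classical
    rw [show (g : _ → _) = DFinsupp.mapRange (fun x => Submodule.factor (hle x)) (fun _ => map_zero _) from rfl]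
    rw [DFinsupp.mapRange_surjective]
    exact fun x => Submodule.factor_surjective (hle x)
  have hι : Function.Injective ι := by
    rw [show (ι : _ → _) = DFinsupp.mapRange (fun x => Submodule.mapQ ((A x).submoduleOf (A' x)) _ (A' x).subtype le_rfl)
      (fun _ => map_zero _) from rfl]
    classical
    rw [DFinsupp.mapRange_injective]
    intro x
    rw [← LinearMap.ker_eq_bot]
    exact Submodule.ker_liftQ_eq_bot _ _ _ (by
      intro y hy
      exact (Submodule.Quotient.mk_eq_zero (A x)).1 hy)
  have hker : LinearMap.ker g = LinearMap.range ι := by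
    classical
    ext y
    constructor
    · intro hy
      have h : ∀ x, ∃ z : A' x ⧸ (A x).submoduleOf (A' x),
          Submodule.mapQ _ _ (A' x).subtype le_rfl z = y x := by
        intro x
        have hx : Submodule.factor (hle x) (y x) = 0 := DFunLike.congr_fun hy x
        obtain ⟨v, hv⟩ := Submodule.Quotient.mk_surjective _ (y x)
        rw [← hv] at hx ⊢
        exact ⟨Submodule.Quotient.mk ⟨v, (Submodule.Quotient.mk_eq_zero _).1 hx⟩, rfl⟩
      choose z hz using h
      refine ⟨DFinsupp.mk y.support fun x => z x, ?_⟩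
      ext x
      change Submodule.mapQ _ _ (A' x).subtype le_rfl
        ((DFinsupp.mk y.support (fun x => z x) : Π₀ x, (A' x ⧸ (A x).submoduleOf (A' x))) x) = y x
      rw [DFinsupp.mk_apply]
      split_ifs with h
      · exact hz x
      · exact (map_zero (Submodule.mapQ ((A x).submoduleOf (A' x)) _ (A' x).subtype le_rfl)).trans
          (DFinsupp.notMem_support_iff.1 h).symm
    · rintro ⟨z, rfl⟩
      ext x
      change Submodule.factor (hle x) (Submodule.mapQ _ _ (A' x).subtype le_rfl (z x)) = 0
      obtain ⟨v, hv⟩ := Submodule.Quotient.mk_surjective _ (z x)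
      rw [← hv]
      exact (Submodule.Quotient.mk_eq_zero _).2 v.2
  have e : (Π₀ x, (A' x ⧸ (A x).submoduleOf (A' x))) ≃ₗ[L] LinearMap.ker g :=
    (LinearEquiv.ofInjective ι hι).trans (LinearEquiv.ofEq _ _ hker.symm)
  have : Module.Finite L (LinearMap.ker (g ∘ₗ quotDiag A hA)) := by
    rw [hcomp, ker_quotDiag]; infer_instance
  obtain ⟨h1, h2, h3⟩ := finrank_ker_comp_add (quotDiag A hA) g hg
  rw [hcomp] at h2 h3
  rw [ker_quotDiag, ker_quotDiag, ← e.finrank_eq] at h3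
  exact ⟨Module.Finite.equiv e.symm, h2, h3⟩

/-- A semilinear map which preserves linear independence and has large image does not decrease
Euler characteristics. -/
theorem euler_le_of_semilinear {Y : Type*} {ρ : L →+* L} (T : V →ₛₗ[ρ] W)
    (hT : ∀ (n : ℕ) (s : Fin n → V), LinearIndependent L s → LinearIndependent L (T ∘ s))
    (hspan : Submodule.span L (Set.range T) = ⊤) (e : X ≃ Y)
    (A : Y → Submodule L V) (hA : ∀ v, {x | v ∉ A x}.Finite)
    (B : X → Submodule L W) (hB : ∀ v, {x | v ∉ B x}.Finite)
    (hAB : ∀ x v, v ∈ A (e x) → T v ∈ B x)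
    [Module.Finite L (⨅ x, B x : Submodule L W)] [Module.Finite L (H1 A hA)] :
    finrank L (⨅ x, A x : Submodule L V) ≤ finrank L (⨅ x, B x : Submodule L W) ∧
    Module.Finite L (H1 B hB) ∧ finrank L (H1 B hB) ≤ finrank L (H1 A hA) := by
  classical
  constructor
  · by_contra h
    push Not at h
    have hb : ∃ s : Fin (finrank L (⨅ x, B x : Submodule L W) + 1) → (⨅ x, A x : Submodule L V),
        LinearIndependent L s := exists_linearIndependent_of_le_finrank h
    obtain ⟨s, hs⟩ := hb
    have h1 := hT _ _ (hs.map' (Submodule.subtype _) (Submodule.ker_subtype _))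
    have hmem : ∀ i, T (s i) ∈ (⨅ x, B x : Submodule L W) := fun i =>
      (Submodule.mem_iInf _).2 fun x => hAB x _ ((Submodule.mem_iInf _).1 (s i).2 _)
    have h2 : LinearIndependent L (fun i => (⟨T (s i), hmem i⟩ : (⨅ x, B x : Submodule L W))) :=
      LinearIndependent.of_comp (Submodule.subtype _) h1
    have := h2.fintype_card_le_finrank
    simp at this
  · let τ : ∀ y, (V ⧸ A y) →+ Π₀ x, W ⧸ B x := fun y =>
      (DFinsupp.singleAddHom (fun x => W ⧸ B x) (e.symm y)).comp
        (Submodule.mapQ (A y) (B (e.symm y)) T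
          (fun v hv => hAB _ _ (by rw [e.apply_symm_apply]; exact hv))).toAddMonoidHom
    let θ : (Π₀ y, V ⧸ A y) →+ Π₀ x, W ⧸ B x := DFinsupp.liftAddHom τ
    have hθs : ∀ y v, θ (DFinsupp.single y (Submodule.Quotient.mk v)) =
        DFinsupp.single (e.symm y) (Submodule.Quotient.mk (T v)) := by
      intro y v
      rw [DFinsupp.liftAddHom_apply_single]; rfl
    have hθl : ∀ (a : L) z, θ (a • z) = ρ a • θ z := by
      intro a z
      induction z using DFinsupp.induction with
      | h0 => simp
      | ha y b z _ _ ih =>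
        rw [show a • (DFinsupp.single y b + z) = a • DFinsupp.single y b + a • z from
          DFinsupp.ext fun x => smul_add a _ _, map_add, map_add,
          show ∀ u w : Π₀ x, W ⧸ B x, ρ a • (u + w) = ρ a • u + ρ a • w from
            fun u w => DFinsupp.ext fun x => smul_add (ρ a) _ _, ih]
        congr 1
        obtain ⟨v, rfl⟩ := Submodule.Quotient.mk_surjective _ b
        rw [← DFinsupp.single_smul, ← Submodule.Quotient.mk_smul, hθs, hθs, ← DFinsupp.single_smul,
          ← Submodule.Quotient.mk_smul, map_smulₛₗ]
    have hθd : ∀ v, θ (quotDiag A hA v) = quotDiag B hB (T v) := by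
      intro v
      have happ : ∀ z x, θ z x = Submodule.mapQ (A (e x)) (B x) T (hAB x) (z (e x)) := by
        intro z x
        induction z using DFinsupp.induction with
        | h0 => simp
        | ha y b z _ _ ih =>
          rw [map_add, DFinsupp.add_apply, DFinsupp.add_apply, map_add, ih]
          congr 1
          obtain ⟨v, rfl⟩ := Submodule.Quotient.mk_surjective _ b
          rw [hθs]
          by_cases hy : y = e x
          · subst hy
            rw [DFinsupp.single_eq_same]
            have : ∀ x', x' = x → (DFinsupp.single x' (Submodule.Quotient.mk (T v)) :
              Π₀ x, W ⧸ B x) x = Submodule.Quotient.mk (T v) := by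
              rintro _ rfl; exact DFinsupp.single_eq_same
            rw [this _ (e.symm_apply_apply x)]; rfl
          · rw [DFinsupp.single_eq_of_ne, DFinsupp.single_eq_of_ne, map_zero]
            · exact fun h => hy h.symm
            · intro h; exact hy (by rw [h, e.apply_symm_apply])
      ext x
      rw [happ, quotDiag_apply, quotDiag_apply]; rfl
    obtain ⟨b⟩ : Nonempty (Basis (Fin (finrank L (H1 A hA))) L (H1 A hA)) := ⟨finBasis L _⟩
    choose β hβ using fun i => Submodule.Quotient.mk_surjective _ (b i)
    have key : Submodule.span L (Set.range fun i =>
        (LinearMap.range (quotDiag B hB)).mkQ (θ (β i))) = ⊤ := by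
      rw [eq_top_iff]
      set S := Submodule.span L (Set.range fun i =>
        (LinearMap.range (quotDiag B hB)).mkQ (θ (β i))) with hS
      have hS1 : ∀ z, (LinearMap.range (quotDiag B hB)).mkQ (θ z) ∈ S := by
        intro z
        have h1 : (LinearMap.range (quotDiag A hA)).mkQ (z - ∑ i, b.repr (Submodule.Quotient.mk z) i • β i) = 0 := by
          rw [map_sub, map_sum]
          simp only [map_smul]
          rw [sub_eq_zero]
          conv_lhs => rw [Submodule.mkQ_apply, ← b.sum_repr (Submodule.Quotient.mk z)]
          refine Finset.sum_congr rfl fun i _ => ?_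
          rw [Submodule.mkQ_apply, hβ]
        obtain ⟨v, hv⟩ := (Submodule.Quotient.mk_eq_zero _).1 h1
        have h2 : z = quotDiag A hA v + ∑ i, b.repr (Submodule.Quotient.mk z) i • β i := by
          rw [hv]; abel
        rw [h2, map_add, hθd, map_add, map_sum, map_sum]
        refine S.add_mem ?_ (S.sum_mem fun i _ => ?_)
        · rw [(Submodule.Quotient.mk_eq_zero _).2 ⟨T v, rfl⟩ |> (fun h => show (LinearMap.range (quotDiag B hB)).mkQ _ = 0 from h)]
          exact S.zero_mem
        · rw [hθl, map_smul]
          exact S.smul_mem _ (Submodule.subset_span ⟨i, rfl⟩)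
      rintro z -
      obtain ⟨z, rfl⟩ := Submodule.mkQ_surjective _ z
      induction z using DFinsupp.induction with
      | h0 => rw [map_zero]; exact S.zero_mem
      | ha x w z _ _ ih =>
        rw [map_add]
        refine S.add_mem ?_ ih
        clear * - hS1 hθs hspan
        obtain ⟨w, rfl⟩ := Submodule.Quotient.mk_surjective _ w
        have hw : w ∈ Submodule.span L (Set.range T) := by rw [hspan]; trivial
        induction hw using Submodule.span_induction with
        | mem w hw =>
          obtain ⟨v, rfl⟩ := hw
          have := hS1 (DFinsupp.single (e x) (Submodule.Quotient.mk v))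
          rw [hθs] at this
          rwa [e.symm_apply_apply] at this
        | zero => rw [Submodule.Quotient.mk_zero, DFinsupp.single_zero, map_zero]; exact S.zero_mem
        | add v w _ _ hv hw =>
          rw [Submodule.Quotient.mk_add, DFinsupp.single_add, map_add]; exact S.add_mem hv hw
        | smul a v _ hv =>
          rw [Submodule.Quotient.mk_smul, DFinsupp.single_smul, map_smul]; exact S.smul_mem _ hv
    have hfin : Module.Finite L (H1 B hB) := by
      rw [Module.finite_def, ← key]
      exact Submodule.fg_span (Set.finite_range _)
    refine ⟨hfin, ?_⟩
    have := finrank_range_le_card (R := L) (fun i => (LinearMap.range (quotDiag B hB)).mkQ (θ (β i)))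
    rw [Set.finrank, key, finrank_top, Fintype.card_fin] at this
    exact this

end Index


/-! ### Valuation subrings over a Dedekind domain -/

section Valuation

variable {K : Type u} [Field K]

theorem inv_mem_of_notMem_nonunits {v : ValuationSubring K} {a : K} (h : a ∉ v.nonunits) :
    a⁻¹ ∈ v := by
  rw [ValuationSubring.mem_nonunits_iff_or] at h
  push Not at h
  exact h.2

theorem mul_mem_nonunits {v : ValuationSubring K} {a b : K} (ha : a ∈ v) (hb : b ∈ v.nonunits) :
    a * b ∈ v.nonunits := by
  rw [ValuationSubring.mem_nonunits_iff_exists_mem_maximalIdeal] at hb ⊢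
  obtain ⟨hb, h⟩ := hb
  exact ⟨v.mul_mem _ _ ha hb, Ideal.mul_mem_left _ (⟨a, ha⟩ : v) h⟩

theorem one_notMem_nonunits (v : ValuationSubring K) : (1 : K) ∉ v.nonunits := by
  rw [ValuationSubring.mem_nonunits_iff_or, inv_one]
  exact fun h => h.elim one_ne_zero fun h => h v.one_mem

theorem notMem_nonunits {v : ValuationSubring K} {a : K} (h0 : a ≠ 0) (h : a⁻¹ ∈ v) :
    a ∉ v.nonunits := by
  rw [ValuationSubring.mem_nonunits_iff_or]
  tauto

theorem mem_of_pow_mem {v : ValuationSubring K} {a : K} {n : ℕ} (hn : 0 < n) (h : a ^ n ∈ v) :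
    a ∈ v := by
  rcases v.mem_or_inv_mem a with h1 | h1
  · exact h1
  · rcases eq_or_ne a 0 with rfl | h0
    · exact v.zero_mem
    obtain ⟨m, rfl⟩ : ∃ m, n = m + 1 := ⟨n - 1, by omega⟩
    have : a = a ^ (m + 1) * (a⁻¹) ^ m := by
      rw [pow_succ, inv_pow]; field_simp
    rw [this]
    exact v.mul_mem _ _ h (pow_mem h1 m)

end Valuation

section Dedekind

variable {B K : Type u} [CommRing B] [Field K] [Algebra B K]

/-- The center on `B` of a valuation subring which contains `B`. -/
def center (v : ValuationSubring K) (hv : ∀ b : B, algebraMap B K b ∈ v) : Ideal B :=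
  (IsLocalRing.maximalIdeal v).comap ((algebraMap B K).codRestrict v.toSubring hv)

variable {v w : ValuationSubring K} {hv : ∀ b : B, algebraMap B K b ∈ v}
  {hw : ∀ b : B, algebraMap B K b ∈ w}

theorem mem_center {b : B} : b ∈ center v hv ↔ algebraMap B K b ∈ v.nonunits := by
  rw [center, Ideal.mem_comap, ValuationSubring.mem_nonunits_iff_exists_mem_maximalIdeal]
  exact ⟨fun h => ⟨hv b, h⟩, fun ⟨_, h⟩ => h⟩

theorem center_isPrime : (center v hv).IsPrime := Ideal.comap_isPrime _ _

variable [IsFractionRing B K]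

theorem center_ne_bot [Nontrivial B] (h : v ≠ ⊤) : center v hv ≠ ⊥ := by
  intro h0
  apply h
  rw [eq_top_iff]
  intro a _
  obtain ⟨p, q, hq, rfl⟩ := IsFractionRing.div_surjective (A := B) a
  have hq1 : algebraMap B K q ≠ 0 := IsFractionRing.to_map_ne_zero_of_mem_nonZeroDivisors hq
  rw [div_eq_mul_inv]
  refine v.mul_mem _ _ (hv p) (inv_mem_of_notMem_nonunits fun h1 => ?_)
  have h2 : q ∈ center v hv := mem_center.2 h1
  rw [h0, Ideal.mem_bot] at h2
  rw [h2, map_zero] at hq1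
  exact hq1 rfl

theorem exists_pow_center [IsDedekindDomain B] (h : v ≠ ⊤) {g : B} (hg : g ≠ 0) :
    ∃ e, g ∈ center v hv ^ e ∧ ∃ j ∉ center v hv, ∀ b ∈ center v hv ^ e, g ∣ b * j := by
  have hp : (center v hv).IsPrime := center_isPrime
  have hp' : Prime (center v hv) := Ideal.prime_of_isPrime (center_ne_bot h) hp
  have hfin : FiniteMultiplicity (center v hv) (Ideal.span {g}) :=
    FiniteMultiplicity.of_prime_left hp' (by simpa using hg)
  obtain ⟨e, J, hJ, hJ'⟩ : ∃ e J, Ideal.span {g} = center v hv ^ e * J ∧ ¬ center v hv ∣ J :=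
    ⟨_, hfin.exists_eq_pow_mul_and_not_dvd⟩
  refine ⟨e, ?_, ?_⟩
  · have : g ∈ Ideal.span {g} := Ideal.mem_span_singleton_self g
    rw [hJ] at this
    exact (inf_le_left : _ ≤ center v hv ^ e) (Ideal.mul_le_inf this)
  · rw [Ideal.dvd_iff_le] at hJ'
    obtain ⟨j, hj, hj'⟩ := Set.not_subset.1 hJ'
    refine ⟨j, hj', fun b hb => ?_⟩
    rw [← Ideal.mem_span_singleton, hJ]
    exact Ideal.mul_mem_mul hb hj

theorem div_mem_of_mem_pow {g j b : B} (hg : g ≠ 0) (hj : j ∉ center v hv) (h : g ∣ b * j) :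
    algebraMap B K b / algebraMap B K g ∈ v := by
  obtain ⟨c, hc⟩ := h
  have hg' : algebraMap B K g ≠ 0 := by simpa using hg
  have hj0 : j ≠ 0 := fun h => hj (h ▸ zero_mem _)
  have hj' : algebraMap B K j ≠ 0 := by simpa using hj0
  have h1 := congrArg (algebraMap B K) hc
  rw [map_mul, map_mul] at h1
  have : algebraMap B K b / algebraMap B K g = algebraMap B K c * (algebraMap B K j)⁻¹ := by
    field_simp; exact h1
  rw [this]
  exact v.mul_mem _ _ (hv c) (inv_mem_of_notMem_nonunits fun h => hj (mem_center.2 h))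

variable [IsDedekindDomain B]

/-- A generator of the maximal ideal of a valuation ring: every nonzero element is the product of a
power of `π` and a unit. -/
structure IsUniformizer (v : ValuationSubring K) (π : K) : Prop where
  ne_zero : π ≠ 0
  mem : π ∈ v.nonunits
  zpow : ∀ a : K, a ≠ 0 → ∃ n : ℤ, a * π ^ n ∈ v ∧ (a * π ^ n)⁻¹ ∈ v

theorem exists_isUniformizer_of_dedekind (hv : ∀ b : B, algebraMap B K b ∈ v) (h : v ≠ ⊤) :
    ∃ π, IsUniformizer v π := by
  have hp : (center v hv).IsPrime := center_isPrime
  have hlt : center v hv ^ 2 < center v hv := Ideal.pow_lt_self _ (center_ne_bot h)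
    hp.ne_top 2 le_rfl
  obtain ⟨ϖ, hϖ, hϖ2⟩ := Set.exists_of_ssubset hlt
  have hϖ0 : ϖ ≠ 0 := fun h => hϖ2 (h ▸ zero_mem _)
  have hK : algebraMap B K ϖ ≠ 0 := by simpa using hϖ0
  obtain ⟨e, he, j, hj, hj'⟩ := exists_pow_center (hv := hv) h hϖ0
  have he1 : e < 2 := by
    by_contra h'
    exact hϖ2 (Ideal.pow_le_pow_right (not_lt.1 h') he)
  have hPdvd : ∀ b ∈ center v hv, ϖ ∣ b * j := fun b hb => hj' b (by
    interval_cases e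
    · rw [pow_zero, Ideal.one_eq_top]; trivial
    · rwa [pow_one])
  have hpow : ∀ e, ∀ b ∈ center v hv ^ e, ϖ ^ e ∣ b * j ^ e := by
    intro e
    induction e with
    | zero => intro b _; simp
    | succ e ih =>
      intro b hb
      rw [pow_succ] at hb
      refine Submodule.mul_induction_on hb (fun x hx y hy => ?_) fun x y hx hy => ?_
      · have := mul_dvd_mul (ih x hx) (hPdvd y hy)
        rw [pow_succ]
        convert this using 1; ring
      · rw [add_mul]; exact dvd_add hx hy
  have hB : ∀ g : B, g ≠ 0 → ∃ e : ℕ, algebraMap B K g / algebraMap B K ϖ ^ e ∈ v ∧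
      algebraMap B K ϖ ^ e / algebraMap B K g ∈ v := by
    intro g hg
    obtain ⟨e, he, i, hi, hi'⟩ := exists_pow_center (hv := hv) h hg
    refine ⟨e, ?_, ?_⟩
    · rw [← map_pow]
      exact div_mem_of_mem_pow (pow_ne_zero _ hϖ0) (fun h => hj (hp.mem_of_pow_mem _ h)) (hpow e g he)
    · rw [← map_pow]
      exact div_mem_of_mem_pow hg hi (hi' _ (Ideal.pow_mem_pow hϖ e))
  refine ⟨algebraMap B K ϖ, hK, mem_center.1 hϖ, fun a ha => ?_⟩
  obtain ⟨p, q, hq, rfl⟩ := IsFractionRing.div_surjective (A := B) a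
  have hq0 : q ≠ 0 := nonZeroDivisors.ne_zero hq
  have hp0 : p ≠ 0 := by rintro rfl; simp at ha
  have hq1 : algebraMap B K q ≠ 0 := by simpa using hq0
  have hp1 : algebraMap B K p ≠ 0 := by simpa using hp0
  obtain ⟨e, h1, h2⟩ := hB p hp0
  obtain ⟨f, h3, h4⟩ := hB q hq0
  refine ⟨(f : ℤ) - e, ?_, ?_⟩
  · have := v.mul_mem _ _ h1 h4
    convert this using 1
    rw [zpow_sub₀ hK, zpow_natCast, zpow_natCast]
    field_simp
  · have := v.mul_mem _ _ h2 h3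
    convert this using 1
    rw [zpow_sub₀ hK, zpow_natCast, zpow_natCast]
    field_simp

theorem eq_of_center_eq (hw' : w ≠ ⊤) (h : center v hv ≤ center w hw) : v = w ∨ v = ⊤ := by
  rcases eq_or_ne v ⊤ with hv' | hv'
  · exact Or.inr hv'
  left
  have hpv : (center v hv).IsPrime := center_isPrime
  have hpw : (center w hw).IsPrime := center_isPrime
  have heq : center v hv = center w hw :=
    (hpv.isMaximal (center_ne_bot hv')).eq_of_le hpw.ne_top h
  have key : ∀ {v w : ValuationSubring K} {hv : ∀ b : B, algebraMap B K b ∈ v}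
      {hw : ∀ b : B, algebraMap B K b ∈ w}, v ≠ ⊤ → center v hv = center w hw → v ≤ w := by
    intro v w hv hw hv' h x hx
    have hp : (center v hv).IsPrime := center_isPrime
    obtain ⟨p, q, hq, rfl⟩ := IsFractionRing.div_surjective (A := B) x
    have hq0 : q ≠ 0 := nonZeroDivisors.ne_zero hq
    have hq1 : algebraMap B K q ≠ 0 := by simpa using hq0
    rcases dvd_or_dvd_away (center v hv) (center_ne_bot hv') p q with ⟨s, hs, c, h1⟩ | ⟨s, hs, c, h1⟩
    · exact div_mem_of_mem_pow hq0 (h ▸ hs : s ∉ center w hw) ⟨c, by linear_combination h1⟩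
    · rcases eq_or_ne p 0 with rfl | hp0
      · simp
      have h2 := div_mem_of_mem_pow (K := K) (v := v) hp0 hs ⟨c, show q * s = p * c by linear_combination h1⟩
      have h4 : c ∉ center v hv := by
        intro hc
        apply hs
        have hs0 : algebraMap B K s = algebraMap B K p / algebraMap B K q * algebraMap B K c := by
          have := congrArg (algebraMap B K) h1
          rw [map_mul, map_mul] at this
          field_simp; linear_combination this
        rw [mem_center, hs0]
        exact mul_mem_nonunits hx (mem_center.1 hc)
      have h5 : algebraMap B K p / algebraMap B K q = algebraMap B K s / algebraMap B K c := by
        have hc0 : c ≠ 0 := fun h => h4 (h ▸ zero_mem _)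
        have hc1 : algebraMap B K c ≠ 0 := by simpa using hc0
        have := congrArg (algebraMap B K) h1
        rw [map_mul, map_mul] at this
        field_simp; linear_combination -this
      rw [h5, div_eq_mul_inv]
      exact w.mul_mem _ _ (hw s) (inv_mem_of_notMem_nonunits fun h' => h4 (h ▸ mem_center.2 h'))
  exact le_antisymm (key hv' heq) (key hw' heq.symm)

theorem eq_or_eq_top_of_le (hv : ∀ b : B, algebraMap B K b ∈ v) (h : v ≤ w) : v = w ∨ w = ⊤ := by
  have hw : ∀ b : B, algebraMap B K b ∈ w := fun b => h (hv b)
  rcases eq_or_ne v ⊤ with rfl | hv'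
  · exact Or.inr (top_le_iff.1 h)
  have h1 : center w hw ≤ center v hv := by
    intro b hb
    rw [mem_center] at hb ⊢
    exact ValuationSubring.nonunits_le_nonunits.2 h hb
  rcases eq_of_center_eq hv' h1 with h2 | h2
  · exact Or.inl h2.symm
  · exact Or.inr h2

/-- Chinese remainder theorem: some element of `B` is close to `1` at `v` and close to `0` at
finitely many other places. -/
theorem exists_approx_of_dedekind (hv : ∀ b : B, algebraMap B K b ∈ v) (hv' : v ≠ ⊤)
    (S : Finset (ValuationSubring K))
    (hS : ∀ w ∈ S, (∀ b : B, algebraMap B K b ∈ w) ∧ w ≠ ⊤) (hvS : v ∉ S) (g : B) (hg : g ≠ 0) :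
    ∃ h : B, (algebraMap B K h - 1) / algebraMap B K g ∈ v ∧
      ∀ w ∈ S, algebraMap B K h / algebraMap B K g ∈ w := by
  classical
  let P : ValuationSubring K → Ideal B := fun w =>
    if hw : ∀ b : B, algebraMap B K b ∈ w then center w hw else ⊤
  have hP : ∀ w (hw : ∀ b : B, algebraMap B K b ∈ w), P w = center w hw := fun w hw => dif_pos hw
  have hall : ∀ w ∈ insert v S, (∀ b : B, algebraMap B K b ∈ w) ∧ w ≠ ⊤ := by
    intro w hw
    rcases Finset.mem_insert.1 hw with rfl | hw
    · exact ⟨hv, hv'⟩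
    · exact hS w hw
  have hexp : ∀ w, ∃ e : ℕ, w ∈ insert v S → ∀ b ∈ P w ^ e,
      algebraMap B K b / algebraMap B K g ∈ w := by
    intro w
    by_cases hw : w ∈ insert v S
    · obtain ⟨e, -, j, hj, h⟩ := exists_pow_center (hv := (hall w hw).1) (hall w hw).2 hg
      refine ⟨e, fun _ b hb => ?_⟩
      rw [hP w (hall w hw).1] at hb
      exact div_mem_of_mem_pow hg hj (h b hb)
    · exact ⟨0, fun h => absurd h hw⟩
  choose e he using hexp
  obtain ⟨y, hy⟩ := IsDedekindDomain.exists_forall_sub_mem_ideal (s := insert v S) P e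
    (fun w hw => by
      rw [hP w (hall w hw).1]
      exact Ideal.prime_of_isPrime (center_ne_bot (hall w hw).2) center_isPrime)
    (fun w hw w' hw' hne heq => by
      rw [hP w (hall w hw).1, hP w' (hall w' hw').1] at heq
      rcases eq_of_center_eq (hall w' hw').2 heq.le with h | h
      · exact hne h
      · exact (hall w hw).2 h)
    (fun w => if w.1 = v then 1 else 0)
  refine ⟨y, ?_, fun w hw => ?_⟩
  · have h1 := he v (Finset.mem_insert_self _ _) _ (hy v (Finset.mem_insert_self _ _))
    rwa [if_pos rfl, map_sub, map_one] at h1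
  · have h1 := he w (Finset.mem_insert_of_mem hw) _ (hy w (Finset.mem_insert_of_mem hw))
    have hne : ¬ w = v := by rintro rfl; exact hvS hw
    rwa [if_neg hne, sub_zero] at h1

end Dedekind

/-! ### Function fields of one variable -/

section FunctionField

variable {E K : Type u} [Field E] [Field K] [Algebra E K]

variable (E) in
/-- `t` is a transcendental element over which `K` is separable algebraic. -/
structure IsSeparating (t : K) : Prop where
  transcendental : Transcendental E t
  separable : Algebra.IsSeparable (IntermediateField.adjoin E {t}) K

theorem IsSeparating.inv {t : K} (ht : IsSeparating E t) : IsSeparating E t⁻¹ where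
  transcendental h := ht.transcendental (by simpa using h.inv)
  separable := by
    have hinv : IntermediateField.adjoin E {t⁻¹} = IntermediateField.adjoin E {t} := by
      apply le_antisymm <;> rw [IntermediateField.adjoin_simple_le_iff]
      · exact inv_mem (IntermediateField.mem_adjoin_simple_self E t)
      · have := inv_mem (IntermediateField.mem_adjoin_simple_self E t⁻¹)
        rwa [inv_inv] at this
    rw [hinv]; exact ht.separable

theorem IsSeparating.ne_zero {t : K} (ht : IsSeparating E t) : t ≠ 0 := by
  rintro rfl; exact ht.transcendental isAlgebraic_zero

theorem exists_isSeparating [Finite E] [Algebra.EssFiniteType E K] (htr : Algebra.trdeg E K = 1) :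
    ∃ t : K, IsSeparating E t := by
  obtain ⟨s, hs, hsep⟩ := exists_isTranscendenceBasis_and_isSeparable_of_perfectField E K
  have hcard : s.card = 1 := by
    have := hs.cardinalMk_eq_trdeg
    rw [htr] at this
    simpa using this
  obtain ⟨t, rfl⟩ := Finset.card_eq_one.1 hcard
  refine ⟨t, by simpa using hs.1.transcendental ⟨t, by simp⟩, ?_⟩
  rwa [Finset.coe_singleton] at hsep


open scoped IntermediateField.algebraAdjoinAdjoin in
theorem IsSeparating.isDedekindDomain [Algebra.EssFiniteType E K] {t : K} (ht : IsSeparating E t) :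
    IsDedekindDomain (integralClosure (Algebra.adjoin E {t}) K) ∧
      IsFractionRing (integralClosure (Algebra.adjoin E {t}) K) K := by
  let A := Algebra.adjoin E {t}
  let F := IntermediateField.adjoin E {t}
  have := ht.separable
  have : Algebra.IsAlgebraic F K := inferInstance
  have e : Polynomial E ≃ₐ[E] A :=
    AlgEquiv.ofInjective (Polynomial.aeval t) (transcendental_iff_injective.1 ht.transcendental) |>.trans
      (Subalgebra.equivOfEq _ _ (Algebra.adjoin_singleton_eq_range_aeval E t).symm)
  have : IsPrincipalIdealRing A := IsPrincipalIdealRing.of_surjective e.toRingEquiv e.surjective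
  have : Algebra.EssFiniteType F K := Algebra.EssFiniteType.of_comp E F K
  have : FiniteDimensional F K := Algebra.finite_of_essFiniteType_of_isAlgebraic
  have : IsScalarTower A F K := inferInstance
  exact ⟨integralClosure.isDedekindDomain A F (L := K),
    IsIntegralClosure.isFractionRing_of_finite_extension A F K (integralClosure A K)⟩

theorem IsSeparating.finiteDimensional [Algebra.EssFiniteType E K] {t : K} (ht : IsSeparating E t) :
    FiniteDimensional (IntermediateField.adjoin E {t}) K := by
  have := ht.separable
  have : Algebra.EssFiniteType (IntermediateField.adjoin E {t}) K :=
    Algebra.EssFiniteType.of_comp E _ K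
  exact Algebra.finite_of_essFiniteType_of_isAlgebraic

theorem mem_of_mem_integralClosure {v : ValuationSubring K} {t : K}
    (hE : ∀ c : E, algebraMap E K c ∈ v) (htv : t ∈ v)
    (b : integralClosure (Algebra.adjoin E {t}) K) : algebraMap _ K b ∈ v := by
  have hA : ∀ x : Algebra.adjoin E {t}, (x : K) ∈ v := by
    rintro ⟨x, hx⟩
    induction hx using Algebra.adjoin_induction with
    | mem x hx => exact (Set.mem_singleton_iff.1 hx : x = t) ▸ htv
    | algebraMap r => exact hE r
    | add x y _ _ hx hy => exact v.add_mem _ _ hx hy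
    | mul x y _ _ hx hy => exact v.mul_mem _ _ hx hy
  obtain ⟨p, hp, hpe⟩ := b.2
  have hint : IsIntegral v (b : K) := by
    let ψ : Algebra.adjoin E {t} →+* v := (Algebra.adjoin E {t}).val.toRingHom.codRestrict v.toSubring hA
    refine ⟨p.map ψ, hp.map _, ?_⟩
    rw [Polynomial.eval₂_map]
    exact hpe
  obtain ⟨y, hy⟩ := IsIntegrallyClosed.isIntegral_iff.1 hint
  rw [show algebraMap (integralClosure (Algebra.adjoin E {t}) K) K b = y from hy.symm]
  exact y.2

theorem mem_integralClosure_of_forall {t b : K}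
    (h : ∀ v : ValuationSubring K, (∀ c : E, algebraMap E K c ∈ v) → t ∈ v → b ∈ v) :
    b ∈ integralClosure (Algebra.adjoin E {t}) K := by
  have h1 : b ∈ (⨅ v : {v : ValuationSubring K // Set.range (algebraMap E K) ∪ {t} ⊆ (v : Set K)},
      (v : ValuationSubring K).toSubring) := by
    rw [Subring.mem_iInf]
    rintro ⟨v, hv⟩
    exact h v (fun c => hv (Or.inl ⟨c, rfl⟩)) (hv (Or.inr rfl))
  have h2 := iInf_valuationSubring_superset (K := K) (s := Set.range (algebraMap E K) ∪ {t})
  have h3 : b ∈ (integralClosure (Subring.closure (Set.range (algebraMap E K) ∪ {t})) K).toSubring := by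
    rw [← h2]; exact h1
  obtain ⟨p, hp, hpe⟩ := h3
  have hle : ∀ x ∈ Subring.closure (Set.range (algebraMap E K) ∪ {t}), x ∈ Algebra.adjoin E {t} := by
    intro x hx
    have h4 := Algebra.adjoin_eq_ring_closure (R := E) ({t} : Set K)
    rw [← h4] at hx
    exact hx
  let ψ : Subring.closure (Set.range (algebraMap E K) ∪ {t}) →+* Algebra.adjoin E {t} :=
    (Subring.subtype _).codRestrict (Algebra.adjoin E {t}).toSubring fun x => hle x x.2
  refine ⟨p.map ψ, hp.map _, ?_⟩
  rw [Polynomial.eval₂_map]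
  exact hpe

variable [Algebra.EssFiniteType E K]

theorem exists_isUniformizer {t : K} (ht : IsSeparating E t) {v : ValuationSubring K}
    (hE : ∀ c : E, algebraMap E K c ∈ v) (hv : v ≠ ⊤) : ∃ π, IsUniformizer v π := by
  wlog htv : t ∈ v generalizing t
  · exact this ht.inv ((v.mem_or_inv_mem t).resolve_left htv)
  obtain ⟨h1, h2⟩ := ht.isDedekindDomain
  exact exists_isUniformizer_of_dedekind (mem_of_mem_integralClosure hE htv) hv

theorem eq_or_eq_top_of_valuationSubring_le {t : K} (ht : IsSeparating E t)
    {v w : ValuationSubring K} (hE : ∀ c : E, algebraMap E K c ∈ v) (h : v ≤ w) :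
    v = w ∨ w = ⊤ := by
  wlog htv : t ∈ v generalizing t
  · exact this ht.inv ((v.mem_or_inv_mem t).resolve_left htv)
  obtain ⟨h1, h2⟩ := ht.isDedekindDomain
  exact eq_or_eq_top_of_le (mem_of_mem_integralClosure hE htv) h

theorem finite_poles_of_isSeparating {t : K} (ht : IsSeparating E t) (a : K) :
    {v : ValuationSubring K | (∀ c : E, algebraMap E K c ∈ v) ∧ a ∉ v}.Finite := by
  have := ht.separable
  have := ht.inv.separable
  refine ((finite_poles_aux2 t ht.transcendental a).union
    (finite_poles_aux2 t⁻¹ ht.inv.transcendental a)).subset ?_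
  rintro v ⟨h1, h2⟩
  rcases v.mem_or_inv_mem t with h | h
  · exact Or.inl ⟨h1, h, h2⟩
  · exact Or.inr ⟨h1, h, h2⟩

end FunctionField


/-! ### The function field of `C_L` -/

section FunField

variable {k Q L : Type u} [Field k] [Field Q] [Algebra k Q] [IsCurve k Q] [Field L] [Algebra k L]

theorem algebraMap_tensor_injective :
    Function.Injective (algebraMap (L ⊗[k] Q) (FunField k Q L)) :=
  IsFractionRing.injective _ _

theorem algebraMap_tmul (l : L) (a : Q) : algebraMap (L ⊗[k] Q) (FunField k Q L) (l ⊗ₜ a) =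
    algebraMap L (FunField k Q L) l * ofQ k Q L a := by
  rw [IsScalarTower.algebraMap_apply L (L ⊗[k] Q) (FunField k Q L), ofQ]
  simp only [RingHom.comp_apply]
  rw [← map_mul]
  congr 1
  simp [Algebra.TensorProduct.algebraMap_apply]

theorem algebraMap_algebraMap (s : k) : algebraMap L (FunField k Q L) (algebraMap k L s) =
    ofQ k Q L (algebraMap k Q s) := by
  have h1 := algebraMap_tmul (k := k) (Q := Q) (algebraMap k L s) (1 : Q)
  have h2 := algebraMap_tmul (k := k) (L := L) (1 : L) (algebraMap k Q s)
  rw [map_one, mul_one] at h1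
  rw [map_one, one_mul] at h2
  rw [← h1, ← h2, Algebra.algebraMap_eq_smul_one (A := L), Algebra.algebraMap_eq_smul_one (A := Q),
    TensorProduct.smul_tmul]

theorem linearIndependent_ofQ {ι : Type*} {a : ι → Q} (ha : LinearIndependent k a) :
    LinearIndependent L fun i => ofQ k Q L (a i) := by
  have h := Module.Flat.linearIndependent_one_tmul (S := L) ha
  have h1 := h.map' (IsScalarTower.toAlgHom L (L ⊗[k] Q) (FunField k Q L)).toLinearMap
    (LinearMap.ker_eq_bot.2 algebraMap_tensor_injective)
  exact h1

instance : Algebra.EssFiniteType L (FunField k Q L) := by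
  have := IsCurve.essFiniteType (k := k) (Q := Q)
  have : Algebra.EssFiniteType (L ⊗[k] Q) (FunField k Q L) :=
    Algebra.EssFiniteType.of_isLocalization _ (nonZeroDivisors (L ⊗[k] Q))
  exact Algebra.EssFiniteType.comp L (L ⊗[k] Q) (FunField k Q L)

theorem tensor_mem {R : Subring (FunField k Q L)} (hL : ∀ l : L, algebraMap L (FunField k Q L) l ∈ R)
    (hQ : ∀ a : Q, ofQ k Q L a ∈ R) (p : L ⊗[k] Q) :
    algebraMap (L ⊗[k] Q) (FunField k Q L) p ∈ R := by
  induction p with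
  | zero => rw [map_zero]; exact R.zero_mem
  | tmul l a => rw [algebraMap_tmul]; exact R.mul_mem (hL l) (hQ a)
  | add p q hp hq => rw [map_add]; exact R.add_mem hp hq

theorem isSeparating_ofQ {t : Q} (ht : IsSeparating k t) : IsSeparating L (ofQ k Q L t) where
  transcendental := by
    have h : LinearIndependent k fun n : ℕ => t ^ n := by
      have := (Polynomial.basisMonomials k).linearIndependent.map'
        (Polynomial.aeval t).toLinearMap
        (LinearMap.ker_eq_bot.2 (transcendental_iff_injective.1 ht.transcendental))
      have e : (fun n : ℕ => t ^ n) =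
          (Polynomial.aeval t).toLinearMap ∘ Polynomial.basisMonomials k := by
        ext n; simp
      rw [e]
      exact this
    have h' := linearIndependent_ofQ (L := L) h
    rw [transcendental_iff]
    intro p hp
    rw [Polynomial.aeval_eq_sum_range] at hp
    simp only [map_pow] at h'
    have h0 := linearIndependent_iff'.1 h' _ p.coeff hp
    ext n
    rw [Polynomial.coeff_zero]
    by_cases hn : n ≤ p.natDegree
    · exact h0 n (Finset.mem_range.2 (by omega))
    · exact Polynomial.coeff_eq_zero_of_natDegree_lt (by omega)
  separable := by
    set F := IntermediateField.adjoin k {t}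
    set F' := IntermediateField.adjoin L {ofQ k Q L t} with hF'
    have hkt : ∀ a ∈ F, ofQ k Q L a ∈ F' := by
      intro a ha
      refine IntermediateField.adjoin_induction k (p := fun a _ => ofQ k Q L a ∈ F') ?_ ?_ ?_ ?_ ?_ ha
      · rintro _ rfl
        exact IntermediateField.mem_adjoin_simple_self _ _
      · intro s
        rw [← algebraMap_algebraMap]
        exact F'.algebraMap_mem _
      · intro x y _ _ hx hy; rw [map_add]; exact F'.add_mem hx hy
      · intro x _ hx; rw [map_inv₀]; exact F'.inv_mem hx
      · intro x y _ _ hx hy; rw [map_mul]; exact F'.mul_mem hx hy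
    let ψ : F →+* F' := ((ofQ k Q L).comp F.val.toRingHom).codRestrict F'.toSubring
      fun a => hkt a a.2
    have hsep : ∀ a : Q, ofQ k Q L a ∈ separableClosure F' (FunField k Q L) := by
      intro a
      rw [mem_separableClosure_iff]
      have h1 : IsSeparable F a := ht.separable.isSeparable' a
      have h2 : ((minpoly F a).map ψ).Separable := Polynomial.Separable.map h1
      refine h2.of_dvd (minpoly.dvd _ _ ?_)
      rw [Polynomial.aeval_def, Polynomial.eval₂_map]
      have h3 : (algebraMap F' (FunField k Q L)).comp ψ = (ofQ k Q L).comp (algebraMap F Q) := rfl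
      rw [h3, ← Polynomial.hom_eval₂, ← Polynomial.aeval_def, minpoly.aeval, map_zero]
    rw [← separableClosure.eq_top_iff, eq_top_iff]
    rintro a -
    obtain ⟨p, s, -, rfl⟩ := IsFractionRing.div_surjective (A := L ⊗[k] Q) a
    have hmem := tensor_mem (k := k) (Q := Q) (L := L) (R := (separableClosure F' (FunField k Q L)).toSubring)
      (fun l => (separableClosure F' (FunField k Q L)).algebraMap_mem (algebraMap L F' l)) hsep
    exact (separableClosure F' (FunField k Q L)).div_mem (hmem p) (hmem s)

end FunField

theorem exists_isSeparating_curve (k Q : Type u) [Field k] [Finite k] [Field Q] [Algebra k Q]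
    [IsCurve k Q] : ∃ t : Q, IsSeparating k t :=
  have := IsCurve.essFiniteType (k := k) (Q := Q)
  exists_isSeparating IsCurve.trdeg_eq_one

section Curve

variable (k : Type u) {Q : Type u} [Field k] [Finite k] [Field Q] [Algebra k Q]

theorem algebraMap_mem_valuationSubring (v : ValuationSubring Q) (s : k) :
    algebraMap k Q s ∈ v := by
  have : Fintype k := Fintype.ofFinite k
  have h : IsIntegral v (algebraMap k Q s) := by
    refine ⟨Polynomial.X ^ Fintype.card k - Polynomial.X,
      Polynomial.monic_X_pow_sub (by simpa using Fintype.one_lt_card), ?_⟩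
    simp [← map_pow, FiniteField.pow_card]
  obtain ⟨y, hy⟩ := IsIntegrallyClosed.isIntegral_iff.1 h
  rw [← hy]
  exact y.2

theorem eq_or_eq_top_of_le_curve [IsCurve k Q] {v w : ValuationSubring Q} (h : v ≤ w) :
    v = w ∨ w = ⊤ := by
  obtain ⟨t, ht⟩ := exists_isSeparating_curve k Q
  have := IsCurve.essFiniteType (k := k) (Q := Q)
  exact eq_or_eq_top_of_valuationSubring_le ht (algebraMap_mem_valuationSubring k v) h

theorem exists_isUniformizer_curve [IsCurve k Q] {v : ValuationSubring Q} (h : v ≠ ⊤) :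
    ∃ π, IsUniformizer v π := by
  obtain ⟨t, ht⟩ := exists_isSeparating_curve k Q
  have := IsCurve.essFiniteType (k := k) (Q := Q)
  exact exists_isUniformizer ht (algebraMap_mem_valuationSubring k v) h

end Curve

section Points

variable {k Q L : Type u} [Field k] [Field Q] [Algebra k Q] [IsCurve k Q] [Field L] [Algebra k L]

theorem Point.finite_poles [Finite k] (a : FunField k Q L) : {x : Point k Q L | a ∉ x.ring}.Finite := by
  obtain ⟨t, ht⟩ := exists_isSeparating_curve k Q
  refine Set.Finite.of_finite_image (f := Point.ring) ?_ ?_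
  · refine (finite_poles_of_isSeparating (isSeparating_ofQ (L := L) ht) a).subset ?_
    rintro _ ⟨x, hx, rfl⟩
    exact ⟨x.algebraMap_mem, hx⟩
  · intro x _ y _ h
    exact Point.ext h

theorem ofQ_mem {x : Point k Q L} {a : Q} : ofQ k Q L a ∈ x.ring ↔ a ∈ x.toCurve := Iff.rfl

theorem ofQ_mem_nonunits {x : Point k Q L} {a : Q} :
    ofQ k Q L a ∈ x.ring.nonunits ↔ a ∈ x.toCurve.nonunits := by
  rw [ValuationSubring.mem_nonunits_iff_or, ValuationSubring.mem_nonunits_iff_or, ← map_inv₀,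
    ofQ_mem, map_eq_zero]

theorem algebraMap_notMem_nonunits (x : Point k Q L) {l : L} (hl : l ≠ 0) :
    algebraMap L (FunField k Q L) l ∉ x.ring.nonunits :=
  notMem_nonunits (by simpa using hl) (by rw [← map_inv₀]; exact x.algebraMap_mem _)

/-- The generic point of `C_L`. -/
noncomputable def Point.generic (k Q L : Type u) [Field k] [Field Q] [Algebra k Q] [IsCurve k Q] [Field L]
    [Algebra k L] : Point k Q L where
  ring := ⊤
  algebraMap_mem _ := ValuationSubring.mem_top _

/-! ### Points over a rational point -/

section Rational

variable {inf : ValuationSubring Q} (hinf : IsRationalPoint k inf) {π : Q}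
  (hπ : IsUniformizer inf π)
include hinf hπ

theorem exists_residue_tensor (p : L ⊗[k] Q) (hp : p ≠ 0) :
    ∃ (n : ℤ) (l : L), l ≠ 0 ∧ ∀ x : Point k Q L, x.toCurve = inf →
      algebraMap _ (FunField k Q L) p * ofQ k Q L π ^ n - algebraMap L _ l ∈ x.ring.nonunits := by
  classical
  obtain ⟨c, rfl⟩ := TensorProduct.eq_repr_basis_left (Module.Basis.ofVectorSpace k L) p
  set b := Module.Basis.ofVectorSpace k L
  have hne : c.support.Nonempty := by
    rw [Finsupp.support_nonempty_iff]
    rintro rfl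
    exact hp (by simp)
  have hz : ∀ i, ∃ n : ℤ, c i ≠ 0 → c i * π ^ n ∈ inf ∧ (c i * π ^ n)⁻¹ ∈ inf := by
    intro i
    by_cases h : c i = 0
    · exact ⟨0, fun h' => absurd h h'⟩
    · obtain ⟨n, hn⟩ := hπ.zpow _ h
      exact ⟨n, fun _ => hn⟩
  choose n hn using hz
  obtain ⟨i₀, hi₀, hmax⟩ := c.support.exists_max_image n hne
  have hmem : ∀ i, c i * π ^ n i₀ ∈ inf := by
    intro i
    by_cases h : c i = 0
    · rw [h, zero_mul]; exact inf.zero_mem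
    · obtain ⟨m, hm⟩ := Int.eq_ofNat_of_zero_le
        (sub_nonneg.2 (hmax i (Finsupp.mem_support_iff.2 h)))
      have : c i * π ^ n i₀ = c i * π ^ n i * π ^ m := by
        rw [mul_assoc, ← zpow_natCast, ← hm, ← zpow_add₀ hπ.ne_zero]; congr 2; ring
      rw [this]
      exact inf.mul_mem _ _ (hn i h).1 (pow_mem (ValuationSubring.nonunits_subset hπ.mem) m)
  choose s hs using fun i => hinf.2 _ (hmem i)
  have hs0 : s i₀ ≠ 0 := by
    intro h
    have h1 := hs i₀
    rw [h, map_zero, sub_zero] at h1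
    have h2 := Finsupp.mem_support_iff.1 hi₀
    exact notMem_nonunits (mul_ne_zero h2 (zpow_ne_zero _ hπ.ne_zero)) (hn i₀ h2).2 h1
  refine ⟨n i₀, ∑ i ∈ c.support, s i • b i, ?_, fun x hx => ?_⟩
  · intro h
    exact hs0 (linearIndependent_iff'.1 b.linearIndependent _ s h i₀ hi₀)
  · have h1 : algebraMap _ (FunField k Q L) (c.sum fun i a => b i ⊗ₜ[k] a) * ofQ k Q L π ^ n i₀ -
        algebraMap L _ (∑ i ∈ c.support, s i • b i) =
        ∑ i ∈ c.support, algebraMap L (FunField k Q L) (b i) *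
          ofQ k Q L (c i * π ^ n i₀ - algebraMap k Q (s i)) := by
      rw [Finsupp.sum, map_sum, map_sum, Finset.sum_mul, ← Finset.sum_sub_distrib]
      refine Finset.sum_congr rfl fun i _ => ?_
      rw [algebraMap_tmul, Algebra.smul_def, map_mul, algebraMap_algebraMap, map_sub, map_mul,
        map_zpow₀]
      ring
    rw [h1]
    refine sum_mem fun i _ => mul_mem_nonunits (x.algebraMap_mem _) ?_
    rw [ofQ_mem_nonunits, hx]
    exact hs i

theorem exists_residue (a : FunField k Q L) (ha : a ≠ 0) :
    ∃ (n : ℤ) (l : L), l ≠ 0 ∧ ∀ x : Point k Q L, x.toCurve = inf →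
      a * ofQ k Q L π ^ n - algebraMap L _ l ∈ x.ring.nonunits := by
  obtain ⟨p, s, hs, rfl⟩ := IsFractionRing.div_surjective (A := L ⊗[k] Q) a
  have hs0 : s ≠ 0 := nonZeroDivisors.ne_zero hs
  have hp0 : p ≠ 0 := by rintro rfl; simp at ha
  obtain ⟨n, l, hl, h⟩ := exists_residue_tensor (L := L) hinf hπ p hp0
  obtain ⟨m, l', hl', h'⟩ := exists_residue_tensor (L := L) hinf hπ s hs0
  refine ⟨n - m, l / l', div_ne_zero hl hl', fun x hx => ?_⟩
  have hπ0 : ofQ k Q L π ≠ 0 := by simpa using hπ.ne_zero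
  have hsK : algebraMap _ (FunField k Q L) s ≠ 0 := by
    simpa using algebraMap_tensor_injective.ne hs0
  have hlK : algebraMap L (FunField k Q L) l' ≠ 0 := by simpa using hl'
  set A := algebraMap _ (FunField k Q L) p * ofQ k Q L π ^ n with hA
  set S := algebraMap _ (FunField k Q L) s * ofQ k Q L π ^ m with hS
  have hS0 : S ≠ 0 := mul_ne_zero hsK (zpow_ne_zero _ hπ0)
  have hSu : S⁻¹ ∈ x.ring := by
    refine inv_mem_of_notMem_nonunits fun hS' => algebraMap_notMem_nonunits x hl' ?_
    have := sub_mem hS' (h' x hx)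
    rwa [sub_sub_cancel] at this
  have e : algebraMap _ (FunField k Q L) p / algebraMap _ (FunField k Q L) s * ofQ k Q L π ^ (n - m) -
      algebraMap L _ (l / l') = S⁻¹ * ((A - algebraMap L _ l) -
        algebraMap L (FunField k Q L) (l / l') * (S - algebraMap L _ l')) := by
    have e1 : algebraMap _ (FunField k Q L) p / algebraMap _ (FunField k Q L) s * ofQ k Q L π ^ (n - m) =
        A / S := by
      rw [hA, hS, zpow_sub₀ hπ0, div_mul_div_comm]
    rw [e1, map_div₀]
    field_simp
    ring
  rw [e]
  exact mul_mem_nonunits hSu (sub_mem (h x hx) (mul_mem_nonunits (x.algebraMap_mem _) (h' x hx)))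

theorem isUniformizer_ofQ {x : Point k Q L} (hx : x.toCurve = inf) :
    IsUniformizer x.ring (ofQ k Q L π) where
  ne_zero := by simpa using hπ.ne_zero
  mem := by rw [ofQ_mem_nonunits, hx]; exact hπ.mem
  zpow a ha := by
    obtain ⟨n, l, hl, h⟩ := exists_residue (L := L) hinf hπ a ha
    refine ⟨n, ?_, inv_mem_of_notMem_nonunits fun h' => algebraMap_notMem_nonunits x hl ?_⟩
    · have := x.ring.add_mem _ _ (ValuationSubring.nonunits_subset (h x hx)) (x.algebraMap_mem l)
      rwa [sub_add_cancel] at this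
    · have := sub_mem h' (h x hx)
      rwa [sub_sub_cancel] at this

theorem Point.eq_of_toCurve_eq {x y : Point k Q L} (hx : x.toCurve = inf) (hy : y.toCurve = inf) :
    x = y := by
  have key : ∀ {x y : Point k Q L}, x.toCurve = inf → y.toCurve = inf → x.ring ≤ y.ring := by
    intro x y hx hy a ha
    rcases eq_or_ne a 0 with rfl | ha0
    · exact y.ring.zero_mem
    obtain ⟨n, l, hl, h⟩ := exists_residue (L := L) hinf hπ a ha0
    have hπ0 : ofQ k Q L π ≠ 0 := by simpa using hπ.ne_zero
    have hun : ∀ z : Point k Q L, z.toCurve = inf → a * ofQ k Q L π ^ n ∈ z.ring ∧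
        (a * ofQ k Q L π ^ n)⁻¹ ∈ z.ring := by
      intro z hz
      refine ⟨?_, inv_mem_of_notMem_nonunits fun h' => algebraMap_notMem_nonunits z hl ?_⟩
      · have := z.ring.add_mem _ _ (ValuationSubring.nonunits_subset (h z hz)) (z.algebraMap_mem l)
        rwa [sub_add_cancel] at this
      · have := sub_mem h' (h z hz)
        rwa [sub_sub_cancel] at this
    have hn : n ≤ 0 := by
      by_contra hn
      obtain ⟨m, rfl⟩ : ∃ m : ℕ, n = m + 1 := ⟨(n - 1).toNat, by omega⟩
      have h1 : a * ofQ k Q L π ^ ((m : ℤ) + 1) ∈ x.ring.nonunits := by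
        rw [zpow_add₀ hπ0, zpow_one, ← mul_assoc, zpow_natCast]
        refine mul_mem_nonunits (x.ring.mul_mem _ _ ha (pow_mem ?_ m)) ?_
        · exact ValuationSubring.nonunits_subset (isUniformizer_ofQ hinf hπ hx).mem
        · exact (isUniformizer_ofQ hinf hπ hx).mem
      exact notMem_nonunits (mul_ne_zero ha0 (zpow_ne_zero _ hπ0)) (hun x hx).2 h1
    obtain ⟨m, rfl⟩ : ∃ m : ℕ, n = -m := ⟨(-n).toNat, by omega⟩
    have : a = (a * ofQ k Q L π ^ (-(m : ℤ))) * ofQ k Q L π ^ m := by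
      rw [zpow_neg, zpow_natCast]; field_simp
    rw [this]
    exact y.ring.mul_mem _ _ (hun y hy).1 (pow_mem (ValuationSubring.nonunits_subset
      (isUniformizer_ofQ hinf hπ hy).mem) m)
  exact Point.ext (le_antisymm (key hx hy) (key hy hx))

theorem exists_residue_of_mem {x : Point k Q L} (hx : x.toCurve = inf) {a : FunField k Q L}
    (ha : a ∈ x.ring) : ∃ l : L, ∃ b ∈ x.ring, a = algebraMap L _ l + ofQ k Q L π * b := by
  have hu := isUniformizer_ofQ (L := L) hinf hπ hx
  have hπ0 := hu.ne_zero
  have hdiv : ∀ b ∈ x.ring.nonunits, ∃ c ∈ x.ring, b = ofQ k Q L π * c := by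
    intro b hb
    rcases eq_or_ne b 0 with rfl | hb0
    · exact ⟨0, x.ring.zero_mem, by simp⟩
    obtain ⟨n, h1, h2⟩ := hu.zpow b hb0
    have hn : n ≤ -1 := by
      by_contra hn
      obtain ⟨m, rfl⟩ : ∃ m : ℕ, n = m := ⟨n.toNat, by omega⟩
      refine notMem_nonunits (mul_ne_zero hb0 (zpow_ne_zero _ hπ0)) h2 ?_
      rw [mul_comm, zpow_natCast]
      exact mul_mem_nonunits (pow_mem (ValuationSubring.nonunits_subset hu.mem) m) hb
    obtain ⟨m, rfl⟩ : ∃ m : ℕ, n = -(m + 1) := ⟨(-n - 1).toNat, by omega⟩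
    refine ⟨b * ofQ k Q L π ^ (-((m : ℤ) + 1)) * ofQ k Q L π ^ m,
      x.ring.mul_mem _ _ h1 (pow_mem (ValuationSubring.nonunits_subset hu.mem) m), ?_⟩
    rw [zpow_neg, zpow_add₀ hπ0, zpow_one, zpow_natCast]
    field_simp
  by_cases han : a ∈ x.ring.nonunits
  · obtain ⟨c, hc, rfl⟩ := hdiv a han
    exact ⟨0, c, hc, by simp⟩
  have ha0 : a ≠ 0 := by rintro rfl; exact han (zero_mem _)
  obtain ⟨n, l, hl, h⟩ := exists_residue (L := L) hinf hπ a ha0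
  have hn : n = 0 := by
    have hinv := inv_mem_of_notMem_nonunits han
    have h1 : a * ofQ k Q L π ^ n ∉ x.ring.nonunits := fun h' => algebraMap_notMem_nonunits x hl (by
      have := sub_mem h' (h x hx)
      rwa [sub_sub_cancel] at this)
    have h2 : a * ofQ k Q L π ^ n ∈ x.ring := by
      have := x.ring.add_mem _ _ (ValuationSubring.nonunits_subset (h x hx)) (x.algebraMap_mem l)
      rwa [sub_add_cancel] at this
    rcases lt_trichotomy n 0 with hn | hn | hn
    · exfalso
      obtain ⟨m, rfl⟩ : ∃ m : ℕ, n = -(m + 1) := ⟨(-n - 1).toNat, by omega⟩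
      apply one_notMem_nonunits x.ring
      have : (1 : FunField k Q L) = (a * ofQ k Q L π ^ (-((m : ℤ) + 1)) * (a⁻¹ * ofQ k Q L π ^ m)) *
          ofQ k Q L π := by
        rw [zpow_neg, zpow_add₀ hπ0, zpow_one, zpow_natCast]
        field_simp
      rw [this]
      exact mul_mem_nonunits (x.ring.mul_mem _ _ h2 (x.ring.mul_mem _ _ hinv
        (pow_mem (ValuationSubring.nonunits_subset hu.mem) m))) hu.mem
    · exact hn
    · exfalso
      obtain ⟨m, rfl⟩ : ∃ m : ℕ, n = m + 1 := ⟨(n - 1).toNat, by omega⟩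
      apply h1
      rw [zpow_add₀ hπ0, zpow_one, ← mul_assoc, zpow_natCast]
      exact mul_mem_nonunits (x.ring.mul_mem _ _ ha
        (pow_mem (ValuationSubring.nonunits_subset hu.mem) m)) hu.mem
  rw [hn, zpow_zero, mul_one] at h
  obtain ⟨c, hc, hc'⟩ := hdiv _ (h x hx)
  exact ⟨l, c, hc, by rw [← hc']; ring⟩

end Rational

end Points


/-! ### Frobenius maps -/

section Frobenius

variable {k Q L : Type u} [Field k] [Fintype k] [Field Q] [Algebra k Q] [Field L] [Algebra k L]

variable (k Q L) in
/-- The endomorphism `b ⊗ a ↦ b ⊗ a ^ q` of `L ⊗ Q`. -/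
noncomputable def frobCurveTensor : L ⊗[k] Q →ₐ[k] L ⊗[k] Q :=
  Algebra.TensorProduct.map (AlgHom.id k L) (FiniteField.frobeniusAlgHom k Q)

theorem sigmaTensor_frobCurveTensor (p : L ⊗[k] Q) :
    sigmaTensor k Q L (frobCurveTensor k Q L p) = p ^ Fintype.card k := by
  have h : (sigmaTensor k Q L).comp (frobCurveTensor k Q L) =
      FiniteField.frobeniusAlgHom k (L ⊗[k] Q) := by
    ext a <;> simp [sigmaTensor, frobCurveTensor]
  exact DFunLike.congr_fun h p

theorem frobCurveTensor_sigmaTensor (p : L ⊗[k] Q) :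
    frobCurveTensor k Q L (sigmaTensor k Q L p) = p ^ Fintype.card k := by
  have h : (frobCurveTensor k Q L).comp (sigmaTensor k Q L) =
      FiniteField.frobeniusAlgHom k (L ⊗[k] Q) := by
    ext a <;> simp [sigmaTensor, frobCurveTensor]
  exact DFunLike.congr_fun h p

variable [IsCurve k Q]

theorem frobCurveTensor_injective : Function.Injective (frobCurveTensor k Q L) := by
  rw [injective_iff_map_eq_zero]
  intro p hp
  have h := sigmaTensor_frobCurveTensor p
  rw [hp, map_zero] at h
  exact eq_zero_of_pow_eq_zero h.symm

variable (k Q L) in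
/-- The endomorphism of the function field of `C_L` induced by `Frob_q × id_L`. -/
noncomputable def frobCurve : FunField k Q L →+* FunField k Q L :=
  IsFractionRing.map (A := L ⊗[k] Q) (B := L ⊗[k] Q) (j := (frobCurveTensor k Q L).toRingHom)
    frobCurveTensor_injective

theorem frobCurve_tensor (p : L ⊗[k] Q) :
    frobCurve k Q L (algebraMap (L ⊗[k] Q) (FunField k Q L) p) =
    algebraMap (L ⊗[k] Q) (FunField k Q L) (frobCurveTensor k Q L p) := by
  unfold frobCurve IsFractionRing.map
  exact IsLocalization.map_eq (M := nonZeroDivisors (L ⊗[k] Q)) (S := FunField k Q L) _ p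

theorem sigma_frobCurve (a : FunField k Q L) :
    sigma k Q L (frobCurve k Q L a) = a ^ Fintype.card k := by
  obtain ⟨p, s, hs, rfl⟩ := IsFractionRing.div_surjective (A := L ⊗[k] Q) a
  rw [map_div₀, map_div₀, frobCurve_tensor, frobCurve_tensor, sigma_tensor, sigma_tensor,
    sigmaTensor_frobCurveTensor, sigmaTensor_frobCurveTensor, map_pow, map_pow, div_pow]

theorem frobCurve_sigma (a : FunField k Q L) :
    frobCurve k Q L (sigma k Q L a) = a ^ Fintype.card k := by
  obtain ⟨p, s, hs, rfl⟩ := IsFractionRing.div_surjective (A := L ⊗[k] Q) a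
  rw [map_div₀, map_div₀, sigma_tensor, sigma_tensor, frobCurve_tensor, frobCurve_tensor,
    frobCurveTensor_sigmaTensor, frobCurveTensor_sigmaTensor, map_pow, map_pow, div_pow]

theorem frobCurve_algebraMap (l : L) : frobCurve k Q L (algebraMap L _ l) = algebraMap L _ l := by
  rw [IsScalarTower.algebraMap_apply L (L ⊗[k] Q) (FunField k Q L), frobCurve_tensor]
  simp [frobCurveTensor, Algebra.TensorProduct.algebraMap_apply]

variable (k Q L) in
/-- The action of `σ` on the points of `C_L` as a bijection. -/
noncomputable def frobEquiv : Point k Q L ≃ Point k Q L where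
  toFun := Point.frob
  invFun y :=
    { ring := y.ring.comap (frobCurve k Q L)
      algebraMap_mem l := by
        rw [ValuationSubring.mem_comap, frobCurve_algebraMap]
        exact y.algebraMap_mem l }
  left_inv x := by
    refine Point.ext (SetLike.ext fun a => ?_)
    change sigma k Q L (frobCurve k Q L a) ∈ x.ring ↔ _
    rw [sigma_frobCurve]
    exact ⟨mem_of_pow_mem Fintype.card_pos, fun h => pow_mem h _⟩
  right_inv x := by
    refine Point.ext (SetLike.ext fun a => ?_)
    change frobCurve k Q L (sigma k Q L a) ∈ x.ring ↔ _
    rw [frobCurve_sigma]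
    exact ⟨mem_of_pow_mem Fintype.card_pos, fun h => pow_mem h _⟩

theorem toCurve_frob (x : Point k Q L) : x.frob.toCurve = x.toCurve := by
  ext a
  change sigma k Q L (ofQ k Q L a) ∈ x.ring ↔ _
  rw [sigma_ofQ]; rfl

theorem mem_frob {x : Point k Q L} {a : FunField k Q L} :
    a ∈ x.frob.ring ↔ sigma k Q L a ∈ x.ring := Iff.rfl

theorem mem_nonunits_frob {x : Point k Q L} {a : FunField k Q L} :
    a ∈ x.frob.ring.nonunits ↔ sigma k Q L a ∈ x.ring.nonunits := by
  rw [ValuationSubring.mem_nonunits_iff_or, ValuationSubring.mem_nonunits_iff_or, ← map_inv₀,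
    mem_frob, map_eq_zero]

theorem span_range_sigma : Submodule.span L (Set.range (sigma k Q L)) = ⊤ := by
  rw [eq_top_iff]
  rintro a -
  obtain ⟨p, s, hs, rfl⟩ := IsFractionRing.div_surjective (A := L ⊗[k] Q) a
  have hs0 : s ≠ 0 := nonZeroDivisors.ne_zero hs
  have hsK : algebraMap _ (FunField k Q L) s ≠ 0 := by
    simpa using algebraMap_tensor_injective.ne hs0
  set a := algebraMap (L ⊗[k] Q) (FunField k Q L) s
  have key : ∀ p : L ⊗[k] Q, algebraMap _ (FunField k Q L) p * sigma k Q L (frobCurve k Q L a)⁻¹ ∈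
      Submodule.span L (Set.range (sigma k Q L)) := by
    intro p
    induction p with
    | zero => rw [map_zero, zero_mul]; exact zero_mem _
    | tmul l b =>
      rw [algebraMap_tmul, mul_assoc, ← Algebra.smul_def, ← sigma_ofQ, ← map_mul]
      exact Submodule.smul_mem _ _ (Submodule.subset_span ⟨_, rfl⟩)
    | add p q hp hq => rw [map_add, add_mul]; exact add_mem hp hq
  have h1 := key (p * s ^ (Fintype.card k - 1))
  rw [map_inv₀, sigma_frobCurve, map_mul, map_pow] at h1
  convert h1 using 1
  obtain ⟨m, hm⟩ : ∃ m, Fintype.card k = m + 1 :=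
    ⟨Fintype.card k - 1, (Nat.succ_pred_eq_of_pos Fintype.card_pos).symm⟩
  rw [hm, Nat.add_sub_cancel, pow_succ]
  change _ / a = _ * a ^ m * _
  field_simp

/-- `L` and `σ(FunField)` are linearly disjoint over the field of `q`-th powers in `L`. -/
theorem eq_zero_of_sum_sigma_eq_zero {ι : Type*} {e : ι → L}
    (he : LinearIndependent (FiniteField.frobeniusAlgHom k L).toRingHom.fieldRange e) (s : Finset ι)
    (a : ι → FunField k Q L)
    (h : ∑ i ∈ s, algebraMap L (FunField k Q L) (e i) * sigma k Q L (a i) = 0) :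
    ∀ i ∈ s, a i = 0 := by
  classical
  obtain ⟨d, hd⟩ := IsLocalization.exist_integer_multiples (nonZeroDivisors (L ⊗[k] Q)) s a
  have hd0 : algebraMap _ (FunField k Q L) (d : L ⊗[k] Q) ≠ 0 := by
    simp
  choose! p hp using hd
  have h1 : ∑ i ∈ s, e i • sigmaTensor k Q L (p i) = 0 := by
    apply algebraMap_tensor_injective
    rw [map_sum, map_zero]
    have := congrArg (sigma k Q L (algebraMap _ _ (d : L ⊗[k] Q)) * ·) h
    simp only [mul_zero, Finset.mul_sum] at this
    rw [← this]
    refine Finset.sum_congr rfl fun i hi => ?_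
    rw [Algebra.smul_def, map_mul, ← IsScalarTower.algebraMap_apply L (L ⊗[k] Q), ← sigma_tensor,
      hp i hi]
    change _ * sigma k Q L ((d : L ⊗[k] Q) • a i) = _
    rw [Algebra.smul_def, map_mul]
    ring
  let b := Module.Basis.ofVectorSpace k Q
  let β := TensorProduct.equivFinsuppOfBasisRight (M := L) b
  have hβ : ∀ (p : L ⊗[k] Q) i, β (sigmaTensor k Q L p) i = β p i ^ Fintype.card k := by
    intro p i
    induction p with
    | zero => simp
    | tmul l a =>
      simp only [β, sigmaTensor, Algebra.TensorProduct.map_tmul,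
        TensorProduct.equivFinsuppOfBasisRight_apply_tmul_apply, FiniteField.frobeniusAlgHom_apply,
        AlgHom.id_apply, smul_pow]
      congr 1
      exact (FiniteField.pow_card _).symm
    | add p q hp hq =>
      rw [map_add, map_add, map_add, Finsupp.add_apply, Finsupp.add_apply, hp, hq]
      exact (map_add (FiniteField.frobeniusAlgHom k L) _ _).symm
  have hβl : ∀ (l : L) (p : L ⊗[k] Q) i, β (l • p) i = l * β p i := by
    intro l p i
    induction p with
    | zero => simp
    | tmul l' a =>
      simp only [β, TensorProduct.smul_tmul', TensorProduct.equivFinsuppOfBasisRight_apply_tmul_apply,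
        smul_eq_mul, mul_smul_comm]
    | add p q hp hq => rw [smul_add, map_add, map_add, Finsupp.add_apply, Finsupp.add_apply, hp, hq, mul_add]
  intro i hi
  have h2 : β (p i) = 0 := by
    ext j
    have h3 := DFunLike.congr_fun (congrArg β h1) j
    rw [map_sum, Finsupp.finsetSum_apply, map_zero, Finsupp.zero_apply] at h3
    simp only [hβl, hβ] at h3
    have h4 := linearIndependent_iff'.1 he s
      (fun i => ⟨β (p i) j ^ Fintype.card k, ⟨β (p i) j, rfl⟩⟩) (by
        rw [← h3]
        refine Finset.sum_congr rfl fun i _ => ?_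
        rw [mul_comm]; rfl) i hi
    exact eq_zero_of_pow_eq_zero (congrArg Subtype.val h4)
  have h3 : p i = 0 := β.injective (by rw [h2, map_zero])
  have h4 := hp i hi
  rw [h3, map_zero] at h4
  have h5 : algebraMap _ (FunField k Q L) (d : L ⊗[k] Q) * a i = 0 := by
    rw [← Algebra.smul_def]; exact h4.symm
  exact (mul_eq_zero.1 h5).resolve_left hd0

section Semilinear

variable {V W : Type u} [AddCommGroup V] [Module (FunField k Q L) V] [Module L V]
  [IsScalarTower L (FunField k Q L) V] [AddCommGroup W] [Module (FunField k Q L) W] [Module L W]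
  [IsScalarTower L (FunField k Q L) W]

/-- A `σ`-semilinear map as a semilinear map over the Frobenius of `L`. -/
noncomputable def frobSemilinear (T : V →ₛₗ[sigma k Q L] W) :
    V →ₛₗ[(FiniteField.frobeniusAlgHom k L).toRingHom] W where
  toFun := T
  map_add' := map_add T
  map_smul' l v := by
    rw [← algebraMap_smul (FunField k Q L) l v, map_smulₛₗ, sigma_algebraMap, algebraMap_smul]
    rfl

theorem linearIndependent_frobSemilinear {r : ℕ} (b : Module.Basis (Fin r) (FunField k Q L) V)
    (T : V →ₛₗ[sigma k Q L] W) (hT : LinearIndependent (FunField k Q L) (T ∘ b)) (n : ℕ)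
    (s : Fin n → V) (hs : LinearIndependent L s) : LinearIndependent L (frobSemilinear T ∘ s) := by
  classical
  rw [Fintype.linearIndependent_iff]
  intro c hc
  let Φ := (FiniteField.frobeniusAlgHom k L).toRingHom
  let e := Module.Basis.ofVectorSpace Φ.fieldRange L
  have hd : ∀ x : Φ.fieldRange, ∃ l : L, Φ l = x := fun x => x.2
  choose ρ hρ using hd
  let S : Finset _ := Finset.univ.biUnion fun j => (e.repr (c j)).support
  have hcS : ∀ j, c j = ∑ i ∈ S, Φ (ρ (e.repr (c j) i)) * e i := by
    intro j
    conv_lhs => rw [← e.linearCombination_repr (c j), Finsupp.linearCombination_apply]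
    rw [Finsupp.sum_of_support_subset (s := S) _
      (Finset.subset_biUnion_of_mem (fun j => (e.repr (c j)).support) (Finset.mem_univ j))]
    · refine Finset.sum_congr rfl fun i _ => ?_
      rw [hρ]; rfl
    · intro i _; rw [zero_smul]
  let w : _ → V := fun i => ∑ j, ρ (e.repr (c j) i) • s j
  have hw : ∑ i ∈ S, e i • T (w i) = 0 := by
    rw [← hc]
    have h1 : ∀ i, T (w i) = ∑ j, Φ (ρ (e.repr (c j) i)) • T (s j) := by
      intro i
      change frobSemilinear T (w i) = _
      rw [map_sum]
      refine Finset.sum_congr rfl fun j _ => ?_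
      rw [map_smulₛₗ]; rfl
    simp only [h1, Finset.smul_sum]
    rw [Finset.sum_comm]
    refine Finset.sum_congr rfl fun j _ => ?_
    conv_rhs => rw [hcS j]
    rw [Finset.sum_smul]
    refine Finset.sum_congr rfl fun i _ => ?_
    rw [smul_smul, mul_comm]; rfl
  have hw0 : ∀ i ∈ S, w i = 0 := by
    intro i hi
    rw [← b.repr.map_eq_zero_iff]
    ext m
    have hTw : ∀ i, T (w i) = ∑ m, sigma k Q L (b.repr (w i) m) • T (b m) := by
      intro i
      conv_lhs => rw [← b.sum_repr (w i)]
      rw [map_sum]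
      exact Finset.sum_congr rfl fun m _ => map_smulₛₗ T _ _
    have h2 : ∑ m, (∑ i ∈ S, algebraMap L (FunField k Q L) (e i) * sigma k Q L (b.repr (w i) m)) •
        T (b m) = 0 := by
      rw [← hw]
      simp only [hTw, Finset.smul_sum, Finset.sum_smul]
      rw [Finset.sum_comm]
      refine Finset.sum_congr rfl fun i _ => Finset.sum_congr rfl fun m _ => ?_
      rw [mul_smul, algebraMap_smul]
    have h3 := Fintype.linearIndependent_iff.1 hT _ h2 m
    exact eq_zero_of_sum_sigma_eq_zero e.linearIndependent S _ h3 i hi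
  intro j
  rw [hcS j]
  refine Finset.sum_eq_zero fun i hi => ?_
  rw [Fintype.linearIndependent_iff.1 hs _ (hw0 i hi) j, map_zero, zero_mul]

theorem span_range_frobSemilinear (T : V →ₛₗ[sigma k Q L] W)
    (hT : Submodule.span (FunField k Q L) (Set.range T) = ⊤) :
    Submodule.span L (Set.range (frobSemilinear T)) = ⊤ := by
  rw [eq_top_iff]
  rintro w -
  have hw : w ∈ Submodule.span (FunField k Q L) (Set.range T) := by rw [hT]; trivial
  induction hw using Submodule.span_induction with
  | mem w hw => exact Submodule.subset_span hw
  | zero => exact zero_mem _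
  | add v w _ _ hv hw => exact add_mem hv hw
  | smul a w h hw =>
    clear h
    have ha : a ∈ Submodule.span L (Set.range (sigma k Q L)) := by rw [span_range_sigma]; trivial
    induction hw using Submodule.span_induction with
    | zero => rw [smul_zero]; exact zero_mem _
    | add v w _ _ hv hw => rw [smul_add]; exact add_mem hv hw
    | smul l w _ hw =>
      rw [← algebraMap_smul (FunField k Q L) l w, smul_comm, algebraMap_smul]
      exact Submodule.smul_mem _ _ hw
    | mem w hw =>
      obtain ⟨v, rfl⟩ := hw
      induction ha using Submodule.span_induction with
      | zero => rw [zero_smul]; exact zero_mem _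
      | add v w _ _ hv hw => rw [add_smul]; exact add_mem hv hw
      | smul l w _ hw => rw [smul_assoc]; exact Submodule.smul_mem _ _ hw
      | mem a ha =>
        obtain ⟨a, rfl⟩ := ha
        refine Submodule.subset_span ⟨a • v, ?_⟩
        exact map_smulₛₗ T a v

end Semilinear

/-! ### Points over the generic point of `C` -/

theorem sigma_iterate_ofQ (n : ℕ) (a : Q) : (sigma k Q L)^[n] (ofQ k Q L a) = ofQ k Q L a :=
  Function.iterate_fixed (sigma_ofQ k Q L a) n

theorem mem_nonunits_frob_iterate {n : ℕ} {x : Point k Q L} {a : FunField k Q L} :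
    a ∈ (Point.frob^[n] x).ring.nonunits ↔ (sigma k Q L)^[n] a ∈ x.ring.nonunits := by
  induction n generalizing a x with
  | zero => rfl
  | succ n ih =>
    rw [Function.iterate_succ_apply, Function.iterate_succ_apply', ih, mem_nonunits_frob]

theorem eq_top_of_periodic {x : Point k Q L} (hx : x.toCurve = ⊤) {n : ℕ} (hn : 0 < n)
    (hfix : Point.frob^[n] x = x) : x.ring = ⊤ := by
  classical
  by_contra hne
  obtain ⟨t, ht⟩ := exists_isSeparating_curve k Q
  have htK := isSeparating_ofQ (L := L) ht
  have hsep := htK.separable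
  set T := ofQ k Q L t with hT
  have hTx : T ∈ x.ring := by rw [hT, ofQ_mem, hx]; exact ValuationSubring.mem_top _
  have hex : ∃ p : Polynomial L, p.Monic ∧ Polynomial.aeval T p ∈ x.ring.nonunits := by
    by_contra! hno
    apply hne
    rw [eq_top_iff]
    intro a _
    have hp : ∀ p : Polynomial L, (Polynomial.aeval T p)⁻¹ ∈ x.ring := by
      intro p
      rcases eq_or_ne p 0 with rfl | hp0
      · simp
      have hlc : p.leadingCoeff ≠ 0 := Polynomial.leadingCoeff_ne_zero.2 hp0
      have h1 := inv_mem_of_notMem_nonunits (hno _ (Polynomial.monic_mul_leadingCoeff_inv hp0))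
      rw [map_mul, Polynomial.aeval_C, mul_inv, map_inv₀, inv_inv] at h1
      have h2 := x.ring.mul_mem _ _ h1 (x.algebraMap_mem p.leadingCoeff⁻¹)
      rw [map_inv₀] at h2
      rwa [mul_assoc, mul_inv_cancel₀ (by simpa using hlc), mul_one] at h2
    have hL : ∀ p : Polynomial L, Polynomial.aeval T p ∈ x.ring := by
      intro p
      rw [Polynomial.aeval_eq_sum_range]
      refine sum_mem fun i _ => ?_
      rw [Algebra.smul_def]
      exact x.ring.mul_mem _ _ (x.algebraMap_mem _) (pow_mem hTx i)
    have hF : ∀ b ∈ IntermediateField.adjoin L {T}, b ∈ x.ring := by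
      intro b hb
      rw [IntermediateField.mem_adjoin_simple_iff] at hb
      obtain ⟨r, s, rfl⟩ := hb
      rw [div_eq_mul_inv]
      exact x.ring.mul_mem _ _ (hL r) (hp s)
    have hint : IsIntegral (IntermediateField.adjoin L {T}) a := Algebra.IsIntegral.isIntegral a
    obtain ⟨p, hpm, hpe⟩ := hint
    let ψ : IntermediateField.adjoin L {T} →+* x.ring :=
      (IntermediateField.adjoin L {T}).val.toRingHom.codRestrict x.ring.toSubring fun b => hF b b.2
    have hint' : IsIntegral x.ring a := ⟨p.map ψ, hpm.map _, by rw [Polynomial.eval₂_map]; exact hpe⟩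
    obtain ⟨y, hy⟩ := IsIntegrallyClosed.isIntegral_iff.1 hint'
    rw [← hy]
    exact y.2
  obtain ⟨p, ⟨hpm, hpe⟩, hmin⟩ := WellFounded.has_min (measure Polynomial.natDegree).wf
    {p : Polynomial L | p.Monic ∧ Polynomial.aeval T p ∈ x.ring.nonunits} hex
  let Φ := (FiniteField.frobeniusAlgHom k L).toRingHom
  have hσ : ∀ (n : ℕ) (p : Polynomial L), (sigma k Q L)^[n] (Polynomial.aeval T p) =
      Polynomial.aeval T ((Polynomial.map Φ)^[n] p) := by
    intro n
    induction n with
    | zero => intro p; rfl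
    | succ n ih =>
      intro p
      rw [Function.iterate_succ_apply, Function.iterate_succ_apply, ← ih]
      congr 1
      rw [Polynomial.aeval_def, Polynomial.hom_eval₂, Polynomial.aeval_def, Polynomial.eval₂_map, hT,
        sigma_ofQ]
      congr 1
      ext l
      exact sigma_algebraMap k Q L l
  have hdeg : ∀ (n : ℕ) (p : Polynomial L), p.Monic → ((Polynomial.map Φ)^[n] p).Monic ∧
      ((Polynomial.map Φ)^[n] p).degree = p.degree ∧
      ∀ i, ((Polynomial.map Φ)^[n] p).coeff i = p.coeff i ^ Fintype.card k ^ n := by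
    intro n
    induction n with
    | zero => intro p hp; exact ⟨hp, rfl, fun i => by simp⟩
    | succ n ih =>
      intro p hp
      rw [Function.iterate_succ_apply]
      obtain ⟨h1, h2, h3⟩ := ih (p.map Φ) (hp.map Φ)
      refine ⟨h1, h2.trans (Polynomial.degree_map _ _), fun i => ?_⟩
      rw [h3, Polynomial.coeff_map]
      change (p.coeff i ^ Fintype.card k) ^ Fintype.card k ^ n = _
      rw [← pow_mul, pow_succ' (Fintype.card k)]
  obtain ⟨h1, h2, h3⟩ := hdeg n p hpm
  have hpe' : Polynomial.aeval T ((Polynomial.map Φ)^[n] p) ∈ x.ring.nonunits := by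
    rw [← hσ, ← mem_nonunits_frob_iterate, hfix]
    exact hpe
  have hpp : (Polynomial.map Φ)^[n] p = p := by
    by_contra hpp
    have hsub : (Polynomial.map Φ)^[n] p - p ≠ 0 := sub_ne_zero.2 hpp
    have hlt := Polynomial.degree_sub_lt_left h2 h1.ne_zero (by rw [h1.leadingCoeff, hpm.leadingCoeff])
    set r := (Polynomial.map Φ)^[n] p - p with hr
    have hre : Polynomial.aeval T r ∈ x.ring.nonunits := by
      rw [hr, map_sub]; exact sub_mem hpe' hpe
    refine hmin (r * Polynomial.C r.leadingCoeff⁻¹)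
      ⟨Polynomial.monic_mul_leadingCoeff_inv hsub, ?_⟩ ?_
    · rw [map_mul, mul_comm, Polynomial.aeval_C]
      exact mul_mem_nonunits (x.algebraMap_mem _) hre
    · change (r * Polynomial.C r.leadingCoeff⁻¹).natDegree < p.natDegree
      rw [Polynomial.natDegree_mul_C (inv_ne_zero (Polynomial.leadingCoeff_ne_zero.2 hsub))]
      exact Polynomial.natDegree_lt_natDegree hsub (by rwa [h2] at hlt)
  let ρ : x.ring →+* IsLocalRing.ResidueField x.ring := IsLocalRing.residue x.ring
  let θ : L →+* IsLocalRing.ResidueField x.ring := ρ.comp x.constants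
  let _ : Algebra k (IsLocalRing.ResidueField x.ring) := (θ.comp (algebraMap k L)).toAlgebra
  have hint : IsIntegral k (ρ ⟨T, hTx⟩) := by
    let A := integralClosure k (IsLocalRing.ResidueField x.ring)
    have hcoef : ∀ i, θ (p.coeff i) ∈ A := by
      intro i
      refine ⟨Polynomial.X ^ Fintype.card k ^ n - Polynomial.X, Polynomial.monic_X_pow_sub ?_, ?_⟩
      · rw [Polynomial.degree_X]
        exact_mod_cast Nat.one_lt_pow hn.ne' Fintype.one_lt_card
      · have h4 := h3 i
        rw [hpp] at h4
        rw [Polynomial.eval₂_sub, Polynomial.eval₂_X_pow, Polynomial.eval₂_X, ← map_pow, ← h4, sub_self]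
    have hA : IsIntegral A (ρ ⟨T, hTx⟩) := by
      have hsub : (↑(p.map θ).coeffs : Set (IsLocalRing.ResidueField x.ring)) ⊆ A.toSubring := by
        intro c hc
        obtain ⟨i, -, rfl⟩ := Polynomial.mem_coeffs_iff.1 hc
        rw [Polynomial.coeff_map]
        exact hcoef i
      refine ⟨(p.map θ).toSubring A.toSubring hsub, (Polynomial.monic_toSubring _ _ hsub).2 (hpm.map θ), ?_⟩
      have h5 : ((p.map θ).toSubring A.toSubring hsub).map (algebraMap A _) = p.map θ := by
        ext i
        rw [Polynomial.coeff_map]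
        exact Polynomial.coeff_toSubring _ _ hsub
      rw [← Polynomial.eval_map, h5, Polynomial.eval_map]
      have h6 : Polynomial.eval₂ θ (ρ ⟨T, hTx⟩) p = ρ (Polynomial.eval₂ x.constants ⟨T, hTx⟩ p) :=
        (Polynomial.hom_eval₂ _ _ _ _).symm
      rw [h6]
      refine (IsLocalRing.residue_eq_zero_iff _).2 ?_
      rw [← ValuationSubring.coe_mem_nonunits_iff]
      have h7 : ((Polynomial.eval₂ x.constants ⟨T, hTx⟩ p : x.ring) : FunField k Q L) =
          Polynomial.aeval T p := by
        change x.ring.subtype _ = _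
        rw [Polynomial.hom_eval₂]; rfl
      rw [h7]; exact hpe
    exact isIntegral_trans _ hA
  obtain ⟨g, hgm, hge⟩ := hint
  have h6 : Polynomial.eval₂ (θ.comp (algebraMap k L)) (ρ ⟨T, hTx⟩) g =
      ρ (Polynomial.eval₂ (x.constants.comp (algebraMap k L)) ⟨T, hTx⟩ g) :=
    (Polynomial.hom_eval₂ g (x.constants.comp (algebraMap k L)) ρ ⟨T, hTx⟩).symm
  have h7 : Polynomial.eval₂ (x.constants.comp (algebraMap k L)) ⟨T, hTx⟩ g ∈
      IsLocalRing.maximalIdeal x.ring := (IsLocalRing.residue_eq_zero_iff _).1 (h6.symm.trans hge)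
  rw [← ValuationSubring.coe_mem_nonunits_iff] at h7
  have h8 : ((Polynomial.eval₂ (x.constants.comp (algebraMap k L)) ⟨T, hTx⟩ g : x.ring) :
      FunField k Q L) = ofQ k Q L (Polynomial.aeval t g) := by
    change x.ring.subtype _ = _
    rw [Polynomial.hom_eval₂, Polynomial.aeval_def, Polynomial.hom_eval₂]
    congr 1
    ext s
    exact algebraMap_algebraMap s
  rw [h8, ofQ_mem_nonunits, hx] at h7
  have h9 : Polynomial.aeval t g ≠ 0 := fun h =>
    ht.transcendental ⟨g, hgm.ne_zero, h⟩
  exact notMem_nonunits h9 (ValuationSubring.mem_top _) h7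

end Frobenius


/-! ### Elements with bounded poles -/

section BoundedPoles

variable {E K : Type u} [Field E] [Field K] [Algebra E K]

theorem exists_polynomial_mul_mem {t : K} (ht : IsSeparating E t) (a : K) :
    ∃ p : Polynomial E, p ≠ 0 ∧ ∀ v : ValuationSubring K, (∀ c : E, algebraMap E K c ∈ v) → t ∈ v →
      Polynomial.aeval t p * a ∈ v := by
  have := ht.separable
  have halg : Algebra.IsAlgebraic (Algebra.adjoin E {t}) K := by
    have h1 : Algebra.IsAlgebraic (IntermediateField.adjoin E {t}) K := inferInstance
    open scoped IntermediateField.algebraAdjoinAdjoin in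
    exact (IsFractionRing.comap_isAlgebraic_iff (A := Algebra.adjoin E {t})
      (K := IntermediateField.adjoin E {t}) (C := K)).2 h1
  obtain ⟨y, hy0, hy⟩ := (halg.isAlgebraic a).exists_integral_multiple
  obtain ⟨p, hp⟩ : ∃ p : Polynomial E, Polynomial.aeval t p = (y : K) := by
    have : ∀ z ∈ Algebra.adjoin E {t}, ∃ p : Polynomial E, Polynomial.aeval t p = z := by
      intro z hz
      rwa [Algebra.adjoin_singleton_eq_range_aeval] at hz
    exact this y y.2
  refine ⟨p, ?_, fun v hE htv => ?_⟩
  · rintro rfl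
    rw [map_zero] at hp
    exact hy0 (Subtype.ext hp.symm)
  · rw [hp]
    exact mem_of_mem_integralClosure hE htv ⟨y • a, hy⟩

theorem aeval_mem {v : ValuationSubring K} (hE : ∀ c : E, algebraMap E K c ∈ v) {t : K}
    (ht : t ∈ v) (p : Polynomial E) : Polynomial.aeval t p ∈ v := by
  rw [Polynomial.aeval_eq_sum_range]
  refine sum_mem fun i _ => ?_
  rw [Algebra.smul_def]
  exact v.mul_mem _ _ (hE _) (pow_mem ht i)

theorem aeval_ne_zero {t : K} (ht : Transcendental E t) {p : Polynomial E} (hp : p ≠ 0) :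
    Polynomial.aeval t p ≠ 0 := fun h => ht ⟨p, hp, h⟩

/-- A polynomial in `s` is a power of `s` up to units at the zeros of `s`. -/
theorem exists_pow_dvd_aeval {p : Polynomial E} (hp : p ≠ 0) :
    ∃ n : ℕ, ∀ s : K, ∀ v : ValuationSubring K, (∀ c : E, algebraMap E K c ∈ v) →
      s ∈ v.nonunits → ∃ u, u ∈ v ∧ u⁻¹ ∈ v ∧ u ≠ 0 ∧ Polynomial.aeval s p = s ^ n * u := by
  obtain ⟨q, hq, hq'⟩ := Polynomial.exists_eq_pow_rootMultiplicity_mul_and_not_dvd p hp 0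
  rw [map_zero, sub_zero] at hq hq'
  rw [Polynomial.X_dvd_iff] at hq'
  refine ⟨p.rootMultiplicity 0, fun s v hE hs => ⟨Polynomial.aeval s q, ?_⟩⟩
  have hsv := ValuationSubring.nonunits_subset hs
  have hu : Polynomial.aeval s q ∉ v.nonunits := by
    intro h
    have h1 : Polynomial.aeval s q = s * Polynomial.aeval s q.divX + algebraMap E K (q.coeff 0) := by
      conv_lhs => rw [← Polynomial.divX_mul_X_add q]
      rw [map_add, map_mul, Polynomial.aeval_X, Polynomial.aeval_C]
      ring
    have h2 : algebraMap E K (q.coeff 0) ∈ v.nonunits := by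
      have h3 := sub_mem h (mul_mem_nonunits (aeval_mem hE hsv q.divX) hs)
      rwa [h1, mul_comm s, add_sub_cancel_left] at h3
    exact notMem_nonunits (by simpa using hq') (by rw [← map_inv₀]; exact hE _) h2
  refine ⟨aeval_mem hE hsv q, inv_mem_of_notMem_nonunits hu, ?_, ?_⟩
  · intro h; rw [h] at hu; exact hu (zero_mem _)
  · conv_lhs => rw [hq]
    rw [map_mul, map_pow, Polynomial.aeval_X]

theorem inv_pow_mul_aeval_mem {v : ValuationSubring K} (hE : ∀ c : E, algebraMap E K c ∈ v) {t : K}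
    (ht : t ∉ v) {p : Polynomial E} {n : ℕ} (hp : p.natDegree ≤ n) :
    t⁻¹ ^ n * Polynomial.aeval t p ∈ v := by
  rw [Polynomial.aeval_eq_sum_range, Finset.mul_sum]
  refine sum_mem fun j hj => ?_
  obtain ⟨e, he⟩ := Nat.exists_eq_add_of_le
    ((Nat.lt_succ_iff.1 (Finset.mem_range.1 hj)).trans hp)
  rw [he, Algebra.smul_def, pow_add]
  have h2 : t⁻¹ ^ j * t⁻¹ ^ e * (algebraMap E K (p.coeff j) * t ^ j) =
      algebraMap E K (p.coeff j) * t⁻¹ ^ e := by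
    have : t ≠ 0 := by rintro rfl; exact ht v.zero_mem
    rw [inv_pow, inv_pow]; field_simp
  rw [h2]
  exact v.mul_mem _ _ (hE _) (pow_mem ((v.mem_or_inv_mem t).resolve_left ht) e)

theorem aeval_div_aeval_mem {v : ValuationSubring K} (hE : ∀ c : E, algebraMap E K c ∈ v) {t : K}
    (ht : t ∉ v) {p q : Polynomial E} (hq : q ≠ 0) (hpq : p.natDegree ≤ q.natDegree) :
    Polynomial.aeval t p / Polynomial.aeval t q ∈ v := by
  have ht0 : t ≠ 0 := by rintro rfl; exact ht v.zero_mem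
  have hlead : algebraMap E K q.leadingCoeff ∉ v.nonunits :=
    notMem_nonunits (by simpa using hq) (by rw [← map_inv₀]; exact hE _)
  have hu : t⁻¹ ^ q.natDegree * Polynomial.aeval t q ∉ v.nonunits := by
    intro h
    apply hlead
    have h1 : t⁻¹ ^ q.natDegree * Polynomial.aeval t q =
        t⁻¹ ^ q.natDegree * Polynomial.aeval t q.eraseLead + algebraMap E K q.leadingCoeff := by
      have e := congrArg (Polynomial.aeval t) q.eraseLead_add_C_mul_X_pow
      rw [map_add, map_mul, Polynomial.aeval_C, map_pow, Polynomial.aeval_X] at e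
      rw [← e, inv_pow]
      field_simp
    have h2 : t⁻¹ ^ q.natDegree * Polynomial.aeval t q.eraseLead ∈ v.nonunits := by
      rcases Nat.eq_zero_or_pos q.natDegree with h0 | h0
      · rw [Polynomial.eq_C_of_natDegree_eq_zero h0, Polynomial.eraseLead_C, map_zero, mul_zero]
        exact zero_mem _
      · obtain ⟨m, hm⟩ : ∃ m, q.natDegree = m + 1 := ⟨_, (Nat.succ_pred_eq_of_pos h0).symm⟩
        rw [hm, pow_succ, mul_right_comm]
        refine mul_mem_nonunits (inv_pow_mul_aeval_mem hE ht ?_)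
          ((ValuationSubring.inv_mem_nonunits_iff v).2 (Or.inr ht))
        have := q.eraseLead_natDegree_le
        omega
    have h3 := sub_mem h h2
    rwa [h1, add_sub_cancel_left] at h3
  have h3 := v.mul_mem _ _ (inv_pow_mul_aeval_mem hE ht hpq) (inv_mem_of_notMem_nonunits hu)
  convert h3 using 1
  rw [mul_inv, mul_mul_mul_comm, mul_inv_cancel₀ (pow_ne_zero _ (inv_ne_zero ht0)), one_mul,
    div_eq_mul_inv]

theorem isIntegral_trace_of_subalgebra (F : IntermediateField E K) [FiniteDimensional F K]
    (R : Subalgebra E K) (hR : R ≤ F.toSubalgebra) {x : K} (hx : IsIntegral R x) :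
    IsIntegral R (algebraMap F K (Algebra.trace F K x)) := by
  let _ : Algebra R F := (Subalgebra.inclusion hR).toRingHom.toAlgebra
  have : IsScalarTower R F K := IsScalarTower.of_algebraMap_eq fun _ => rfl
  exact (Algebra.isIntegral_trace hx : IsIntegral R (Algebra.trace F K x)).algebraMap

theorem trace_mul_of_mem (F : IntermediateField E K) {f : K} (hf : f ∈ F) (x : K) :
    algebraMap F K (Algebra.trace F K (f * x)) = f * algebraMap F K (Algebra.trace F K x) := by
  have h : Algebra.trace F K ((⟨f, hf⟩ : F) • x) = (⟨f, hf⟩ : F) * Algebra.trace F K x :=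
    map_smul (Algebra.trace F K) _ x
  have h' : ((⟨f, hf⟩ : F) • x) = f * x := rfl
  rw [← h', h, map_mul]; rfl

theorem aeval_mem_intermediateField (F : IntermediateField E K) {t : K} (ht : t ∈ F)
    (p : Polynomial E) : Polynomial.aeval t p ∈ F := by
  rw [Polynomial.aeval_eq_sum_range]
  exact sum_mem fun i _ => F.smul_mem (pow_mem ht i)

theorem mem_adjoin_of_isIntegral {t : K} (ht : Transcendental E t) {x : K}
    (hx : x ∈ IntermediateField.adjoin E {t}) (hint : IsIntegral (Algebra.adjoin E {t}) x) :
    x ∈ Algebra.adjoin E {t} := by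
  have e : Polynomial E ≃ₐ[E] Algebra.adjoin E {t} :=
    AlgEquiv.ofInjective (Polynomial.aeval t) (transcendental_iff_injective.1 ht) |>.trans
      (Subalgebra.equivOfEq _ _ (Algebra.adjoin_singleton_eq_range_aeval E t).symm)
  have : IsPrincipalIdealRing (Algebra.adjoin E {t}) :=
    IsPrincipalIdealRing.of_surjective e.toRingEquiv e.surjective
  open scoped IntermediateField.algebraAdjoinAdjoin in
  have h1 : IsIntegral (Algebra.adjoin E {t}) (⟨x, hx⟩ : IntermediateField.adjoin E {t}) := by
    refine (isIntegral_algHom_iff (IsScalarTower.toAlgHom (Algebra.adjoin E {t})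
      (IntermediateField.adjoin E {t}) K) (algebraMap (IntermediateField.adjoin E {t}) K).injective).1 ?_
    exact hint
  open scoped IntermediateField.algebraAdjoinAdjoin in
  obtain ⟨y, hy⟩ := IsIntegrallyClosed.isIntegral_iff.1 h1
  have h2 := congrArg Subtype.val hy
  rw [show x = (y : K) from h2.symm]
  exact y.2

variable (E) in
/-- The polynomials in `t` of degree at most `n`. -/
def polySpan (t : K) (n : ℕ) : Submodule E K :=
  Submodule.span E (Set.range fun i : Fin (n + 1) => t ^ (i : ℕ))

instance (t : K) (n : ℕ) : Module.Finite E (polySpan E t n) :=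
  Module.Finite.span_of_finite E (Set.finite_range _)

theorem mem_polySpan {t : K} (ht : Transcendental E t) {n : ℕ} {x : K}
    (h1 : x ∈ Algebra.adjoin E {t}) (h2 : t⁻¹ ^ n * x ∈ Algebra.adjoin E {t⁻¹}) :
    x ∈ polySpan E t n := by
  have ht0 : t ≠ 0 := by rintro rfl; exact ht isAlgebraic_zero
  rw [Algebra.adjoin_singleton_eq_range_aeval] at h1 h2
  obtain ⟨p, rfl⟩ := h1
  obtain ⟨q, hq⟩ := h2
  change Polynomial.aeval t⁻¹ q = t⁻¹ ^ n * Polynomial.aeval t p at hq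
  change Polynomial.aeval t p ∈ _
  have h3 : Polynomial.aeval t q.reverse = t ^ q.natDegree * Polynomial.aeval t⁻¹ q := by
    let _ : Invertible t⁻¹ := invertibleOfNonzero (inv_ne_zero ht0)
    have := Polynomial.eval₂_reverse_mul_pow (algebraMap E K) t⁻¹ q
    rw [invOf_eq_inv, inv_inv] at this
    rw [Polynomial.aeval_def, Polynomial.aeval_def, ← this, inv_pow]
    field_simp
  have h4 : Polynomial.X ^ n * q.reverse = Polynomial.X ^ q.natDegree * p := by
    apply transcendental_iff_injective.1 ht
    rw [map_mul, map_mul, h3, hq, map_pow, map_pow, Polynomial.aeval_X, inv_pow]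
    field_simp
  have h5 : p.natDegree ≤ n := by
    rcases eq_or_ne p 0 with rfl | hp
    · simp
    have h6 := congrArg Polynomial.natDegree h4
    have h7 := Polynomial.natDegree_mul_le (p := Polynomial.X ^ n) (q := q.reverse)
    rw [h6, Polynomial.natDegree_mul (pow_ne_zero _ Polynomial.X_ne_zero) hp,
      Polynomial.natDegree_X_pow, Polynomial.natDegree_X_pow] at h7
    have h8 := Polynomial.reverse_natDegree_le q
    omega
  rw [Polynomial.aeval_eq_sum_range' (Nat.lt_succ_of_le h5)]
  refine sum_mem fun i hi => Submodule.smul_mem _ _ (Submodule.subset_span ⟨⟨i, ?_⟩, rfl⟩)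
  exact Finset.mem_range.1 hi

/-- The elements of `K` without poles outside the poles of `t`, and with poles of order at most
`n · (t)_∞` there. -/
def sectionsPole (t : K) (n : ℕ) (E : Type u) [Field E] [Algebra E K] : Submodule E K where
  carrier := {b | ∀ v : ValuationSubring K, (∀ c : E, algebraMap E K c ∈ v) →
    (t ∈ v → b ∈ v) ∧ (t ∉ v → t⁻¹ ^ n * b ∈ v)}
  zero_mem' v _ := ⟨fun _ => v.zero_mem, fun _ => by rw [mul_zero]; exact v.zero_mem⟩
  add_mem' ha hb v hE := ⟨fun h => v.add_mem _ _ ((ha v hE).1 h) ((hb v hE).1 h),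
    fun h => by rw [mul_add]; exact v.add_mem _ _ ((ha v hE).2 h) ((hb v hE).2 h)⟩
  smul_mem' c b hb v hE := ⟨fun h => by
      rw [Algebra.smul_def]; exact v.mul_mem _ _ (hE c) ((hb v hE).1 h),
    fun h => by
      rw [mul_smul_comm, Algebra.smul_def]; exact v.mul_mem _ _ (hE c) ((hb v hE).2 h)⟩

theorem finite_sectionsPole [Algebra.EssFiniteType E K] {t : K} (ht : IsSeparating E t) (n : ℕ) :
    Module.Finite E (sectionsPole t n E) := by
  have ht0 := ht.ne_zero
  have := ht.separable
  have := ht.finiteDimensional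
  set F := IntermediateField.adjoin E {t} with hF
  let w₀ := Module.finBasis F K
  choose p hp0 hp using fun i => exists_polynomial_mul_mem ht (w₀ i)
  let w := fun i => Polynomial.aeval t (p i) * w₀ i
  have hw : ∀ i, ∃ m : ℕ, ∀ v : ValuationSubring K, (∀ c : E, algebraMap E K c ∈ v) → t ∉ v →
      t⁻¹ ^ m * w i ∈ v := by
    intro i
    obtain ⟨q, hq0, hq⟩ := exists_polynomial_mul_mem ht.inv (w i)
    obtain ⟨m, hm⟩ := exists_pow_dvd_aeval (K := K) hq0
    refine ⟨m, fun v hE htv => ?_⟩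
    have hs : t⁻¹ ∈ v.nonunits := (ValuationSubring.inv_mem_nonunits_iff v).2 (Or.inr htv)
    obtain ⟨u, hu, hu', hu0, he⟩ := hm _ v hE hs
    have := v.mul_mem _ _ hu' (hq v hE (ValuationSubring.nonunits_subset hs))
    rw [he] at this
    convert this using 1
    field_simp
  choose m hm using hw
  let N : ℕ := n + ∑ i, m i
  let τ : K →ₗ[E] (Fin (Module.finrank F K) → K) :=
    LinearMap.pi fun i => ((Algebra.linearMap F K).restrictScalars E) ∘ₗ
      ((Algebra.trace F K).restrictScalars E) ∘ₗ (LinearMap.mulRight E (w i))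
  have htF : t ∈ F := IntermediateField.mem_adjoin_simple_self E t
  have hsF : t⁻¹ ∈ F := inv_mem htF
  have hinv : F ≤ IntermediateField.adjoin E {t⁻¹} := by
    rw [hF, IntermediateField.adjoin_simple_le_iff]
    have := inv_mem (IntermediateField.mem_adjoin_simple_self E t⁻¹)
    rwa [inv_inv] at this
  have hτ : ∀ b ∈ sectionsPole t n E, ∀ i, τ b i ∈ polySpan E t N := by
    intro b hb i
    change algebraMap F K (Algebra.trace F K (b * w i)) ∈ _
    refine mem_polySpan ht.transcendental ?_ ?_
    · refine mem_adjoin_of_isIntegral ht.transcendental (SetLike.coe_mem _) ?_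
      refine isIntegral_trace_of_subalgebra F _ (Algebra.adjoin_le (Set.singleton_subset_iff.2 htF)) ?_
      exact mem_integralClosure_of_forall fun v hE htv => v.mul_mem _ _ ((hb v hE).1 htv) (hp i v hE htv)
    · rw [← trace_mul_of_mem F (pow_mem hsF N)]
      refine mem_adjoin_of_isIntegral ht.inv.transcendental (hinv (SetLike.coe_mem _)) ?_
      refine isIntegral_trace_of_subalgebra F _ (Algebra.adjoin_le (Set.singleton_subset_iff.2 hsF)) ?_
      refine mem_integralClosure_of_forall fun v hE hsv => ?_
      by_cases htv : t ∈ v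
      · exact v.mul_mem _ _ (pow_mem hsv _) (v.mul_mem _ _ ((hb v hE).1 htv) (hp i v hE htv))
      · obtain ⟨e, he⟩ : ∃ e, N = n + m i + e := by
          have := Finset.single_le_sum (f := m) (fun j _ => Nat.zero_le _) (Finset.mem_univ i)
          exact ⟨N - (n + m i), by omega⟩
        have h2 := v.mul_mem _ _ (pow_mem hsv e)
          (v.mul_mem _ _ ((hb v hE).2 htv) (hm i v hE htv))
        convert h2 using 1
        rw [he, pow_add, pow_add]; ring
  have hinj : ∀ b, τ b = 0 → b = 0 := by
    intro b hb
    have hnd := traceForm_nondegenerate F K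
    refine hnd.1 b fun y => ?_
    rw [Algebra.traceForm_apply]
    have h1 : ∀ i, Algebra.trace F K (b * w₀ i) = 0 := by
      intro i
      have h2 : algebraMap F K (Algebra.trace F K (b * w i)) = 0 := congrFun hb i
      have h3 : b * w i = Polynomial.aeval t (p i) * (b * w₀ i) := by
        change b * (Polynomial.aeval t (p i) * w₀ i) = _
        ring
      rw [h3, trace_mul_of_mem F (aeval_mem_intermediateField F htF _)] at h2
      exact (map_eq_zero _).1 ((mul_eq_zero.1 h2).resolve_left
        (aeval_ne_zero ht.transcendental (hp0 i)))
    rw [← w₀.sum_repr y, Finset.mul_sum, map_sum]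
    refine Finset.sum_eq_zero fun i _ => ?_
    rw [mul_smul_comm, map_smul, h1, smul_zero]
  let τ' : sectionsPole t n E →ₗ[E] (Fin (Module.finrank F K) → polySpan E t N) :=
    LinearMap.pi fun i => ((LinearMap.proj i ∘ₗ τ).comp (Submodule.subtype _)).codRestrict _
      fun b => hτ b b.2 i
  refine Module.Finite.of_injective τ' ?_
  rw [injective_iff_map_eq_zero]
  intro b hb
  refine Subtype.ext (hinj b ?_)
  funext i
  exact congrArg Subtype.val (congrFun hb i)

end BoundedPoles


/-! ### Bounded families of stalks -/

section BoundedFamily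

set_option linter.unusedSectionVars false

variable {k Q L : Type u} [Field k] [Fintype k] [Field Q] [Algebra k Q] [IsCurve k Q]
  [Field L] [Algebra k L]
variable {V W : Type u} [AddCommGroup V] [Module (FunField k Q L) V]
  [AddCommGroup W] [Module (FunField k Q L) W]

/-- A family of stalks is bounded if every vector and every linear form is integral at almost all
points and has a bounded denominator at the others. -/
structure IsBounded (M : StalkFamily k Q L V) : Prop where
  fin_mem : ∀ w : V, {x | w ∉ M x}.Finite
  fin_dual : ∀ f : V →ₗ[FunField k Q L] FunField k Q L, {x | ¬ ∀ m ∈ M x, f m ∈ x.ring}.Finite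
  absorb : ∀ (x : Point k Q L) (w : V), ∃ a : FunField k Q L, a ≠ 0 ∧ a • w ∈ M x
  bounded : ∀ (x : Point k Q L) (f : V →ₗ[FunField k Q L] FunField k Q L),
    ∃ a : FunField k Q L, a ≠ 0 ∧ ∀ m ∈ M x, a * f m ∈ x.ring

theorem smul_mem_stalk {x : Point k Q L} {N : Submodule x.ring V} {a : FunField k Q L} {m : V}
    (ha : a ∈ x.ring) (hm : m ∈ N) : a • m ∈ N := N.smul_mem (⟨a, ha⟩ : x.ring) hm

theorem exists_common_denominator (v : ValuationSubring (FunField k Q L)) {r : ℕ}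
    (c : Fin r → FunField k Q L) :
    ∃ a : FunField k Q L, a ≠ 0 ∧ ∀ i, a * c i ∈ v := by
  obtain ⟨d, hd⟩ := IsLocalization.exist_integer_multiples_of_finite (nonZeroDivisors v) c
  refine ⟨(d : v), by simp, fun i => ?_⟩
  obtain ⟨y, hy⟩ := hd i
  have h : (y : FunField k Q L) = (d : v) * c i := by
    have : algebraMap v (FunField k Q L) y = (d : v) • c i := hy
    rw [Algebra.smul_def] at this
    exact this
  rw [← h]; exact y.2

theorem mem_span_of_repr {ι : Type*} [Fintype ι] (b : Module.Basis ι (FunField k Q L) V) {x : Point k Q L} {w : V}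
    (h : ∀ i, b.repr w i ∈ x.ring) : w ∈ Submodule.span x.ring (Set.range b) := by
  rw [← b.sum_repr w]
  exact sum_mem fun i _ => smul_mem_stalk (h i) (Submodule.subset_span ⟨i, rfl⟩)

theorem map_mem_of_mem_span {ι : Type*} (b : ι → V) {x : Point k Q L}
    (f : V →ₗ[FunField k Q L] FunField k Q L) {a : FunField k Q L}
    (h : ∀ i, a * f (b i) ∈ x.ring) {m : V} (hm : m ∈ Submodule.span x.ring (Set.range b)) :
    a * f m ∈ x.ring := by
  induction hm using Submodule.span_induction with
  | mem m hm => obtain ⟨i, rfl⟩ := hm; exact h i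
  | zero => rw [map_zero, mul_zero]; exact x.ring.zero_mem
  | add m n _ _ hm hn => rw [map_add, mul_add]; exact x.ring.add_mem _ _ hm hn
  | smul c m _ hm =>
    have h : c • m = (c : FunField k Q L) • m := rfl
    rw [h, map_smul, smul_eq_mul, mul_left_comm]
    exact x.ring.mul_mem _ _ c.2 hm

theorem IsLocallyFree.isBounded {r : ℕ} {M : StalkFamily k Q L V} (hM : IsLocallyFree r M) :
    IsBounded M where
  fin_mem w := by
    obtain ⟨b, -, hb⟩ := hM (Point.generic k Q L)
    refine (hb.union (Set.finite_iUnion fun i : Fin r => Point.finite_poles (b.repr w i))).subset ?_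
    intro x hx
    by_contra h
    simp only [Set.mem_union, Set.mem_iUnion, Set.mem_ofPred_eq, not_or, not_exists, not_not] at h
    refine hx ?_
    rw [h.1]
    exact mem_span_of_repr b h.2
  fin_dual f := by
    obtain ⟨b, -, hb⟩ := hM (Point.generic k Q L)
    refine (hb.union (Set.finite_iUnion fun i : Fin r => Point.finite_poles (f (b i)))).subset ?_
    intro x hx
    by_contra h
    simp only [Set.mem_union, Set.mem_iUnion, Set.mem_ofPred_eq, not_or, not_exists, not_not] at h
    refine hx fun m hm => ?_
    rw [h.1] at hm
    rw [← one_mul (f m)]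
    exact map_mem_of_mem_span b f (fun i => by rw [one_mul]; exact h.2 i) hm
  absorb x w := by
    obtain ⟨b, hb, -⟩ := hM x
    obtain ⟨a, ha, h⟩ := exists_common_denominator x.ring fun i => b.repr w i
    refine ⟨a, ha, ?_⟩
    rw [hb]
    refine mem_span_of_repr b fun i => ?_
    rw [map_smul, Finsupp.smul_apply, smul_eq_mul]
    exact h i
  bounded x f := by
    obtain ⟨b, hb, -⟩ := hM x
    obtain ⟨a, ha, h⟩ := exists_common_denominator x.ring fun i => f (b i)
    refine ⟨a, ha, fun m hm => ?_⟩
    rw [hb] at hm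
    exact map_mem_of_mem_span b f h hm

/-- The family of stalks of a subspace. -/
noncomputable def StalkFamily.sub (M : StalkFamily k Q L V) (U : Submodule (FunField k Q L) V) :
    StalkFamily k Q L U :=
  fun x => (M x).comap (U.subtype.restrictScalars x.ring)

theorem IsBounded.sub {M : StalkFamily k Q L V} (hM : IsBounded M)
    (U : Submodule (FunField k Q L) V) : IsBounded (M.sub U) where
  fin_mem w := hM.fin_mem w
  fin_dual f := by
    obtain ⟨g, rfl⟩ := f.exists_extend
    exact (hM.fin_dual g).subset fun x hx h => hx fun m hm => h m hm
  absorb x w := hM.absorb x w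
  bounded x f := by
    obtain ⟨g, rfl⟩ := f.exists_extend
    obtain ⟨a, ha, h⟩ := hM.bounded x g
    exact ⟨a, ha, fun m hm => h m hm⟩

theorem IsBounded.map {M : StalkFamily k Q L V} (hM : IsBounded M) {f : V →ₗ[FunField k Q L] W}
    (hf : Function.Surjective f) : IsBounded (M.map f) where
  fin_mem w := by
    obtain ⟨v, rfl⟩ := hf w
    exact (hM.fin_mem v).subset fun x hx h => hx ⟨v, h, rfl⟩
  fin_dual g := (hM.fin_dual (g ∘ₗ f)).subset fun x hx h => hx (by
    rintro _ ⟨m, hm, rfl⟩; exact h m hm)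
  absorb x w := by
    obtain ⟨v, rfl⟩ := hf w
    obtain ⟨a, ha, h⟩ := hM.absorb x v
    exact ⟨a, ha, a • v, h, map_smul f a v⟩
  bounded x g := by
    obtain ⟨a, ha, h⟩ := hM.bounded x (g ∘ₗ f)
    exact ⟨a, ha, by rintro _ ⟨m, hm, rfl⟩; exact h m hm⟩

theorem IsBounded.generic {M : StalkFamily k Q L V} (hM : IsBounded M) {x : Point k Q L}
    (hx : x.ring = ⊤) (w : V) : w ∈ M x := by
  obtain ⟨a, ha, h⟩ := hM.absorb x w
  have := smul_mem_stalk (x := x) (a := a⁻¹) (by rw [hx]; exact ValuationSubring.mem_top _) h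
  rwa [smul_smul, inv_mul_cancel₀ ha, one_smul] at this

variable {T : FunField k Q L}

theorem IsBounded.exists_polynomial_smul_mem {M : StalkFamily k Q L V} (hM : IsBounded M)
    (hT : IsSeparating L T) (w : V) :
    ∃ p : Polynomial L, p ≠ 0 ∧ ∀ x : Point k Q L, T ∈ x.ring → Polynomial.aeval T p • w ∈ M x := by
  classical
  choose a ha0 ha using fun x => hM.absorb x w
  choose p hp0 hp using fun x => exists_polynomial_mul_mem hT (a x)⁻¹
  refine ⟨∏ x ∈ (hM.fin_mem w).toFinset, p x, Finset.prod_ne_zero_iff.2 fun x _ => hp0 x,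
    fun x hx => ?_⟩
  have hmem : ∀ p : Polynomial L, Polynomial.aeval T p ∈ x.ring := aeval_mem x.algebraMap_mem hx
  by_cases hw : w ∈ M x
  · exact smul_mem_stalk (hmem _) hw
  · rw [← Finset.prod_erase_mul _ _ ((hM.fin_mem w).mem_toFinset.2 hw), map_mul, mul_smul]
    refine smul_mem_stalk (hmem _) ?_
    have h1 := smul_mem_stalk (hp x _ x.algebraMap_mem hx) (ha x)
    rwa [smul_smul, mul_assoc, inv_mul_cancel₀ (ha0 x), mul_one] at h1

theorem IsBounded.exists_polynomial_mul_mem_dual {M : StalkFamily k Q L V} (hM : IsBounded M)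
    (hT : IsSeparating L T) (f : V →ₗ[FunField k Q L] FunField k Q L) :
    ∃ p : Polynomial L, p ≠ 0 ∧ ∀ x : Point k Q L, T ∈ x.ring → ∀ m ∈ M x,
      Polynomial.aeval T p * f m ∈ x.ring := by
  classical
  choose a ha0 ha using fun x => hM.bounded x f
  choose p hp0 hp using fun x => exists_polynomial_mul_mem hT (a x)⁻¹
  refine ⟨∏ x ∈ (hM.fin_dual f).toFinset, p x, Finset.prod_ne_zero_iff.2 fun x _ => hp0 x,
    fun x hx m hm => ?_⟩
  have hmem : ∀ p : Polynomial L, Polynomial.aeval T p ∈ x.ring := aeval_mem x.algebraMap_mem hx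
  by_cases hw : ∀ m ∈ M x, f m ∈ x.ring
  · exact x.ring.mul_mem _ _ (hmem _) (hw m hm)
  · rw [← Finset.prod_erase_mul _ _ ((hM.fin_dual f).mem_toFinset.2 hw), map_mul, mul_assoc]
    refine x.ring.mul_mem _ _ (hmem _) ?_
    have h1 := x.ring.mul_mem _ _ (hp x _ x.algebraMap_mem hx) (ha x m hm)
    rwa [mul_assoc, inv_mul_cancel_left₀ (ha0 x)] at h1

theorem IsBounded.exists_pow_smul_mem {M : StalkFamily k Q L V} (hM : IsBounded M)
    (hT : IsSeparating L T) (w : V) :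
    ∃ n : ℕ, ∀ x : Point k Q L, T ∉ x.ring → T⁻¹ ^ n • w ∈ M x := by
  obtain ⟨p, hp0, hp⟩ := hM.exists_polynomial_smul_mem hT.inv w
  obtain ⟨n, hn⟩ := exists_pow_dvd_aeval (K := FunField k Q L) hp0
  refine ⟨n, fun x hx => ?_⟩
  have hs : T⁻¹ ∈ x.ring.nonunits := (ValuationSubring.inv_mem_nonunits_iff _).2 (Or.inr hx)
  obtain ⟨u, hu, hu', hu0, he⟩ := hn _ x.ring x.algebraMap_mem hs
  have := smul_mem_stalk hu' (hp x (ValuationSubring.nonunits_subset hs))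
  rw [he, smul_smul] at this
  convert this using 2
  field_simp

theorem IsBounded.exists_pow_mul_mem_dual {M : StalkFamily k Q L V} (hM : IsBounded M)
    (hT : IsSeparating L T) (f : V →ₗ[FunField k Q L] FunField k Q L) :
    ∃ n : ℕ, ∀ x : Point k Q L, T ∉ x.ring → ∀ m ∈ M x, T⁻¹ ^ n * f m ∈ x.ring := by
  obtain ⟨p, hp0, hp⟩ := hM.exists_polynomial_mul_mem_dual hT.inv f
  obtain ⟨n, hn⟩ := exists_pow_dvd_aeval (K := FunField k Q L) hp0
  refine ⟨n, fun x hx m hm => ?_⟩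
  have hs : T⁻¹ ∈ x.ring.nonunits := (ValuationSubring.inv_mem_nonunits_iff _).2 (Or.inr hx)
  obtain ⟨u, hu, hu', hu0, he⟩ := hn _ x.ring x.algebraMap_mem hs
  have := x.ring.mul_mem _ _ hu' (hp x (ValuationSubring.nonunits_subset hs) m hm)
  rw [he] at this
  convert this using 1
  field_simp

/-- Strong approximation for one component. -/
theorem IsBounded.exists_approx_single {M : StalkFamily k Q L V} (hM : IsBounded M)
    (hT : IsSeparating L T) (x : Point k Q L) (w : V) :
    ∃ v : V, (T ∈ x.ring → v - w ∈ M x) ∧ ∀ y : Point k Q L, T ∈ y.ring → y ≠ x → v ∈ M y := by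
  classical
  by_cases hTx : T ∈ x.ring
  swap
  · exact ⟨0, fun h => absurd h hTx, fun y _ _ => zero_mem _⟩
  by_cases hx : x.ring = ⊤
  · exact ⟨0, fun _ => hM.generic hx _, fun y _ _ => zero_mem _⟩
  obtain ⟨p, hp0, hp⟩ := hM.exists_polynomial_smul_mem hT w
  obtain ⟨h1, h2⟩ := hT.isDedekindDomain
  let B := integralClosure (Algebra.adjoin L {T}) (FunField k Q L)
  have hpB : Polynomial.aeval T p ∈ B :=
    mem_integralClosure_of_forall fun v hE hTv => aeval_mem hE hTv p
  have hg0 := aeval_ne_zero hT.transcendental hp0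
  let S : Finset (Point k Q L) := (hM.fin_mem w).toFinset.filter fun y => T ∈ y.ring ∧ y ≠ x
  obtain ⟨h, hh1, hh2⟩ := exists_approx_of_dedekind (B := B) (v := x.ring)
    (mem_of_mem_integralClosure x.algebraMap_mem hTx) hx (S.image Point.ring)
    (by
      intro v hv
      obtain ⟨y, hy, rfl⟩ := Finset.mem_image.1 hv
      obtain ⟨hy1, hy2, hy3⟩ := Finset.mem_filter.1 hy
      refine ⟨mem_of_mem_integralClosure y.algebraMap_mem hy2, fun htop => ?_⟩
      exact (hM.fin_mem w).mem_toFinset.1 hy1 (hM.generic htop w))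
    (by
      intro hv
      obtain ⟨y, hy, hyx⟩ := Finset.mem_image.1 hv
      exact (Finset.mem_filter.1 hy).2.2 (Point.ext hyx))
    (⟨_, hpB⟩ : B) (fun h => hg0 (congrArg Subtype.val h))
  change ((h : FunField k Q L) - 1) / Polynomial.aeval T p ∈ x.ring at hh1
  refine ⟨(h : FunField k Q L) • w, fun _ => ?_, fun y hy hyx => ?_⟩
  · have h3 := smul_mem_stalk hh1 (hp x hTx)
    rwa [smul_smul, div_mul_cancel₀ _ hg0, sub_smul, one_smul] at h3
  · by_cases hw : w ∈ M y
    · exact smul_mem_stalk (mem_of_mem_integralClosure y.algebraMap_mem hy h) hw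
    · have h3 : (h : FunField k Q L) / Polynomial.aeval T p ∈ y.ring := hh2 y.ring
        (Finset.mem_image_of_mem _ (Finset.mem_filter.2 ⟨(hM.fin_mem w).mem_toFinset.2 hw, hy, hyx⟩))
      have h4 := smul_mem_stalk h3 (hp y hy)
      rwa [smul_smul, div_mul_cancel₀ _ hg0] at h4

variable [Module L V] [IsScalarTower L (FunField k Q L) V]

/-- A module over the local ring at `x` as a vector space over `L`. -/
noncomputable def Point.overL (x : Point k Q L) (N : Submodule x.ring V) : Submodule L V where
  carrier := N
  zero_mem' := zero_mem _
  add_mem' := add_mem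
  smul_mem' l m hm := by
    rw [← algebraMap_smul (FunField k Q L) l m]
    exact smul_mem_stalk (x.algebraMap_mem l) hm

theorem Point.mem_overL {x : Point k Q L} {N : Submodule x.ring V} {m : V} :
    m ∈ x.overL N ↔ m ∈ N := Iff.rfl

/-- The stalks as `L`-subspaces. -/
noncomputable def StalkFamily.overL (M : StalkFamily k Q L V) (x : Point k Q L) : Submodule L V :=
  x.overL (M x)

theorem IsBounded.exists_approx {M : StalkFamily k Q L V} (hM : IsBounded M)
    (hT : IsSeparating L T) (ξ : Π₀ x, V ⧸ M.overL x) :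
    ∃ v : V, ∀ x : Point k Q L, T ∈ x.ring → (M.overL x).mkQ v = ξ x := by
  classical
  induction ξ using DFinsupp.induction with
  | h0 => exact ⟨0, fun x _ => by rw [map_zero, DFinsupp.zero_apply]⟩
  | ha y b ξ _ _ ih =>
    obtain ⟨v, hv⟩ := ih
    obtain ⟨w, rfl⟩ := Submodule.Quotient.mk_surjective _ b
    obtain ⟨u, hu1, hu2⟩ := hM.exists_approx_single hT y w
    refine ⟨u + v, fun x hx => ?_⟩
    rw [map_add, DFinsupp.add_apply, hv x hx]
    congr 1
    by_cases hxy : x = y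
    · subst hxy
      rw [DFinsupp.single_eq_same]
      exact (Submodule.Quotient.eq _).2 (hu1 hx)
    · rw [DFinsupp.single_eq_of_ne hxy]
      exact (Submodule.Quotient.mk_eq_zero _).2 (hu2 x hx hxy)

theorem IsBounded.finite_H0 [FiniteDimensional (FunField k Q L) V] {M : StalkFamily k Q L V}
    (hM : IsBounded M) : Module.Finite L (⨅ x, M.overL x : Submodule L V) := by
  obtain ⟨t, ht⟩ := exists_isSeparating_curve k Q
  have hT := isSeparating_ofQ (L := L) ht
  set T := ofQ k Q L t
  let b := Module.finBasis (FunField k Q L) V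
  choose p hp0 hp using fun i => hM.exists_polynomial_mul_mem_dual hT (b.coord i)
  choose n hn using fun i => hM.exists_pow_mul_mem_dual hT (b.coord i)
  let τ : V →ₗ[L] (Fin (Module.finrank (FunField k Q L) V) → FunField k Q L) :=
    LinearMap.pi fun i => (LinearMap.mulLeft L (Polynomial.aeval T (p i))) ∘ₗ
      ((b.coord i).restrictScalars L)
  have hτ : ∀ m ∈ (⨅ x, M.overL x : Submodule L V), ∀ i,
      τ m i ∈ sectionsPole T (n i + (p i).natDegree) L := by
    intro m hm i v hE
    rw [Submodule.mem_iInf] at hm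
    have hm' : m ∈ M ⟨v, hE⟩ := hm ⟨v, hE⟩
    refine ⟨fun h => hp i ⟨v, hE⟩ h m hm', fun h => ?_⟩
    change T⁻¹ ^ (n i + (p i).natDegree) * (Polynomial.aeval T (p i) * b.coord i m) ∈ v
    have h1 := inv_pow_mul_aeval_mem hE h (le_refl (p i).natDegree)
    have h2 := v.mul_mem _ _ h1 (hn i ⟨v, hE⟩ h m hm')
    convert h2 using 1
    rw [pow_add]; ring
  have := fun i => finite_sectionsPole hT (n i + (p i).natDegree)
  let τ' : (⨅ x, M.overL x : Submodule L V) →ₗ[L] (∀ i, sectionsPole T (n i + (p i).natDegree) L) :=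
    LinearMap.pi fun i => ((LinearMap.proj i ∘ₗ τ).comp (Submodule.subtype _)).codRestrict _
      fun m => hτ m m.2 i
  refine Module.Finite.of_injective τ' ?_
  rw [injective_iff_map_eq_zero]
  intro m hm
  refine Subtype.ext (b.repr.map_eq_zero_iff.1 ?_)
  ext i
  have h1 : Polynomial.aeval T (p i) * b.coord i m = 0 := congrArg Subtype.val (congrFun hm i)
  exact (mul_eq_zero.1 h1).resolve_left (aeval_ne_zero hT.transcendental (hp0 i))

/-- `V` is the sum of the sections away from the poles of `T`, the sections at the poles of `T` and
a finite dimensional subspace. -/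
theorem IsBounded.exists_finite_sup [FiniteDimensional (FunField k Q L) V] {M : StalkFamily k Q L V}
    (hM : IsBounded M) {T : FunField k Q L} (hT : IsSeparating L T) :
    ∃ E : Submodule L V, Module.Finite L E ∧ ∀ v : V, ∃ e ∈ E, ∃ a b : V, v = a + b + e ∧
      (∀ x : Point k Q L, T ∈ x.ring → a ∈ M x) ∧ ∀ x : Point k Q L, T ∉ x.ring → b ∈ M x := by
  classical
  have hT0 := hT.ne_zero
  have := hT.finiteDimensional
  set F := IntermediateField.adjoin L {T} with hF
  have hTF : T ∈ F := IntermediateField.mem_adjoin_simple_self L T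
  let β := Module.finBasis F (FunField k Q L)
  let γ := Module.finBasis (FunField k Q L) V
  let w₀ := fun ij : Fin (Module.finrank F (FunField k Q L)) × Fin (Module.finrank (FunField k Q L) V) =>
    β ij.1 • γ ij.2
  choose p hp0 hp using fun ij => hM.exists_polynomial_smul_mem hT (w₀ ij)
  let w := fun ij => Polynomial.aeval T (p ij) • w₀ ij
  choose m hm using fun ij => hM.exists_pow_smul_mem hT (w ij)
  let c := ∑ ij, m ij
  have hc : ∀ ij, m ij ≤ c := fun ij =>
    Finset.single_le_sum (f := m) (fun _ _ => Nat.zero_le _) (Finset.mem_univ ij)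
  let E : Submodule L V := Submodule.span L (Set.range fun z :
    (Fin (Module.finrank F (FunField k Q L)) × Fin (Module.finrank (FunField k Q L) V)) × Fin c =>
      T⁻¹ ^ ((z.2 : ℕ) + 1) • w z.1)
  refine ⟨E, Module.Finite.span_of_finite L (Set.finite_range _), ?_⟩
  let P : V → Prop := fun v => ∃ e ∈ E, ∃ a b : V, v = a + b + e ∧
      (∀ x : Point k Q L, T ∈ x.ring → a ∈ M x) ∧ ∀ x : Point k Q L, T ∉ x.ring → b ∈ M x
  have hPadd : ∀ u v, P u → P v → P (u + v) := by
    rintro _ _ ⟨e, he, a, b, rfl, ha, hb⟩ ⟨e', he', a', b', rfl, ha', hb'⟩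
    exact ⟨e + e', add_mem he he', a + a', b + b', by abel,
      fun x hx => add_mem (ha x hx) (ha' x hx), fun x hx => add_mem (hb x hx) (hb' x hx)⟩
  have hPsum : ∀ {ι : Type} (s : Finset ι) (f : ι → V), (∀ i ∈ s, P (f i)) → P (∑ i ∈ s, f i) := by
    intro ι s f hf
    induction s using Finset.induction_on with
    | empty => exact ⟨0, zero_mem _, 0, 0, by simp, fun x _ => zero_mem _, fun x _ => zero_mem _⟩
    | insert i s hi ih =>
      rw [Finset.sum_insert hi]
      exact hPadd _ _ (hf i (Finset.mem_insert_self _ _))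
        (ih fun j hj => hf j (Finset.mem_insert_of_mem hj))
  have hPF : ∀ f ∈ F, ∀ ij, P (f • w ij) := by
    intro f hf ij
    obtain ⟨r, q, rfl⟩ := (IntermediateField.mem_adjoin_simple_iff L _).1 hf
    rcases eq_or_ne q 0 with rfl | hq0
    · exact ⟨0, zero_mem _, 0, 0, by simp, fun x _ => zero_mem _, fun x _ => zero_mem _⟩
    have hqT := aeval_ne_zero hT.transcendental hq0
    set g := Polynomial.X ^ c * r / q
    set h := Polynomial.X ^ c * r % q with hh
    have e1 : q * g + h = Polynomial.X ^ c * r := EuclideanDomain.div_add_mod _ _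
    have e2 : g %ₘ (Polynomial.X ^ c) + Polynomial.X ^ c * (g /ₘ Polynomial.X ^ c) = g :=
      Polynomial.modByMonic_add_div g (Polynomial.X ^ c)
    set g₁ := g /ₘ (Polynomial.X ^ c)
    set g₂ := g %ₘ (Polynomial.X ^ c) with hg₂
    have e3 := congrArg (Polynomial.aeval T) e1
    have e4 := congrArg (Polynomial.aeval T) e2
    simp only [map_add, map_mul, map_pow, Polynomial.aeval_X] at e3 e4
    have e5 : Polynomial.aeval T r / Polynomial.aeval T q = Polynomial.aeval T g₁ +
        T⁻¹ ^ c * (Polynomial.aeval T h / Polynomial.aeval T q) + T⁻¹ ^ c * Polynomial.aeval T g₂ := by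
      rw [← e4] at e3
      rw [inv_pow]
      field_simp
      linear_combination -e3
    refine ⟨(T⁻¹ ^ c * Polynomial.aeval T g₂) • w ij, ?_, Polynomial.aeval T g₁ • w ij,
      (T⁻¹ ^ c * (Polynomial.aeval T h / Polynomial.aeval T q)) • w ij,
      by rw [e5, add_smul, add_smul], fun x hx => ?_, fun x hx => ?_⟩
    · rcases Nat.eq_zero_or_pos c with hc0 | hc0
      · have : g₂ = 0 := by rw [hg₂, hc0, pow_zero, Polynomial.modByMonic_one]
        rw [this, map_zero, mul_zero, zero_smul]; exact zero_mem _
      have hdeg : g₂.natDegree < c := by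
        have := Polynomial.natDegree_modByMonic_lt g (Polynomial.monic_X_pow (R := L) c)
          (fun h => by
            have := congrArg Polynomial.natDegree h
            rw [Polynomial.natDegree_X_pow, Polynomial.natDegree_one] at this
            omega)
        rwa [Polynomial.natDegree_X_pow] at this
      rw [Polynomial.aeval_eq_sum_range' hdeg, Finset.mul_sum, Finset.sum_smul]
      refine sum_mem fun j hj => ?_
      have hj' := Finset.mem_range.1 hj
      have e6 : T⁻¹ ^ c * g₂.coeff j • T ^ j = algebraMap L (FunField k Q L) (g₂.coeff j) *
          T⁻¹ ^ (c - 1 - j + 1) := by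
        have : c = (c - 1 - j + 1) + j := by omega
        conv_lhs => rw [this]
        rw [Algebra.smul_def, pow_add, inv_pow, inv_pow]
        field_simp
      rw [e6, mul_smul, algebraMap_smul]
      exact Submodule.smul_mem _ _ (Submodule.subset_span ⟨(ij, ⟨c - 1 - j, by omega⟩), rfl⟩)
    · exact smul_mem_stalk (aeval_mem x.algebraMap_mem hx _) (hp ij x hx)
    · rw [mul_comm, mul_smul]
      refine smul_mem_stalk (aeval_div_aeval_mem x.algebraMap_mem hx hq0 ?_) ?_
      · exact Polynomial.natDegree_le_natDegree (Polynomial.degree_mod_lt _ hq0).le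
      · obtain ⟨d, hd⟩ := Nat.exists_eq_add_of_le (hc ij)
        rw [hd, add_comm, pow_add, mul_smul]
        exact smul_mem_stalk (pow_mem ((x.ring.mem_or_inv_mem T).resolve_left hx) d) (hm ij x hx)
  intro v
  have hv : v = ∑ j, ∑ i, ((β.repr (γ.repr v j) i : F) : FunField k Q L) • w₀ (i, j) := by
    conv_lhs => rw [← γ.sum_repr v]
    refine Finset.sum_congr rfl fun j _ => ?_
    conv_lhs => rw [← β.sum_repr (γ.repr v j)]
    rw [Finset.sum_smul]
    refine Finset.sum_congr rfl fun i _ => ?_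
    rw [Algebra.smul_def, mul_smul]; rfl
  change P v
  rw [hv]
  refine hPsum _ _ fun j _ => hPsum _ _ fun i _ => ?_
  have hpT := aeval_ne_zero hT.transcendental (hp0 (i, j))
  have h1 := hPF _ (F.div_mem (SetLike.coe_mem (β.repr (γ.repr v j) i))
    (aeval_mem_intermediateField F hTF (p (i, j)))) (i, j)
  rwa [← mul_smul, div_mul_cancel₀ _ hpT] at h1

theorem IsBounded.finite_H1 [FiniteDimensional (FunField k Q L) V] {M : StalkFamily k Q L V}
    (hM : IsBounded M) : Module.Finite L (H1 M.overL hM.fin_mem) := by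
  classical
  obtain ⟨t, ht⟩ := exists_isSeparating_curve k Q
  have hT := isSeparating_ofQ (L := L) ht
  set T := ofQ k Q L t
  obtain ⟨E, hE, hV⟩ := hM.exists_finite_sup hT
  let D := quotDiag M.overL hM.fin_mem
  let θ : V →ₗ[L] Π₀ x, V ⧸ M.overL x :=
    (DFinsupp.filterLinearMap L (fun x => V ⧸ M.overL x) fun x => T ∉ x.ring) ∘ₗ D
  have hθ : ∀ v x, θ v x = if T ∉ x.ring then D v x else 0 := fun v x => DFinsupp.filter_apply _ _ _
  refine Module.Finite.of_surjective
    ((LinearMap.range D).mkQ ∘ₗ θ ∘ₗ E.subtype) fun z => ?_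
  obtain ⟨ξ, rfl⟩ := Submodule.Quotient.mk_surjective _ z
  obtain ⟨v₁, hv₁⟩ := hM.exists_approx hT ξ
  obtain ⟨v₂, hv₂⟩ := hM.exists_approx hT.inv (ξ - D v₁)
  obtain ⟨e, he, a, b, rfl, ha, hb⟩ := hV v₂
  refine ⟨⟨e, he⟩, (Submodule.Quotient.eq _).2 ⟨-(v₁ + a), ?_⟩⟩
  ext x
  change (D (-(v₁ + a))) x = (θ e - ξ) x
  rw [DFinsupp.sub_apply, hθ]
  change (M.overL x).mkQ (-(v₁ + a)) = _
  by_cases hx : T ∈ x.ring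
  · rw [if_neg (not_not.2 hx), ← hv₁ x hx, zero_sub, ← map_neg]
    refine (Submodule.Quotient.eq _).2 ?_
    have : -(v₁ + a) - -v₁ = -a := by abel
    rw [this]
    exact neg_mem (ha x hx)
  · rw [if_pos hx]
    have h1 := hv₂ x ((x.ring.mem_or_inv_mem T).resolve_left hx)
    have h2 : ξ x = (M.overL x).mkQ v₁ + (M.overL x).mkQ (a + b + e) := by
      rw [h1]
      change ξ x = D v₁ x + (ξ x - D v₁ x)
      abel
    rw [h2]
    change _ = (M.overL x).mkQ e - _
    rw [← map_add, ← map_sub]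
    refine (Submodule.Quotient.eq _).2 ?_
    have : -(v₁ + a) - (e - (v₁ + (a + b + e))) = b := by abel
    rw [this]
    exact hb x hx

end BoundedFamily


/-! ### Comparison of the cokernels of a linear and a semilinear map -/

section Coker

set_option linter.unusedSectionVars false

variable {k Q L : Type u} [Field k] [Fintype k] [Field Q] [Algebra k Q] [IsCurve k Q]
  [Field L] [Algebra k L]
variable {V W : Type u} [AddCommGroup V] [Module (FunField k Q L) V]
  [AddCommGroup W] [Module (FunField k Q L) W]

theorem mk_smul_cokerStalk (N M : StalkFamily k Q L V) (x : Point k Q L) (l : L) (m : M x) :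
    l • (Submodule.Quotient.mk m : CokerStalk N M x) =
      Submodule.Quotient.mk (x.constants l • m) := rfl

theorem subset_mapSigma (T : V →ₛₗ[sigma k Q L] W) (M : StalkFamily k Q L V) {x : Point k Q L}
    {m : V} (hm : m ∈ M x.frob) : T m ∈ M.mapSigma T x := Submodule.subset_span ⟨m, hm, rfl⟩

theorem finite_notMem_mapSigma {M : StalkFamily k Q L V} (hM : ∀ w, {x | w ∉ M x}.Finite)
    (T : V →ₛₗ[sigma k Q L] W) (hT : Submodule.span (FunField k Q L) (Set.range T) = ⊤) (w : W) :
    {x | w ∉ M.mapSigma T x}.Finite := by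
  have hw : w ∈ Submodule.span (FunField k Q L) (Set.range T) := by rw [hT]; trivial
  induction hw using Submodule.span_induction with
  | mem w hw =>
    obtain ⟨v, rfl⟩ := hw
    refine ((hM v).preimage (frobEquiv k Q L).injective.injOn).subset fun x hx h => hx ?_
    exact subset_mapSigma T M h
  | zero => simp
  | add v w _ _ hv hw =>
    refine (hv.union hw).subset fun x hx => ?_
    by_contra h
    simp only [Set.mem_union, Set.mem_ofPred_eq, not_or, not_not] at h
    exact hx (add_mem h.1 h.2)
  | smul a w _ hw =>
    refine (hw.union (Point.finite_poles a)).subset fun x hx => ?_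
    by_contra h
    simp only [Set.mem_union, Set.mem_ofPred_eq, not_or, not_not] at h
    exact hx (smul_mem_stalk h.2 h.1)

theorem span_range_eq_top_of_linearIndependent [FiniteDimensional (FunField k Q L) V]
    (hVW : Module.finrank (FunField k Q L) V = Module.finrank (FunField k Q L) W)
    [FiniteDimensional (FunField k Q L) W]
    (T : V →ₛₗ[sigma k Q L] W) (hT : ∀ (n : ℕ) (s : Fin n → V),
      LinearIndependent (FunField k Q L) s → LinearIndependent (FunField k Q L) fun j => T (s j)) :
    Submodule.span (FunField k Q L) (Set.range T) = ⊤ := by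
  have h := (hT _ _ (Module.finBasis (FunField k Q L) V).linearIndependent).span_eq_top_of_card_eq_finrank'
    (by rw [Fintype.card_fin, hVW])
  rw [eq_top_iff, ← h]
  exact Submodule.span_mono (by rintro _ ⟨i, rfl⟩; exact ⟨_, rfl⟩)

section OverL

variable [Module L V] [IsScalarTower L (FunField k Q L) V]

/-- The stalks of the cokernel in terms of `L`-subspaces. -/
noncomputable def cokerStalkEquiv (N M : StalkFamily k Q L V) (x : Point k Q L) :
    (M.overL x ⧸ (N.overL x).submoduleOf (M.overL x)) ≃ₗ[L] CokerStalk N M x :=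
  LinearEquiv.ofBijective
    (((N.overL x).submoduleOf (M.overL x)).liftQ
      ({ toFun := fun m => (Submodule.Quotient.mk ⟨m.1, m.2⟩ : CokerStalk N M x)
         map_add' := fun _ _ => rfl
         map_smul' := fun l m => by
          rw [RingHom.id_apply, mk_smul_cokerStalk]
          congr 1
          exact Subtype.ext (algebraMap_smul (FunField k Q L) l m.1).symm } :
        M.overL x →ₗ[L] CokerStalk N M x)
      (fun m hm => (Submodule.Quotient.mk_eq_zero _).2 hm))
    ⟨by
      rw [← LinearMap.ker_eq_bot, Submodule.ker_liftQ_eq_bot']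
      ext m
      exact (Submodule.Quotient.mk_eq_zero ((N x).submoduleOf (M x))).symm,
    fun z => by
      obtain ⟨m, rfl⟩ := Submodule.Quotient.mk_surjective _ z
      exact ⟨Submodule.Quotient.mk ⟨m.1, m.2⟩, rfl⟩⟩

theorem cokerDim_eq_rank (N M : StalkFamily k Q L V) :
    cokerDim N M = Module.rank L (Π₀ x, (M.overL x ⧸ (N.overL x).submoduleOf (M.overL x))) :=
  (DFinsupp.mapRange.linearEquiv fun x => cokerStalkEquiv N M x).rank_eq.symm

end OverL

theorem cokerDim_mapSigma_le [FiniteDimensional (FunField k Q L) V] {M : StalkFamily k Q L V}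
    {N : StalkFamily k Q L W} (hM : IsBounded M) (hN : IsBounded N) (P : V ≃ₗ[FunField k Q L] W)
    (hP : M.map P.toLinearMap ≤ N) (T : V →ₛₗ[sigma k Q L] W) (hT : M.mapSigma T ≤ N)
    (hLI : ∀ (n : ℕ) (s : Fin n → V),
      LinearIndependent (FunField k Q L) s → LinearIndependent (FunField k Q L) fun j => T (s j)) :
    cokerDim (M.mapSigma T) N ≤ cokerDim (M.map P.toLinearMap) N ∧
      cokerDim (M.map P.toLinearMap) N < Cardinal.aleph0 := by
  let _ : Module L V := Module.compHom V (algebraMap L (FunField k Q L))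
  let _ : Module L W := Module.compHom W (algebraMap L (FunField k Q L))
  have : IsScalarTower L (FunField k Q L) V := IsScalarTower.of_algebraMap_smul fun _ _ => rfl
  have : IsScalarTower L (FunField k Q L) W := IsScalarTower.of_algebraMap_smul fun _ _ => rfl
  have : FiniteDimensional (FunField k Q L) W := P.finiteDimensional
  have hPM : IsBounded (M.map P.toLinearMap) := hM.map P.surjective
  have hspan := span_range_eq_top_of_linearIndependent P.finrank_eq T hLI
  have hfin := finite_notMem_mapSigma hM.fin_mem T hspan
  have i1 := hN.finite_H0
  have i2 := hPM.finite_H1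
  have i3 := hM.finite_H0
  have i4 := hM.finite_H1
  have i5 : Module.Finite L (⨅ x, (M.mapSigma T).overL x : Submodule L W) :=
    Submodule.finiteDimensional_of_le (S₂ := ⨅ x, N.overL x) (iInf_mono fun x => hT x)
  obtain ⟨h0, h1, h2⟩ := euler_le_of_semilinear (frobSemilinear T)
    (linearIndependent_frobSemilinear (Module.finBasis (FunField k Q L) V) T
      (hLI _ _ (Module.finBasis (FunField k Q L) V).linearIndependent))
    (span_range_frobSemilinear T hspan) (frobEquiv k Q L) M.overL hM.fin_mem
    (M.mapSigma T).overL hfin (fun x v hv => subset_mapSigma T M hv)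
  obtain ⟨g0, g1, g2⟩ := euler_le_of_semilinear (P.symm.toLinearMap.restrictScalars L)
    (fun n s hs => hs.map' (P.symm.toLinearMap.restrictScalars L)
      (LinearMap.ker_eq_bot.2 P.symm.injective))
    (by
      rw [eq_top_iff]
      exact fun v _ => Submodule.subset_span ⟨P v, P.symm_apply_apply v⟩)
    (Equiv.refl _) (M.map P.toLinearMap).overL hPM.fin_mem M.overL hM.fin_mem
    (fun x v hv => by
      obtain ⟨m, hm, rfl⟩ := hv
      have : P.symm (P m) = m := P.symm_apply_apply m
      change P.symm (P m) ∈ M x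
      rwa [this])
  obtain ⟨a1, a2, a3⟩ := euler_add (M.map P.toLinearMap).overL N.overL hPM.fin_mem hN.fin_mem (fun x => hP x)
  obtain ⟨b1, b2, b3⟩ := euler_add (M.mapSigma T).overL N.overL hfin hN.fin_mem (fun x => hT x)
  rw [cokerDim_eq_rank, cokerDim_eq_rank, ← Module.finrank_eq_rank, ← Module.finrank_eq_rank]
  refine ⟨?_, Cardinal.natCast_lt_aleph0⟩
  rw [Nat.cast_le]
  omega

end Coker


/-! ### Relative dimensions of subspaces -/

section RelDim

variable {L X Y Z : Type u} [Field L] [AddCommGroup X] [Module L X] [AddCommGroup Y] [Module L Y]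
  [AddCommGroup Z] [Module L Z]

/-- The dimension of `B / A` for subspaces `A ≤ B`. -/
noncomputable def relDim (A B : Submodule L X) : Cardinal.{u} :=
  Module.rank L (B ⧸ A.submoduleOf B)

theorem rank_add_rank_of_exact (f : X →ₗ[L] Y) (g : Y →ₗ[L] Z) (hf : Function.Injective f)
    (hg : Function.Surjective g) (h : LinearMap.range f = LinearMap.ker g) :
    Module.rank L X + Module.rank L Z = Module.rank L Y := by
  rw [← g.rank_range_add_rank_ker, ← h, rank_range_of_injective f hf,
    rank_range_of_surjective g hg, add_comm]

theorem relDim_add_of_exact (f : X →ₗ[L] Y) (g : Y →ₗ[L] Z) {A B : Submodule L X}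
    {A' B' : Submodule L Y} {A'' B'' : Submodule L Z} (hB : ∀ b ∈ B, f b ∈ B')
    (hA : ∀ b ∈ B, f b ∈ A' ↔ b ∈ A) (hB'' : ∀ b ∈ B', g b ∈ B'')
    (hA'' : ∀ b ∈ B', g b ∈ A'' ↔ ∃ x ∈ B, b - f x ∈ A')
    (hsurj : ∀ z ∈ B'', ∃ b ∈ B', g b - z ∈ A'') :
    relDim A B + relDim A'' B'' = relDim A' B' := by
  let f₁ : B →ₗ[L] B' := f.restrict hB
  let g₁ : B' →ₗ[L] B'' := g.restrict hB''
  have h1 : A.submoduleOf B ≤ (A'.submoduleOf B').comap f₁ := fun b hb => (hA b b.2).2 hb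
  have h2 : A'.submoduleOf B' ≤ (A''.submoduleOf B'').comap g₁ := fun b hb =>
    (hA'' b b.2).2 ⟨0, zero_mem _, by rw [map_zero, sub_zero]; exact hb⟩
  refine rank_add_rank_of_exact (Submodule.mapQ _ _ f₁ h1) (Submodule.mapQ _ _ g₁ h2) ?_ ?_ ?_
  · rw [injective_iff_map_eq_zero]
    intro b hb
    obtain ⟨b, rfl⟩ := Submodule.Quotient.mk_surjective _ b
    rw [Submodule.mapQ_apply, Submodule.Quotient.mk_eq_zero] at hb
    exact (Submodule.Quotient.mk_eq_zero _).2 ((hA b b.2).1 hb)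
  · intro z
    obtain ⟨z, rfl⟩ := Submodule.Quotient.mk_surjective _ z
    obtain ⟨b, hb, h⟩ := hsurj z z.2
    exact ⟨Submodule.Quotient.mk ⟨b, hb⟩, (Submodule.Quotient.eq _).2 h⟩
  · ext b
    obtain ⟨b, rfl⟩ := Submodule.Quotient.mk_surjective _ b
    rw [LinearMap.mem_ker, Submodule.mapQ_apply, Submodule.Quotient.mk_eq_zero]
    refine Iff.trans ?_ (hA'' b b.2).symm
    constructor
    · rintro ⟨x, hx⟩
      obtain ⟨x, rfl⟩ := Submodule.Quotient.mk_surjective _ x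
      rw [Submodule.mapQ_apply] at hx
      exact ⟨x, x.2, (Submodule.Quotient.eq (A'.submoduleOf B')).1 hx.symm⟩
    · rintro ⟨x, hx, h⟩
      exact ⟨Submodule.Quotient.mk ⟨x, hx⟩, ((Submodule.Quotient.eq (A'.submoduleOf B')).2 h).symm⟩

theorem relDim_eq_zero_iff {A B : Submodule L X} : relDim A B = 0 ↔ B ≤ A := by
  rw [relDim, rank_zero_iff, Submodule.Quotient.subsingleton_iff, Submodule.submoduleOf,
    Submodule.comap_subtype_eq_top]

theorem relDim_add {A B C : Submodule L X} (hAB : A ≤ B) (hBC : B ≤ C) :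
    relDim A B + relDim B C = relDim A C :=
  relDim_add_of_exact LinearMap.id LinearMap.id (fun _ h => hBC h) (fun _ _ => Iff.rfl)
    (fun _ h => h)
    (fun b _ => ⟨fun h => ⟨b, h, by simp⟩, fun ⟨x, hx, h⟩ => by
      have := add_mem (hAB h) hx
      rwa [LinearMap.id_apply, sub_add_cancel] at this⟩)
    (fun z hz => ⟨z, hz, by simp⟩)

theorem relDim_map (f : X →ₗ[L] Y) (hf : Function.Injective f) (A B : Submodule L X) :
    relDim (A.map f) (B.map f) = relDim A B := by
  have h0 : relDim (⊥ : Submodule L X) ⊥ = 0 := relDim_eq_zero_iff.2 le_rfl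
  rw [← add_zero (relDim A B), ← h0]
  symm
  refine relDim_add_of_exact f (0 : Y →ₗ[L] X) (fun b hb => ⟨b, hb, rfl⟩) (fun b _ => ?_)
    (fun _ _ => zero_mem _) (fun b hb => ?_) (fun z hz => ⟨0, zero_mem _, ?_⟩)
  · exact ⟨fun ⟨a, ha, h⟩ => hf h ▸ ha, fun h => ⟨b, h, rfl⟩⟩
  · refine ⟨fun _ => ?_, fun _ => zero_mem _⟩
    obtain ⟨x, hx, rfl⟩ := hb
    exact ⟨x, hx, by rw [sub_self]; exact zero_mem _⟩
  · rw [map_zero, zero_sub]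
    exact neg_mem hz

theorem relDim_comap_add_map (q : X →ₗ[L] Y) (U : Submodule L X) (hU : LinearMap.ker q = U)
    {A B : Submodule L X} (hAB : A ≤ B) :
    relDim (A.comap U.subtype) (B.comap U.subtype) + relDim (A.map q) (B.map q) = relDim A B := by
  subst hU
  refine relDim_add_of_exact (Submodule.subtype _) q (fun b hb => hb) (fun _ _ => Iff.rfl)
    (fun b hb => ⟨b, hb, rfl⟩) (fun b hb => ⟨?_, ?_⟩) ?_
  · rintro ⟨a, ha, h⟩
    refine ⟨⟨b - a, ?_⟩, sub_mem hb (hAB ha), ?_⟩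
    · rw [LinearMap.mem_ker, map_sub, h, sub_self]
    · rw [Submodule.subtype_apply, sub_sub_cancel]
      exact ha
  · rintro ⟨x, hx, h⟩
    refine ⟨_, h, ?_⟩
    rw [map_sub, Submodule.subtype_apply, LinearMap.mem_ker.1 x.2, sub_zero]
  · rintro _ ⟨b, hb, rfl⟩
    exact ⟨b, hb, by rw [sub_self]; exact zero_mem _⟩

theorem relDim_le_of_span {A B : Submodule L X} {n : ℕ} (b : Fin n → X) (hb : ∀ j, b j ∈ B)
    (h : ∀ v ∈ B, ∃ c : Fin n → L, v - ∑ j, c j • b j ∈ A) : relDim A B ≤ n := by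
  let f : (Fin n → L) →ₗ[L] (B ⧸ A.submoduleOf B) :=
    (A.submoduleOf B).mkQ ∘ₗ Fintype.linearCombination L (fun j => (⟨b j, hb j⟩ : B))
  have hf : Function.Surjective f := by
    intro z
    obtain ⟨v, rfl⟩ := Submodule.Quotient.mk_surjective _ z
    obtain ⟨c, hc⟩ := h v v.2
    refine ⟨c, ((Submodule.Quotient.eq _).2 ?_).symm⟩
    change ((v - Fintype.linearCombination L (fun j => (⟨b j, hb j⟩ : B)) c : B) : X) ∈ A
    rw [Fintype.linearCombination_apply]
    simpa using hc
  have := rank_range_le f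
  rwa [rank_range_of_surjective f hf, rank_fin_fun] at this

theorem exists_span_of_relDim_eq {A B : Submodule L X} {n : ℕ} (h : relDim A B = n) :
    ∃ b : Fin n → X, (∀ j, b j ∈ B) ∧ ∀ v ∈ B, ∃ c : Fin n → L, v - ∑ j, c j • b j ∈ A := by
  have hfr := Module.finrank_eq_of_rank_eq h
  have : Module.Finite L (B ⧸ A.submoduleOf B) := by
    rw [← Module.rank_lt_aleph0_iff]
    exact h.trans_lt Cardinal.natCast_lt_aleph0
  let β := Module.finBasisOfFinrankEq L (B ⧸ A.submoduleOf B) hfr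
  choose b hb using fun j => Submodule.Quotient.mk_surjective _ (β j)
  refine ⟨fun j => b j, fun j => (b j).2, fun v hv => ⟨fun j => β.repr (Submodule.Quotient.mk ⟨v, hv⟩) j, ?_⟩⟩
  have h1 := β.sum_repr (Submodule.Quotient.mk ⟨v, hv⟩)
  have h2 : (A.submoduleOf B).mkQ (⟨v, hv⟩ - ∑ j, β.repr (Submodule.Quotient.mk ⟨v, hv⟩) j • b j) = 0 := by
    rw [map_sub, map_sum]
    conv_lhs => enter [1]; rw [Submodule.mkQ_apply, ← h1]
    rw [sub_eq_zero]
    refine Finset.sum_congr rfl fun j _ => ?_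
    rw [map_smul, Submodule.mkQ_apply, hb]
  have h3 := (Submodule.Quotient.mk_eq_zero _).1 h2
  change ((⟨v, hv⟩ - ∑ j, β.repr (Submodule.Quotient.mk ⟨v, hv⟩) j • b j : B) : X) ∈ A at h3
  simpa using h3

theorem relDim_eq_of_basis {A B : Submodule L X} {n : ℕ} (b : Fin n → X) (hb : ∀ j, b j ∈ B)
    (h : ∀ v ∈ B, ∃ c : Fin n → L, v - ∑ j, c j • b j ∈ A)
    (h0 : ∀ c : Fin n → L, ∑ j, c j • b j ∈ A → c = 0) : relDim A B = n := by
  refine le_antisymm (relDim_le_of_span b hb h) ?_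
  let f : (Fin n → L) →ₗ[L] (B ⧸ A.submoduleOf B) :=
    (A.submoduleOf B).mkQ ∘ₗ Fintype.linearCombination L (fun j => (⟨b j, hb j⟩ : B))
  have hf : Function.Injective f := by
    rw [injective_iff_map_eq_zero]
    intro c hc
    refine h0 c ?_
    have h3 := (Submodule.Quotient.mk_eq_zero _).1 hc
    change ((Fintype.linearCombination L (fun j => (⟨b j, hb j⟩ : B)) c : B) : X) ∈ A at h3
    rw [Fintype.linearCombination_apply] at h3
    simpa using h3
  have := LinearMap.rank_le_of_injective f hf
  rwa [rank_fin_fun] at this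

end RelDim

theorem cardinal_sum_eq_single {ι : Type u} (f : ι → Cardinal.{u}) (x : ι) (h : ∀ y, y ≠ x → f y = 0) :
    Cardinal.sum f = f x := by
  refine le_antisymm ?_ (Cardinal.le_sum f x)
  have hx : ∀ z : (Σ y, (f y).out), z.1 = x := by
    intro z
    by_contra h'
    exact (Cardinal.mk_eq_zero_iff.1 ((Cardinal.mk_out _).trans (h z.1 h'))).elim z.2
  rw [Cardinal.sum, ← Cardinal.mk_out (f x)]
  refine Cardinal.mk_le_of_injective (f := fun z : (Σ y, (f y).out) => (hx z ▸ z.2 : (f x).out)) ?_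
  rintro ⟨y, a⟩ ⟨z, b⟩ hab
  obtain rfl : y = x := hx ⟨y, a⟩
  obtain rfl : z = y := hx ⟨z, b⟩
  exact congrArg _ hab

section StalkRelDim

set_option linter.unusedSectionVars false

variable {k Q L : Type u} [Field k] [Fintype k] [Field Q] [Algebra k Q] [IsCurve k Q]
  [Field L] [Algebra k L]
variable {V W : Type u} [AddCommGroup V] [Module (FunField k Q L) V]
  [AddCommGroup W] [Module (FunField k Q L) W]

section OverL

variable [Module L V] [IsScalarTower L (FunField k Q L) V]
  [Module L W] [IsScalarTower L (FunField k Q L) W]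

theorem cokerDim_eq_sum (N M : StalkFamily k Q L V) :
    cokerDim N M = Cardinal.sum fun x : Point k Q L => relDim (x.overL (N x)) (x.overL (M x)) := by
  rw [cokerDim_eq_rank]
  exact rank_directSum (R := L) fun x : Point k Q L => x.overL (M x) ⧸ (x.overL (N x)).submoduleOf (x.overL (M x))

theorem relDim_le_cokerDim (N M : StalkFamily k Q L V) (x : Point k Q L) :
    relDim (x.overL (N x)) (x.overL (M x)) ≤ cokerDim N M := by
  rw [cokerDim_eq_sum]
  exact Cardinal.le_sum _ x

theorem cokerDim_eq_zero_of_le {N M : StalkFamily k Q L V} (h : ∀ x, M x ≤ N x) :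
    cokerDim N M = 0 := by
  rw [cokerDim_eq_sum]
  have : (fun x : Point k Q L => relDim (x.overL (N x)) (x.overL (M x))) = fun _ => 0 :=
    funext fun x => relDim_eq_zero_iff.2 (h x)
  rw [this]
  simp

theorem cokerDim_eq_single {N M : StalkFamily k Q L V} (x : Point k Q L)
    (h : ∀ y, y ≠ x → M y ≤ N y) : cokerDim N M = relDim (x.overL (N x)) (x.overL (M x)) := by
  rw [cokerDim_eq_sum]
  exact cardinal_sum_eq_single _ x fun y hy => relDim_eq_zero_iff.2 (h y hy)

theorem cokerDim_sub_add_map {A B : StalkFamily k Q L V} (hAB : A ≤ B)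
    (q : V →ₗ[FunField k Q L] W) (U : Submodule (FunField k Q L) V) (hU : LinearMap.ker q = U) :
    cokerDim (A.sub U) (B.sub U) + cokerDim (A.map q) (B.map q) = cokerDim A B := by
  rw [cokerDim_eq_sum, cokerDim_eq_sum, cokerDim_eq_sum, ← Cardinal.sum_add_distrib']
  congr 1
  ext x
  exact relDim_comap_add_map (q.restrictScalars L) (U.restrictScalars L)
    (by subst hU; rfl) (A := x.overL (A x)) (B := x.overL (B x)) (hAB x)

theorem cokerDim_anti {A A' B : StalkFamily k Q L V} (hA : A ≤ A') (hB : A' ≤ B) :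
    cokerDim A' B ≤ cokerDim A B := by
  rw [cokerDim_eq_sum, cokerDim_eq_sum]
  refine Cardinal.sum_le_sum _ _ fun x => ?_
  rw [← relDim_add (A := x.overL (A x)) (B := x.overL (A' x)) (C := x.overL (B x)) (hA x) (hB x)]
  exact self_le_add_left _ _

end OverL

/-- A bounded family with finitely generated stalks is locally free. -/
theorem IsBounded.isLocallyFree [FiniteDimensional (FunField k Q L) V] {M : StalkFamily k Q L V}
    (hM : IsBounded M) (hfg : ∀ x, (M x).FG) :
    IsLocallyFree (Module.finrank (FunField k Q L) V) M := by
  intro x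
  have : Module.Finite x.ring (M x) := Module.Finite.iff_fg.2 (hfg x)
  have : Module.IsTorsionFree x.ring V := Module.IsTorsionFree.trans_faithfulSMul x.ring (FunField k Q L) V
  have : Module.Flat x.ring (M x) := by
    rw [Module.Flat.flat_iff_torsion_eq_bot_of_isBezout, ← Submodule.isTorsionFree_iff_torsion_eq_bot]
    infer_instance
  have : Module.Free x.ring (M x) := Module.free_of_flat_of_isLocalRing
  let β := Module.Free.chooseBasis x.ring (M x)
  let b₀ : Module.Free.ChooseBasisIndex x.ring (M x) → V := fun i => β i
  have hspan : Submodule.span x.ring (Set.range b₀) = M x := by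
    have h := congrArg (Submodule.map (M x).subtype) β.span_eq
    rw [Submodule.map_span, Submodule.map_top, Submodule.range_subtype, ← Set.range_comp] at h
    exact h
  have hli : LinearIndependent (FunField k Q L) b₀ := by
    rw [← LinearIndependent.iff_fractionRing x.ring]
    exact β.linearIndependent.map' (M x).subtype (Submodule.ker_subtype _)
  let b₁ := Module.Basis.mk hli (by
    rintro w -
    obtain ⟨a, ha, h⟩ := hM.absorb x w
    rw [← hspan] at h
    have h1 := Submodule.smul_mem _ a⁻¹ (Submodule.span_subset_span x.ring (FunField k Q L) _ h)
    rwa [smul_smul, inv_mul_cancel₀ ha, one_smul] at h1)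
  let b := b₁.reindex (Fintype.equivFinOfCardEq (Module.finrank_eq_card_basis b₁).symm)
  have hb : Set.range b = Set.range b₀ := by
    rw [Module.Basis.range_reindex, Module.Basis.coe_mk]
  refine ⟨b, by rw [hb, hspan], ?_⟩
  refine ((Set.finite_iUnion fun i => hM.fin_mem (b i)).union
    (Set.finite_iUnion fun i => hM.fin_dual (b.coord i))).subset fun y hy => ?_
  by_contra h
  simp only [Set.mem_union, Set.mem_iUnion, Set.mem_ofPred_eq, not_or, not_exists, not_not] at h
  refine hy (le_antisymm (fun m hm => mem_span_of_repr b fun i => h.2 i m hm) ?_)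
  rw [Submodule.span_le]
  rintro _ ⟨i, rfl⟩
  exact h.1 i

theorem IsLocallyFree.fg {r : ℕ} {M : StalkFamily k Q L V} (hM : IsLocallyFree r M)
    (x : Point k Q L) : (M x).FG := by
  obtain ⟨b, hb, -⟩ := hM x
  rw [hb]
  exact Submodule.fg_span (Set.finite_range b)

theorem linearIndependent_of_span_range_eq_top [FiniteDimensional (FunField k Q L) V]
    [FiniteDimensional (FunField k Q L) W]
    (hVW : Module.finrank (FunField k Q L) V = Module.finrank (FunField k Q L) W)
    (T : V →ₛₗ[sigma k Q L] W) (hT : Submodule.span (FunField k Q L) (Set.range T) = ⊤)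
    (n : ℕ) (s : Fin n → V) (hs : LinearIndependent (FunField k Q L) s) :
    LinearIndependent (FunField k Q L) fun j => T (s j) := by
  classical
  let b := Module.Basis.sumExtend hs
  have := FiniteDimensional.fintypeBasisIndex b
  have hb : LinearIndependent (FunField k Q L) fun j => T (b j) := by
    refine linearIndependent_of_top_le_span_of_card_eq_finrank ?_
      (by rw [← hVW, Module.finrank_eq_card_basis b])
    rw [← hT, Submodule.span_le]
    rintro _ ⟨v, rfl⟩
    rw [← b.sum_repr v, map_sum]
    refine sum_mem fun i _ => ?_
    rw [map_smulₛₗ]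
    exact Submodule.smul_mem _ _ (Submodule.subset_span ⟨i, rfl⟩)
  have h := hb.comp Sum.inl Sum.inl_injective
  convert h using 2 with j
  have : b (Sum.inl j) = s j := by simp [b, Module.Basis.sumExtend]; rfl
  rw [Function.comp_apply, this]

end StalkRelDim


section Uniformizer

variable {K : Type*} [Field K] {v : ValuationSubring K} {π : K}

theorem IsUniformizer.exists_pow_mul_mem (hπ : IsUniformizer v π) {a : K} (ha : a ≠ 0) :
    ∃ n : ℕ, π ^ n * a ∈ v := by
  obtain ⟨n, hn, -⟩ := hπ.zpow a ha
  refine ⟨n.toNat, ?_⟩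
  have h1 : π ^ n.toNat * a = (a * π ^ n) * π ^ (n.toNat - n).toNat := by
    rw [← zpow_natCast, ← zpow_natCast, mul_assoc, ← zpow_add₀ hπ.ne_zero, mul_comm]
    congr 2; omega
  rw [h1]
  exact v.mul_mem _ _ hn (pow_mem (ValuationSubring.nonunits_subset hπ.mem) _)

theorem IsUniformizer.div_mem (hπ : IsUniformizer v π) {b : K} (hb : b ∈ v.nonunits) :
    b / π ∈ v := by
  rcases eq_or_ne b 0 with rfl | hb0
  · rw [zero_div]; exact v.zero_mem
  obtain ⟨n, hn, hn'⟩ := hπ.zpow b hb0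
  have hn0 : n < 0 := by
    by_contra h
    obtain ⟨j, rfl⟩ := Int.eq_ofNat_of_zero_le (not_lt.1 h)
    have h1 : b * π ^ (j : ℤ) ∈ v.nonunits := by
      rw [zpow_natCast, mul_comm]
      exact mul_mem_nonunits (pow_mem (ValuationSubring.nonunits_subset hπ.mem) j) hb
    exact notMem_nonunits (mul_ne_zero hb0 (zpow_ne_zero _ hπ.ne_zero)) hn' h1
  have h1 : b / π = (b * π ^ n) * π ^ (-n - 1).toNat := by
    rw [← zpow_natCast, mul_assoc, ← zpow_add₀ hπ.ne_zero, div_eq_mul_inv, ← zpow_neg_one]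
    congr 2; omega
  rw [h1]
  exact v.mul_mem _ _ hn (pow_mem (ValuationSubring.nonunits_subset hπ.mem) _)

theorem IsUniformizer.exists_of_mem_maximalIdeal_pow (hπ : IsUniformizer v π) {n : ℕ} {g : v}
    (hg : g ∈ IsLocalRing.maximalIdeal v ^ n) : ∃ a ∈ v, (g : K) = π ^ n * a := by
  have h1 : IsLocalRing.maximalIdeal v ≤ Ideal.span {⟨π, ValuationSubring.nonunits_subset hπ.mem⟩} := by
    intro b hb
    rw [Ideal.mem_span_singleton]
    refine ⟨⟨_, hπ.div_mem (ValuationSubring.coe_mem_nonunits_iff.2 hb)⟩, Subtype.ext ?_⟩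
    exact (mul_div_cancel₀ _ hπ.ne_zero).symm
  have h2 := Ideal.pow_right_mono h1 n hg
  rw [Ideal.span_singleton_pow, Ideal.mem_span_singleton] at h2
  obtain ⟨a, rfl⟩ := h2
  exact ⟨a, a.2, rfl⟩

theorem IsUniformizer.mem_maximalIdeal (hπ : IsUniformizer v π) :
    (⟨π, ValuationSubring.nonunits_subset hπ.mem⟩ : v) ∈ IsLocalRing.maximalIdeal v :=
  ValuationSubring.coe_mem_nonunits_iff.1 hπ.mem

end Uniformizer

section Stalks

set_option linter.unusedSectionVars false

variable {k Q L : Type u} [Field k] [Fintype k] [Field Q] [Algebra k Q] [IsCurve k Q]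
  [Field L] [Algebra k L]
variable {V W : Type u} [AddCommGroup V] [Module (FunField k Q L) V]
  [AddCommGroup W] [Module (FunField k Q L) W]

theorem mem_negTwist {inf : ValuationSubring Q} {π : Q} (hπ : IsUniformizer inf π)
    {M : StalkFamily k Q L V} {x : Point k Q L} (hx : x.toCurve = inf) {n : ℕ} {w : V} :
    w ∈ negTwist inf n M x ↔ ∃ m ∈ M x, w = ofQ k Q L π ^ n • m := by
  rw [negTwist, if_pos hx]
  constructor
  · intro hw
    induction hw using Submodule.span_induction with
    | mem w hw =>
      obtain ⟨g, hg, m, hm, rfl⟩ := hw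
      obtain ⟨a, ha, h⟩ := hπ.exists_of_mem_maximalIdeal_pow hg
      refine ⟨ofQ k Q L a • m, smul_mem_stalk (by rw [ofQ_mem, hx]; exact ha) hm, ?_⟩
      rw [h, map_mul, map_pow, mul_smul]
    | zero => exact ⟨0, zero_mem _, (smul_zero _).symm⟩
    | add v w _ _ hv hw =>
      obtain ⟨m, hm, rfl⟩ := hv
      obtain ⟨m', hm', rfl⟩ := hw
      exact ⟨m + m', add_mem hm hm', (smul_add _ _ _).symm⟩
    | smul a w _ hw =>
      obtain ⟨m, hm, rfl⟩ := hw
      exact ⟨a • m, Submodule.smul_mem _ _ hm, (smul_comm _ _ _)⟩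
  · rintro ⟨m, hm, rfl⟩
    exact Submodule.subset_span ⟨_, Ideal.pow_mem_pow hπ.mem_maximalIdeal n, m, hm, by
      rw [SubmonoidClass.mk_pow, map_pow]⟩

theorem negTwist_of_ne {inf : ValuationSubring Q} {M : StalkFamily k Q L V} {x : Point k Q L}
    (hx : x.toCurve ≠ inf) (n : ℕ) : negTwist inf n M x = M x := by
  rw [negTwist, if_neg hx]

theorem map_negTwist (f : V →ₗ[FunField k Q L] W) (inf : ValuationSubring Q) (n : ℕ)
    (M : StalkFamily k Q L V) : (negTwist inf n M).map f = negTwist inf n (M.map f) := by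
  ext1 x
  by_cases hx : x.toCurve = inf
  · rw [StalkFamily.map, negTwist, negTwist, if_pos hx, if_pos hx, Submodule.map_span]
    congr 1
    ext w
    constructor
    · rintro ⟨_, ⟨g, hg, m, hm, rfl⟩, rfl⟩
      exact ⟨g, hg, f m, ⟨m, hm, rfl⟩, map_smul f _ _⟩
    · rintro ⟨g, hg, _, ⟨m, hm, rfl⟩, rfl⟩
      exact ⟨_, ⟨g, hg, m, hm, rfl⟩, map_smul f _ _⟩
  · rw [StalkFamily.map, negTwist_of_ne hx, negTwist_of_ne hx]
    rfl

theorem map_map_stalk {X : Type u} [AddCommGroup X] [Module (FunField k Q L) X]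
    (f : V →ₗ[FunField k Q L] W) (g : W →ₗ[FunField k Q L] X) (M : StalkFamily k Q L V) :
    (M.map f).map g = M.map (g ∘ₗ f) := by
  ext1 x
  exact (Submodule.map_comp _ _ _).symm

theorem map_mono_stalk (f : V →ₗ[FunField k Q L] W) {M N : StalkFamily k Q L V} (h : M ≤ N) :
    M.map f ≤ N.map f := fun x => Submodule.map_mono (h x)

section OverL

variable [Module L V] [IsScalarTower L (FunField k Q L) V]
  [Module L W] [IsScalarTower L (FunField k Q L) W]

/-- Multiplication by an element of the function field as an `L`-linear map. -/
noncomputable def scaleOverL (V : Type u) [AddCommGroup V] [Module (FunField k Q L) V]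
    [Module L V] [IsScalarTower L (FunField k Q L) V] (a : FunField k Q L) : V →ₗ[L] V :=
  (LinearMap.lsmul (FunField k Q L) V a).restrictScalars L

theorem scaleOverL_injective {a : FunField k Q L} (ha : a ≠ 0) :
    Function.Injective (scaleOverL V a) := fun _ _ h => smul_right_injective V ha h

variable {inf : ValuationSubring Q} (hinf : IsRationalPoint k inf) {π : Q}
  (hπ : IsUniformizer inf π) {x : Point k Q L} (hx : x.toCurve = inf)

include hinf hπ hx

theorem relDim_uniformizer {r : ℕ} (b : Module.Basis (Fin r) (FunField k Q L) V)
    {N : Submodule x.ring V} (hb : N = Submodule.span x.ring (Set.range b)) :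
    relDim ((x.overL N).map (scaleOverL V (ofQ k Q L π))) (x.overL N) = r := by
  have hmem : ∀ w, w ∈ N ↔ ∀ i, b.repr w i ∈ x.ring := by
    intro w
    rw [hb]
    refine ⟨fun hw i => ?_, mem_span_of_repr b⟩
    have := map_mem_of_mem_span (x := x) b (b.coord i) (a := 1) (fun j => by
      rw [one_mul, Module.Basis.coord_apply, b.repr_self]
      by_cases hij : j = i
      · subst hij; rw [Finsupp.single_eq_same]; exact x.ring.one_mem
      · rw [Finsupp.single_eq_of_ne' hij]; exact x.ring.zero_mem) hw
    rwa [one_mul] at this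
  refine relDim_eq_of_basis b (fun j => by rw [Point.mem_overL, hb]; exact Submodule.subset_span ⟨j, rfl⟩)
    (fun v hv => ?_) (fun c hc => ?_)
  · rw [Point.mem_overL, hmem] at hv
    choose l a ha h using fun i => exists_residue_of_mem hinf hπ hx (hv i)
    refine ⟨l, ∑ j, a j • b j, ?_, ?_⟩
    · rw [hb]
      exact sum_mem fun j _ => smul_mem_stalk (ha j) (Submodule.subset_span ⟨j, rfl⟩)
    · change ofQ k Q L π • ∑ j, a j • b j = _
      conv_rhs => rw [← b.sum_repr v]
      rw [← Finset.sum_sub_distrib, Finset.smul_sum]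
      refine Finset.sum_congr rfl fun j _ => ?_
      rw [h j, add_smul, algebraMap_smul, mul_smul, add_sub_cancel_left]
  · obtain ⟨w, hw, h⟩ := hc
    rw [SetLike.mem_coe, Point.mem_overL, hmem] at hw
    change ofQ k Q L π • w = _ at h
    ext j
    by_contra hj
    have h1 := congrArg (fun w => b.repr w j) h
    have h2 : b.repr (∑ j, c j • b j) j = algebraMap L _ (c j) := by
      have : ∑ j, c j • b j = ∑ j, (algebraMap L (FunField k Q L) (c j)) • b j :=
        Finset.sum_congr rfl fun j _ => (algebraMap_smul _ _ _).symm
      rw [this, b.repr_sum_self]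
    simp only [h2, map_smul, Finsupp.smul_apply, smul_eq_mul] at h1
    refine algebraMap_notMem_nonunits x hj ?_
    rw [← h1, mul_comm]
    exact mul_mem_nonunits (hw j) (isUniformizer_ofQ (L := L) hinf hπ hx).mem

theorem relDim_uniformizer_pow {r : ℕ} (b : Module.Basis (Fin r) (FunField k Q L) V)
    {N : Submodule x.ring V} (hb : N = Submodule.span x.ring (Set.range b)) (n : ℕ) :
    relDim ((x.overL N).map (scaleOverL V (ofQ k Q L π ^ n))) (x.overL N) = (n * r : ℕ) := by
  have hπ' := isUniformizer_ofQ (L := L) hinf hπ hx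
  induction n with
  | zero =>
    rw [zero_mul, Nat.cast_zero, relDim_eq_zero_iff]
    exact fun v hv => ⟨v, hv, by change ofQ k Q L π ^ 0 • v = v; rw [pow_zero, one_smul]⟩
  | succ n ih =>
    have h1 : (x.overL N).map (scaleOverL V (ofQ k Q L π)) ≤ x.overL N := by
      rintro _ ⟨v, hv, rfl⟩
      exact smul_mem_stalk (ValuationSubring.nonunits_subset hπ'.mem) hv
    have h2 : (x.overL N).map (scaleOverL V (ofQ k Q L π ^ n)) ≤ x.overL N := by
      rintro _ ⟨v, hv, rfl⟩
      exact smul_mem_stalk (pow_mem (ValuationSubring.nonunits_subset hπ'.mem) n) hv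
    have h3 : (x.overL N).map (scaleOverL V (ofQ k Q L π ^ (n + 1))) =
        ((x.overL N).map (scaleOverL V (ofQ k Q L π))).map (scaleOverL V (ofQ k Q L π ^ n)) := by
      rw [← Submodule.map_comp]
      congr 1
      ext v
      exact (congrArg (· • v) (pow_succ _ _)).trans (mul_smul _ _ _)
    rw [h3, ← relDim_add (Submodule.map_mono h1) h2, ih,
      relDim_map _ (scaleOverL_injective (pow_ne_zero n hπ'.ne_zero)),
      relDim_uniformizer hinf hπ hx b hb, ← Nat.cast_add]
    congr 1; ring

theorem relDim_mapSigma_le {A B : StalkFamily k Q L V} (T : V →ₛₗ[sigma k Q L] W)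
    (hAB : ∀ b ∈ B x, ∃ n : ℕ, ofQ k Q L π ^ n • b ∈ A x) {n : ℕ}
    (h : relDim (x.overL (A x)) (x.overL (B x)) = n) :
    relDim (x.overL (A.mapSigma T x)) (x.overL (B.mapSigma T x)) ≤ n := by
  have hfrob : x.frob = x := Point.eq_of_toCurve_eq hinf hπ ((toCurve_frob x).trans hx) hx
  have hmem : ∀ (M : StalkFamily k Q L V) v, v ∈ M x → T v ∈ M.mapSigma T x := fun M v hv =>
    subset_mapSigma T M (by rw [hfrob]; exact hv)
  obtain ⟨b, hb, hspan⟩ := exists_span_of_relDim_eq h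
  refine relDim_le_of_span (fun j => T (b j)) (fun j => hmem B _ (hb j)) ?_
  let X : Submodule L W := x.overL (A.mapSigma T x) ⊔ Submodule.span L (Set.range fun j => T (b j))
  suffices hX : ∀ v ∈ B.mapSigma T x, v ∈ X by
    intro v hv
    obtain ⟨a, ha, c, hc, rfl⟩ := Submodule.mem_sup.1 (hX v hv)
    obtain ⟨c, rfl⟩ := (Submodule.mem_span_range_iff_exists_fun L).1 hc
    exact ⟨c, by rwa [add_sub_cancel_right]⟩
  have key : ∀ (n : ℕ) (v : V), v ∈ B x → ofQ k Q L π ^ n • v ∈ A x → ∀ a ∈ x.ring, a • T v ∈ X := by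
    intro n
    induction n with
    | zero =>
      intro v _ hv a ha
      rw [pow_zero, one_smul] at hv
      exact Submodule.mem_sup_left (smul_mem_stalk ha (hmem A v hv))
    | succ n ih =>
      intro v hv hv' a ha
      obtain ⟨l, a', ha', rfl⟩ := exists_residue_of_mem hinf hπ hx ha
      rw [add_smul, algebraMap_smul]
      refine add_mem (Submodule.smul_mem _ _ ?_) ?_
      · obtain ⟨c, hc⟩ := hspan v hv
        have h1 : T v = T (v - ∑ j, c j • b j) + ∑ j, (c j ^ Fintype.card k) • T (b j) := by
          rw [map_sub, map_sum, sub_add_eq_add_sub, eq_sub_iff_add_eq]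
          congr 1
          refine Finset.sum_congr rfl fun j _ => ?_
          rw [← algebraMap_smul (FunField k Q L) (c j), map_smulₛₗ, sigma_algebraMap, algebraMap_smul]
        rw [h1]
        exact add_mem (Submodule.mem_sup_left (hmem A _ hc)) (Submodule.mem_sup_right
          (sum_mem fun j _ => Submodule.smul_mem _ _ (Submodule.subset_span ⟨j, rfl⟩)))
      · have h2 := ih (ofQ k Q L π • v) (smul_mem_stalk (ValuationSubring.nonunits_subset
          (isUniformizer_ofQ (L := L) hinf hπ hx).mem) hv)
          (by rwa [smul_smul, ← pow_succ]) a' ha'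
        rwa [map_smulₛₗ, sigma_ofQ, smul_smul, mul_comm] at h2
  intro v hv
  induction hv using Submodule.span_induction with
  | mem w hw =>
    obtain ⟨v, hv, rfl⟩ := hw
    rw [hfrob] at hv
    obtain ⟨n, hn⟩ := hAB v hv
    have := key n v hv hn 1 x.ring.one_mem
    rwa [one_smul] at this
  | zero => exact zero_mem _
  | add v w _ _ hv hw => exact add_mem hv hw
  | smul a w hw hw' =>
    clear hw'
    induction hw using Submodule.span_induction generalizing a with
    | mem w hw =>
      obtain ⟨v, hv, rfl⟩ := hw
      rw [hfrob] at hv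
      obtain ⟨n, hn⟩ := hAB v hv
      exact key n v hv hn a a.2
    | zero => rw [smul_zero]; exact zero_mem _
    | add v w _ _ hv hw => rw [smul_add]; exact add_mem (hv a) (hw a)
    | smul c w _ hw => rw [smul_smul]; exact hw _

end OverL

/-- If some power of an ideal annihilates a module of length at most `e`, then so does the power with
exponent `e`. -/
theorem pow_smul_mem_of_relDim_le [Module L V] [IsScalarTower L (FunField k Q L) V]
    {x : Point k Q L} {N M : Submodule x.ring V} (hNM : N ≤ M) (I : Ideal x.ring) {D e : ℕ}
    (hD : ∀ h ∈ I ^ D, ∀ m ∈ M, h • m ∈ N) (he : relDim (x.overL N) (x.overL M) ≤ e) :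
    ∀ h ∈ I ^ e, ∀ m ∈ M, h • m ∈ N := by
  let B : ℕ → Submodule x.ring V := fun j => Nat.rec M (fun _ B => I • B ⊔ N) j
  have hBs : ∀ j, B (j + 1) = I • B j ⊔ N := fun j => rfl
  have hN : ∀ j, N ≤ B j := fun j => by cases j with
    | zero => exact hNM
    | succ j => rw [hBs]; exact le_sup_right
  have hIB : ∀ j, I ^ j • M ≤ B j := by
    intro j
    induction j with
    | zero => rw [pow_zero, Ideal.one_eq_top, Submodule.top_smul]; exact le_refl _
    | succ j ih =>
      rw [pow_succ', mul_smul, hBs]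
      exact (Submodule.smul_mono le_rfl ih).trans le_sup_left
  have hBI : ∀ j, B j ≤ I ^ j • M ⊔ N := by
    intro j
    induction j with
    | zero => rw [pow_zero, Ideal.one_eq_top, Submodule.top_smul]; exact le_sup_left
    | succ j ih =>
      rw [hBs, pow_succ', mul_smul]
      refine sup_le ((Submodule.smul_mono le_rfl ih).trans ?_) le_sup_right
      rw [Submodule.smul_sup]
      exact sup_le_sup_left Submodule.smul_le_right _
  have hBD : B D ≤ N := (hBI D).trans (sup_le (Submodule.smul_le.2 hD) le_rfl)
  have hanti : ∀ j, B (j + 1) ≤ B j := fun j => by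
    rw [hBs]; exact sup_le Submodule.smul_le_right (hN j)
  have key : ∀ j, B j ≤ N ∨ relDim (x.overL N) (x.overL (B j)) + j ≤ e := by
    intro j
    induction j with
    | zero => right; rw [Nat.cast_zero, add_zero]; exact he
    | succ j ih =>
      rcases ih with h | h
      · exact Or.inl ((hanti j).trans h)
      rcases Classical.em (B j ≤ B (j + 1)) with heq | heq
      · left
        have hst : ∀ i, B j ≤ B (j + i) := by
          intro i
          induction i with
          | zero => exact le_refl _
          | succ i ih =>
            refine heq.trans ?_
            rw [← add_assoc, hBs, hBs]
            exact sup_le_sup_right (Submodule.smul_mono le_rfl ih) _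
        have hanti' : Antitone B := antitone_nat_of_succ_le hanti
        exact (hanti j).trans ((hst D).trans ((hanti' (Nat.le_add_left D j)).trans hBD))
      · right
        have h1 : 1 ≤ relDim (x.overL (B (j + 1))) (x.overL (B j)) := by
          rw [Cardinal.one_le_iff_ne_zero]
          exact fun h0 => heq (relDim_eq_zero_iff.1 h0)
        have h2 := relDim_add (A := x.overL N) (B := x.overL (B (j + 1))) (C := x.overL (B j))
          (hN (j + 1)) (hanti j)
        rw [← h2] at h
        refine le_trans ?_ h
        rw [Nat.cast_succ, add_assoc, add_comm (j : Cardinal)]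
        gcongr
  have hBe : B e ≤ N := by
    rcases key e with h | h
    · exact h
    · have hlt : relDim (x.overL N) (x.overL (B e)) < Cardinal.aleph0 :=
        ((self_le_add_right _ _).trans h).trans_lt Cardinal.natCast_lt_aleph0
      obtain ⟨n, hn⟩ := Cardinal.lt_aleph0.1 hlt
      rw [hn, ← Nat.cast_add, Nat.cast_le] at h
      have : n = 0 := by omega
      rw [this, Nat.cast_zero] at hn
      exact relDim_eq_zero_iff.1 hn
  exact fun h hh m hm => hBe (hIB e (Submodule.smul_mem_smul hh hm))

end Stalks

section Iterate

set_option linter.unusedSectionVars false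

variable {k Q L : Type u} [Field k] [Fintype k] [Field Q] [Algebra k Q] [IsCurve k Q]
  [Field L] [Algebra k L]
variable {V : ℤ → Type u} [∀ i, AddCommGroup (V i)] [∀ i, Module (FunField k Q L) (V i)]
  {W : ℤ → Type u} [∀ i, AddCommGroup (W i)] [∀ i, Module (FunField k Q L) (W i)]

theorem castEquiv_mem (M : ∀ i, StalkFamily k Q L (V i)) {i j : ℤ} (h : i = j) (x : Point k Q L)
    (m : V i) : castEquiv (R := FunField k Q L) h m ∈ M j x ↔ m ∈ M i x := by
  subst h; rfl

theorem map_castEquiv (M : ∀ i, StalkFamily k Q L (V i)) {i j : ℤ} (h : i = j) :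
    (M i).map (castEquiv (R := FunField k Q L) h).toLinearMap = M j := by
  subst h
  ext1 x
  exact Submodule.map_id _

theorem apply_castEquiv (f : ∀ i, V i →ₗ[FunField k Q L] W i) {i j : ℤ} (h : i = j) (m : V i) :
    f j (castEquiv (R := FunField k Q L) h m) = castEquiv (R := FunField k Q L) h (f i m) := by
  subst h; rfl

theorem iter_succ (P : ∀ i, V i →ₗ[FunField k Q L] V (i + 1)) (i : ℤ) (n : ℕ) :
    iter P i (n + 1) = (castEquiv (R := FunField k Q L) (by push_cast; ring) :
      V (i + n + 1) ≃ₗ[FunField k Q L] V (i + (n + 1 : ℕ))).toLinearMap ∘ₗ P (i + n) ∘ₗ iter P i n := rfl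

theorem apply_iter (f : ∀ i, V i →ₗ[FunField k Q L] W i) (P : ∀ i, V i →ₗ[FunField k Q L] V (i + 1))
    (P' : ∀ i, W i →ₗ[FunField k Q L] W (i + 1)) (h : ∀ i m, f (i + 1) (P i m) = P' i (f i m))
    (i : ℤ) (n : ℕ) (m : V i) : f (i + n) (iter P i n m) = iter P' i n (f i m) := by
  induction n with
  | zero => exact apply_castEquiv f _ m
  | succ n ih =>
    rw [iter_succ, iter_succ, LinearMap.comp_apply, LinearMap.comp_apply, LinearMap.comp_apply,
      LinearMap.comp_apply, ← ih, ← h]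
    exact apply_castEquiv f _ _

theorem map_iter_le {M : ∀ i, StalkFamily k Q L (V i)} {P : ∀ i, V i →ₗ[FunField k Q L] V (i + 1)}
    (hP : ∀ i, (M i).map (P i) ≤ M (i + 1)) (i : ℤ) (n : ℕ) :
    (M i).map (iter P i n) ≤ M (i + n) := by
  induction n with
  | zero => exact (map_castEquiv M _).le
  | succ n ih =>
    rw [iter_succ, ← map_map_stalk, ← map_map_stalk, ← map_castEquiv M (i := i + n + 1)
      (j := i + (n + 1 : ℕ)) (by push_cast; ring)]
    exact map_mono_stalk _ ((map_mono_stalk _ ih).trans (hP _))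

theorem relDim_iter [∀ i, Module L (V i)] [∀ i, IsScalarTower L (FunField k Q L) (V i)]
    {M : ∀ i, StalkFamily k Q L (V i)} {P : ∀ i, V i →ₗ[FunField k Q L] V (i + 1)}
    (hP : ∀ i, (M i).map (P i) ≤ M (i + 1)) (hP' : ∀ i, Function.Injective (P i))
    (x : Point k Q L) (i : ℤ) (n : ℕ) :
    relDim (x.overL ((M i).map (iter P i n) x)) (x.overL (M (i + n) x)) =
      ∑ j ∈ Finset.range n, relDim (x.overL ((M (i + j)).map (P (i + j)) x))
        (x.overL (M (i + j + 1) x)) := by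
  induction n with
  | zero =>
    rw [Finset.range_zero, Finset.sum_empty, relDim_eq_zero_iff]
    exact (map_castEquiv M _).ge x
  | succ n ih =>
    rw [Finset.sum_range_succ, ← ih]
    have e : i + n + 1 = i + (n + 1 : ℕ) := by push_cast; ring
    let E : V (i + n + 1) →ₗ[L] V (i + (n + 1 : ℕ)) :=
      (castEquiv (R := FunField k Q L) e).toLinearMap.restrictScalars L
    have h1 : x.overL ((M i).map (iter P i (n + 1)) x) =
        (x.overL (((M i).map (iter P i n)).map (P (i + n)) x)).map E := by
      rw [iter_succ, ← map_map_stalk, ← map_map_stalk]; rfl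
    have h2 : x.overL (M (i + (n + 1 : ℕ)) x) = (x.overL (M (i + n + 1) x)).map E := by
      rw [← map_castEquiv M e]; rfl
    have h3 : x.overL (((M i).map (iter P i n)).map (P (i + n)) x) =
        (x.overL ((M i).map (iter P i n) x)).map ((P (i + n)).restrictScalars L) := rfl
    have h4 : x.overL ((M (i + n)).map (P (i + n)) x) =
        (x.overL (M (i + n) x)).map ((P (i + n)).restrictScalars L) := rfl
    rw [h1, h2, relDim_map E (castEquiv (R := FunField k Q L) e).injective,
      ← relDim_add (B := x.overL ((M (i + n)).map (P (i + n)) x))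
        (map_mono_stalk _ (map_iter_le hP i n) x) (hP _ x), h3, h4,
      relDim_map ((P (i + n)).restrictScalars L) (hP' _)]

end Iterate


namespace AbelianTauSheaf

set_option linter.unusedSectionVars false

variable {k Q L : Type u} [Field k] [Fintype k] [Field Q] [Algebra k Q] [IsCurve k Q]
  [Field L] [Algebra k L] {inf : ValuationSubring Q} {c : Characteristic k Q L}

/-! ### First properties of abelian `τ`-sheaves -/

noncomputable instance (F : AbelianTauSheaf inf c) (i : ℤ) : Module L (F.V i) :=
  Module.compHom (F.V i) (algebraMap L (FunField k Q L))

instance (F : AbelianTauSheaf inf c) (i : ℤ) : IsScalarTower L (FunField k Q L) (F.V i) :=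
  IsScalarTower.of_algebraMap_smul fun _ _ => rfl

variable (F : AbelianTauSheaf inf c)

theorem nonempty_basis (i : ℤ) :
    Nonempty (Module.Basis (Fin F.rank) (FunField k Q L) (F.V i)) := by
  obtain ⟨b, -⟩ := F.locallyFree i (Point.generic k Q L)
  exact ⟨b⟩

instance (i : ℤ) : FiniteDimensional (FunField k Q L) (F.V i) :=
  (F.nonempty_basis i).elim fun b => b.finiteDimensional_of_finite

theorem finrank_V (i : ℤ) : Module.finrank (FunField k Q L) (F.V i) = F.rank := by
  obtain ⟨b⟩ := F.nonempty_basis i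
  rw [Module.finrank_eq_card_basis b, Fintype.card_fin]

/-- The isomorphism of generic fibres given by `Π_i`. -/
noncomputable def equivP (i : ℤ) : F.V i ≃ₗ[FunField k Q L] F.V (i + 1) :=
  LinearEquiv.ofInjectiveOfFinrankEq (F.P i) (F.P_injective i) (by rw [finrank_V, finrank_V])

@[simp] theorem equivP_apply (i : ℤ) (m : F.V i) : F.equivP i m = F.P i m := rfl

theorem span_range_tau (i : ℤ) :
    Submodule.span (FunField k Q L) (Set.range (F.tau i)) = ⊤ :=
  span_range_eq_top_of_linearIndependent (by rw [finrank_V, finrank_V]) (F.tau i) (F.tau_injective i)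

theorem isBounded (i : ℤ) : IsBounded (F.F i) := (F.locallyFree i).isBounded

theorem P_mem {i : ℤ} {x : Point k Q L} {m : F.V i} (hm : m ∈ F.F i x) : F.P i m ∈ F.F (i + 1) x :=
  F.P_le i x ⟨m, hm, rfl⟩

theorem tau_mem {i : ℤ} {x : Point k Q L} {m : F.V i} (hm : m ∈ F.F i x.frob) :
    F.tau i m ∈ F.F (i + 1) x := F.tau_le i x (subset_mapSigma _ _ hm)

/-- Outside of `∞` the `Π_i` are isomorphisms. -/
theorem le_map_P {x : Point k Q L} (hx : x.toCurve ≠ inf) (i : ℤ) :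
    F.F (i + 1) x ≤ (F.F i).map (F.P i) x := by
  obtain ⟨m, l, -, hl, -, h⟩ := F.periodic
  obtain ⟨n, rfl⟩ : ∃ n, l = n + 1 := ⟨l - 1, by omega⟩
  obtain ⟨i, rfl⟩ : ∃ j, i = j + n := ⟨i - n, by ring⟩
  intro w hw
  have h1 := congrFun (h i) x
  rw [negTwist_of_ne hx] at h1
  have e : i + n + 1 = i + (n + 1 : ℕ) := by push_cast; ring
  have h2 := (castEquiv_mem F.F e x w).2 hw
  rw [← h1] at h2
  obtain ⟨v, hv, hvw⟩ := h2
  refine ⟨iter F.P i n v, map_iter_le F.P_le i n x ⟨v, hv, rfl⟩, ?_⟩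
  exact (castEquiv (R := FunField k Q L) e).injective hvw

theorem le_mapSigma_tau {x : Point k Q L} (hx : c.graphIdeal x = ⊤) (i : ℤ) :
    F.F (i + 1) x ≤ (F.F i).mapSigma (F.tau i) x := by
  intro w hw
  have := F.coker_tau_graph i x 1 (by rw [hx, Ideal.top_pow]; trivial) w hw
  rwa [one_smul] at this

theorem graphIdeal_eq_top (hinf : IsRationalPoint k inf) (hc : c.point ≠ inf) {x : Point k Q L}
    (hx : x.toCurve = inf) : c.graphIdeal x = ⊤ := by
  rw [Characteristic.graphIdeal, if_neg]
  rw [hx]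
  intro h
  rcases eq_or_eq_top_of_le_curve k h with h | h
  · exact hc h
  · exact hinf.1 h

/-! ### Quotients by stable families of subspaces -/

section Quotient

/-- A family of subspaces of the generic fibres which is stable under the `Π_i` and `τ_i`. -/
structure IsStable (U : ∀ i, Submodule (FunField k Q L) (F.V i)) : Prop where
  map_P : ∀ i, (U i).map (F.P i) = U (i + 1)
  tau : ∀ i, ∀ m ∈ U i, F.tau i m ∈ U (i + 1)

variable {F} {U : ∀ i, Submodule (FunField k Q L) (F.V i)} (hU : F.IsStable U)

include hU

theorem IsStable.P_mem_iff {i : ℤ} {m : F.V i} : F.P i m ∈ U (i + 1) ↔ m ∈ U i := by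
  rw [← hU.map_P]
  exact ⟨fun ⟨m', hm', h⟩ => F.P_injective i h ▸ hm', fun h => ⟨m, h, rfl⟩⟩

theorem IsStable.le_comap_P (i : ℤ) : U i ≤ (U (i + 1)).comap (F.P i) := fun _ hm =>
  hU.P_mem_iff.2 hm

theorem IsStable.le_comap_tau (i : ℤ) : U i ≤ (U (i + 1)).comap (F.tau i) := hU.tau i

/-- The map induced by `Π_i` on the quotients. -/
noncomputable def IsStable.quotP (i : ℤ) :
    (F.V i ⧸ U i) →ₗ[FunField k Q L] F.V (i + 1) ⧸ U (i + 1) :=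
  (U i).mapQ (U (i + 1)) (F.P i) (hU.le_comap_P i)

/-- The map induced by `τ_i` on the quotients. -/
noncomputable def IsStable.quotTau (i : ℤ) :
    (F.V i ⧸ U i) →ₛₗ[sigma k Q L] F.V (i + 1) ⧸ U (i + 1) :=
  (U i).mapQ (U (i + 1)) (F.tau i) (hU.le_comap_tau i)

omit hU in
theorem isBounded_quot (i : ℤ) : IsBounded ((F.F i).map (U i).mkQ) :=
  (F.isBounded i).map (U i).mkQ_surjective

theorem IsStable.quotP_injective (i : ℤ) : Function.Injective (hU.quotP i) := by
  rw [injective_iff_map_eq_zero]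
  intro m hm
  obtain ⟨m, rfl⟩ := Submodule.Quotient.mk_surjective _ m
  exact (Submodule.Quotient.mk_eq_zero _).2
    (hU.P_mem_iff.1 ((Submodule.Quotient.mk_eq_zero _).1 hm))

theorem IsStable.quotP_surjective (i : ℤ) : Function.Surjective (hU.quotP i) := by
  intro z
  obtain ⟨w, rfl⟩ := Submodule.Quotient.mk_surjective _ z
  obtain ⟨v, rfl⟩ := (F.equivP i).surjective w
  exact ⟨Submodule.Quotient.mk v, rfl⟩

theorem IsStable.finrank_quot (i j : ℤ) : Module.finrank (FunField k Q L) (F.V i ⧸ U i) =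
    Module.finrank (FunField k Q L) (F.V j ⧸ U j) := by
  have h : ∀ i, Module.finrank (FunField k Q L) (F.V i ⧸ U i) =
      Module.finrank (FunField k Q L) (F.V (i + 1) ⧸ U (i + 1)) := fun i =>
    (LinearEquiv.ofBijective _ ⟨hU.quotP_injective i, hU.quotP_surjective i⟩).finrank_eq
  have h0 : ∀ i, Module.finrank (FunField k Q L) (F.V i ⧸ U i) =
      Module.finrank (FunField k Q L) (F.V 0 ⧸ U 0) := by
    intro i
    induction i using Int.induction_on with
    | zero => rfl
    | succ n ih => rw [← h, ih]
    | pred n ih =>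
      have := h (-(n : ℤ) - 1)
      rw [this, sub_add_cancel, ih]
  rw [h0, h0 j]

theorem IsStable.span_range_quotTau (i : ℤ) :
    Submodule.span (FunField k Q L) (Set.range (hU.quotTau i)) = ⊤ := by
  have h := congrArg (Submodule.map (U (i + 1)).mkQ) (F.span_range_tau i)
  rw [Submodule.map_span, Submodule.map_top, Submodule.range_mkQ] at h
  rw [eq_top_iff, ← h]
  refine Submodule.span_mono ?_
  rintro _ ⟨_, ⟨m, rfl⟩, rfl⟩
  exact ⟨(U i).mkQ m, rfl⟩

theorem IsStable.map_quotP (i : ℤ) : ((F.F i).map (U i).mkQ).map (hU.quotP i) =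
    ((F.F i).map (F.P i)).map (U (i + 1)).mkQ := by
  rw [map_map_stalk, map_map_stalk]; rfl

theorem IsStable.mapSigma_quotTau (i : ℤ) : ((F.F i).map (U i).mkQ).mapSigma (hU.quotTau i) =
    ((F.F i).mapSigma (F.tau i)).map (U (i + 1)).mkQ := by
  ext1 x
  refine Eq.trans ?_ (Submodule.map_span ((U (i + 1)).mkQ.restrictScalars x.ring) _).symm
  change Submodule.span x.ring _ = _
  congr 1
  ext w
  constructor
  · rintro ⟨_, ⟨m, hm, rfl⟩, rfl⟩
    exact ⟨_, ⟨m, hm, rfl⟩, rfl⟩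
  · rintro ⟨_, ⟨m, hm, rfl⟩, rfl⟩
    exact ⟨_, ⟨m, hm, rfl⟩, rfl⟩

theorem IsStable.map_quotP_le (i : ℤ) : ((F.F i).map (U i).mkQ).map (hU.quotP i) ≤
    (F.F (i + 1)).map (U (i + 1)).mkQ := by
  rw [hU.map_quotP]; exact map_mono_stalk _ (F.P_le i)

theorem IsStable.mapSigma_quotTau_le (i : ℤ) : ((F.F i).map (U i).mkQ).mapSigma (hU.quotTau i) ≤
    (F.F (i + 1)).map (U (i + 1)).mkQ := by
  rw [hU.mapSigma_quotTau]; exact map_mono_stalk _ (F.tau_le i)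

/-- The two cokernels of the quotient have the same dimension. -/
theorem IsStable.cokerDim_quotTau (i : ℤ) :
    cokerDim (((F.F i).map (U i).mkQ).mapSigma (hU.quotTau i)) ((F.F (i + 1)).map (U (i + 1)).mkQ) =
      cokerDim (((F.F i).map (U i).mkQ).map (hU.quotP i)) ((F.F (i + 1)).map (U (i + 1)).mkQ) := by
  let P' : U i ≃ₗ[FunField k Q L] U (i + 1) := (F.equivP i).ofSubmodules _ _ (hU.map_P i)
  let τ' : U i →ₛₗ[sigma k Q L] U (i + 1) :=
    ((F.tau i).domRestrict (U i)).codRestrict (U (i + 1)) fun m => hU.tau i m m.2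
  have hP' : ((F.F i).sub (U i)).map P'.toLinearMap = ((F.F i).map (F.P i)).sub (U (i + 1)) := by
    ext x w
    constructor
    · rintro ⟨m, hm, rfl⟩
      exact ⟨m, hm, rfl⟩
    · rintro ⟨m, hm, h⟩
      exact ⟨⟨m, hU.P_mem_iff.1 (by have h2 : F.P i m = w := h; rw [h2]; exact w.2)⟩, hm, Subtype.ext h⟩
  have hτ' : ((F.F i).sub (U i)).mapSigma τ' ≤ ((F.F i).mapSigma (F.tau i)).sub (U (i + 1)) := by
    intro x
    refine Submodule.span_le.2 ?_
    rintro _ ⟨m, hm, rfl⟩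
    exact subset_mapSigma (F.tau i) (F.F i) hm
  have hτ'' : ((F.F i).mapSigma (F.tau i)).sub (U (i + 1)) ≤ (F.F (i + 1)).sub (U (i + 1)) :=
    fun x m hm => F.tau_le i x hm
  have hP'' : ((F.F i).map (F.P i)).sub (U (i + 1)) ≤ (F.F (i + 1)).sub (U (i + 1)) :=
    fun x m hm => F.P_le i x hm
  obtain ⟨h1, h1'⟩ := cokerDim_mapSigma_le ((F.isBounded i).sub (U i))
    ((F.isBounded (i + 1)).sub (U (i + 1))) P' (hP'.le.trans hP'') τ' (hτ'.trans hτ'')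
    (fun n s hs => by
      have h := F.tau_injective i n (fun j => (s j : F.V i))
        (hs.map' (U i).subtype (Submodule.ker_subtype _))
      exact LinearIndependent.of_comp (U (i + 1)).subtype h)
  obtain ⟨h2, h2'⟩ := cokerDim_mapSigma_le (isBounded_quot (U := U) i) (isBounded_quot (i + 1))
    (LinearEquiv.ofBijective _ ⟨hU.quotP_injective i, hU.quotP_surjective i⟩)
    (hU.map_quotP_le i) (hU.quotTau i) (hU.mapSigma_quotTau_le i)
    (linearIndependent_of_span_range_eq_top (hU.finrank_quot i (i + 1)) _ (hU.span_range_quotTau i))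
  change cokerDim _ _ ≤ cokerDim (((F.F i).map (U i).mkQ).map (hU.quotP i)) _ at h2
  change cokerDim (((F.F i).map (U i).mkQ).map (hU.quotP i)) _ < _ at h2'
  have h3 := cokerDim_sub_add_map (F.P_le i) (U (i + 1)).mkQ (U (i + 1)) (Submodule.ker_mkQ _)
  have h4 := cokerDim_sub_add_map (F.tau_le i) (U (i + 1)).mkQ (U (i + 1)) (Submodule.ker_mkQ _)
  rw [← hP', ← hU.map_quotP, F.coker_P] at h3
  rw [← hU.mapSigma_quotTau, F.coker_tau] at h4
  have h5 := (cokerDim_anti hτ' hτ'').trans h1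
  have h5' := h5.trans_lt h1'
  have h2'' := h2.trans_lt h2'
  generalize cokerDim (((F.F i).map (U i).mkQ).mapSigma (hU.quotTau i)) _ = a at *
  generalize cokerDim (((F.F i).map (U i).mkQ).map (hU.quotP i)) _ = b at *
  generalize cokerDim (((F.F i).sub (U i)).map P'.toLinearMap) _ = d at *
  generalize cokerDim (((F.F i).mapSigma (F.tau i)).sub (U (i + 1))) _ = e at *
  lift a to ℕ using h2''
  lift b to ℕ using h2'
  lift d to ℕ using h1'
  lift e to ℕ using h5'
  norm_cast at *
  omega

end Quotient

end AbelianTauSheaf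


namespace AbelianTauSheaf

set_option linter.unusedSectionVars false

variable {k Q L : Type u} [Field k] [Fintype k] [Field Q] [Algebra k Q] [IsCurve k Q]
  [Field L] [Algebra k L] {inf : ValuationSubring Q} {c : Characteristic k Q L}
  {F : AbelianTauSheaf inf c} {U : ∀ i, Submodule (FunField k Q L) (F.V i)} (hU : F.IsStable U)

section QuotientDim

include hU

theorem IsStable.map_iter_quotP {m l : ℕ} (h : ∀ i, (F.F i).map (iter F.P i l) = negTwist inf m (F.F (i + l)))
    (i : ℤ) : ((F.F i).map (U i).mkQ).map (iter hU.quotP i l) =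
      negTwist inf m ((F.F (i + l)).map (U (i + l)).mkQ) := by
  rw [← map_negTwist, ← h, map_map_stalk, map_map_stalk]
  congr 1
  ext v
  exact (apply_iter (fun i => (U i).mkQ) F.P hU.quotP (fun i m => rfl) i l v).symm

theorem IsStable.cokerDim_quotP_le (i : ℤ) :
    cokerDim (((F.F i).map (U i).mkQ).map (hU.quotP i)) ((F.F (i + 1)).map (U (i + 1)).mkQ) ≤
      (F.dim : Cardinal) := by
  have h := cokerDim_sub_add_map (F.P_le i) (U (i + 1)).mkQ (U (i + 1)) (Submodule.ker_mkQ _)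
  rw [← hU.map_quotP, F.coker_P] at h
  rw [← h]
  exact self_le_add_left _ _

theorem IsStable.le_map_quotP {x : Point k Q L} (hx : x.toCurve ≠ inf) (i : ℤ) :
    (F.F (i + 1)).map (U (i + 1)).mkQ x ≤ ((F.F i).map (U i).mkQ).map (hU.quotP i) x := by
  rw [hU.map_quotP]
  exact Submodule.map_mono (F.le_map_P hx i)

theorem IsStable.cokerDim_quotP (hinf : IsRationalPoint k inf) {x : Point k Q L}
    (hx : x.toCurve = inf) (i : ℤ) :
    cokerDim (((F.F i).map (U i).mkQ).map (hU.quotP i)) ((F.F (i + 1)).map (U (i + 1)).mkQ) =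
      relDim (x.overL (((F.F i).map (U i).mkQ).map (hU.quotP i) x))
        (x.overL ((F.F (i + 1)).map (U (i + 1)).mkQ x)) := by
  obtain ⟨π, hπ⟩ := exists_isUniformizer_curve k hinf.1
  refine cokerDim_eq_single x fun y hy => hU.le_map_quotP (fun h => hy ?_) i
  exact Point.eq_of_toCurve_eq hinf hπ h hx

theorem IsStable.cokerDim_quotP_succ_le (hinf : IsRationalPoint k inf) (hc : c.point ≠ inf)
    {x : Point k Q L} (hx : x.toCurve = inf) (i : ℤ) :
    cokerDim (((F.F (i + 1)).map (U (i + 1)).mkQ).map (hU.quotP (i + 1)))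
        ((F.F (i + 1 + 1)).map (U (i + 1 + 1)).mkQ) ≤
      cokerDim (((F.F i).map (U i).mkQ).map (hU.quotP i)) ((F.F (i + 1)).map (U (i + 1)).mkQ) := by
  obtain ⟨π, hπ⟩ := exists_isUniformizer_curve k hinf.1
  have hfin := (hU.cokerDim_quotP_le i).trans_lt Cardinal.natCast_lt_aleph0
  obtain ⟨n, hn⟩ := Cardinal.lt_aleph0.1 hfin
  rw [hn, hU.cokerDim_quotP hinf hx]
  rw [hU.cokerDim_quotP hinf hx] at hn
  have h := relDim_mapSigma_le hinf hπ hx (hU.quotTau (i + 1)) (fun b _ => ?_) hn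
  · have e1 : ∀ i, ((F.F i).map (U i).mkQ).mapSigma (hU.quotTau i) x =
        (F.F (i + 1)).map (U (i + 1)).mkQ x := by
      intro i
      rw [hU.mapSigma_quotTau]
      refine le_antisymm (Submodule.map_mono (F.tau_le i x)) (Submodule.map_mono ?_)
      exact F.le_mapSigma_tau (graphIdeal_eq_top hinf hc hx) i
    have e2 : (((F.F i).map (U i).mkQ).map (hU.quotP i)).mapSigma (hU.quotTau (i + 1)) x =
        ((F.F (i + 1)).map (U (i + 1)).mkQ).map (hU.quotP (i + 1)) x := by
      have hcomm : ∀ v, hU.quotTau (i + 1) (hU.quotP i v) = hU.quotP (i + 1) (hU.quotTau i v) := by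
        intro v
        obtain ⟨v, rfl⟩ := Submodule.Quotient.mk_surjective _ v
        exact (congrArg (U (i + 1 + 1)).mkQ (F.comm i v)).symm
      refine Eq.trans ?_ (congrArg (Submodule.map ((hU.quotP (i + 1)).restrictScalars x.ring)) (e1 i))
      refine Eq.trans ?_ (Submodule.map_span ((hU.quotP (i + 1)).restrictScalars x.ring) _).symm
      change Submodule.span x.ring _ = _
      congr 1
      ext w
      constructor
      · rintro ⟨_, ⟨m, hm, rfl⟩, rfl⟩
        exact ⟨_, ⟨m, hm, rfl⟩, (hcomm m).symm⟩
      · rintro ⟨_, ⟨m, hm, rfl⟩, rfl⟩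
        exact ⟨_, ⟨m, hm, rfl⟩, hcomm m⟩
    rw [e1, e2] at h
    exact h
  · obtain ⟨a, ha, hab⟩ := ((isBounded_quot (U := U) i).map (hU.quotP_surjective i)).absorb x b
    obtain ⟨n, hn⟩ := (isUniformizer_ofQ (L := L) hinf hπ hx).exists_pow_mul_mem (inv_ne_zero ha)
    refine ⟨n, ?_⟩
    have := smul_mem_stalk hn hab
    rwa [smul_smul, mul_assoc, inv_mul_cancel₀ ha, mul_one] at this

omit hU in
theorem isLocallyFree_quot (i : ℤ) : IsLocallyFree
    (Module.finrank (FunField k Q L) (F.V i ⧸ U i)) ((F.F i).map (U i).mkQ) :=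
  (isBounded_quot i).isLocallyFree fun x => ((F.locallyFree i).fg x).map _

theorem IsStable.sum_cokerDim_quotP (hinf : IsRationalPoint k inf) {x : Point k Q L}
    (hx : x.toCurve = inf) {m l : ℕ}
    (h : ∀ i, (F.F i).map (iter F.P i l) = negTwist inf m (F.F (i + l))) (i : ℤ) :
    ∑ j ∈ Finset.range l, cokerDim (((F.F (i + j)).map (U (i + j)).mkQ).map (hU.quotP (i + j)))
      ((F.F (i + j + 1)).map (U (i + j + 1)).mkQ) =
        (m * Module.finrank (FunField k Q L) (F.V (i + l) ⧸ U (i + l)) : ℕ) := by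
  obtain ⟨π, hπ⟩ := exists_isUniformizer_curve k hinf.1
  obtain ⟨b, hb, -⟩ := isLocallyFree_quot (U := U) (i + l) x
  rw [← relDim_uniformizer_pow hinf hπ hx b hb m]
  have h1 := relDim_iter (M := fun i => (F.F i).map (U i).mkQ) hU.map_quotP_le hU.quotP_injective x i l
  rw [hU.map_iter_quotP h] at h1
  refine (Finset.sum_congr rfl fun j _ => hU.cokerDim_quotP hinf hx _).trans (h1.symm.trans ?_)
  congr 1
  ext w
  change w ∈ negTwist inf m _ x ↔ _
  rw [mem_negTwist hπ hx]
  exact ⟨fun ⟨m, hm, h⟩ => ⟨m, hm, h.symm⟩, fun ⟨m, hm, h⟩ => ⟨m, hm, h.symm⟩⟩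

theorem IsStable.exists_dim (hinf : IsRationalPoint k inf) (hc : c.point ≠ inf) :
    ∃ d : ℕ, (∀ i, cokerDim (((F.F i).map (U i).mkQ).map (hU.quotP i))
        ((F.F (i + 1)).map (U (i + 1)).mkQ) = d) ∧
      ∃ m l : ℕ, 0 < m ∧ 0 < l ∧ l * d = m * Module.finrank (FunField k Q L) (F.V 0 ⧸ U 0) ∧
        ∀ i, (F.F i).map (iter F.P i l) = negTwist inf m (F.F (i + l)) := by
  obtain ⟨m, l, hm, hl, hlm, h⟩ := F.periodic
  have hfin := fun i => (hU.cokerDim_quotP_le i).trans_lt Cardinal.natCast_lt_aleph0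
  choose N hN using fun i => Cardinal.lt_aleph0.1 (hfin i)
  by_cases hx : ∃ x : Point k Q L, x.toCurve = inf
  · obtain ⟨x, hx⟩ := hx
    have h1 : ∀ i, N (i + 1) ≤ N i := fun i => by
      have := hU.cokerDim_quotP_succ_le hinf hc hx i
      rw [hN, hN] at this
      exact_mod_cast this
    have h2 : ∀ i, ∑ j ∈ Finset.range l, N (i + j) =
        m * Module.finrank (FunField k Q L) (F.V 0 ⧸ U 0) := fun i => by
      have := hU.sum_cokerDim_quotP hinf hx h i
      rw [hU.finrank_quot _ 0] at this
      simp only [hN] at this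
      exact_mod_cast this
    have hanti : ∀ (i : ℤ) (n : ℕ), N (i + n) ≤ N i := by
      intro i n
      induction n with
      | zero => simp
      | succ n ih => rw [Nat.cast_succ, ← add_assoc]; exact (h1 _).trans ih
    have hper : ∀ i, N (i + l) = N i := by
      intro i
      have h3 := Finset.sum_range_succ (fun j : ℕ => N (i + j)) l
      have h4 := Finset.sum_range_succ' (fun j : ℕ => N (i + j)) l
      have h5 := h2 (i + 1)
      have h6 : ∑ j ∈ Finset.range l, N (i + (j + 1 : ℕ)) = ∑ j ∈ Finset.range l, N (i + 1 + j) :=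
        Finset.sum_congr rfl fun j _ => by congr 1; push_cast; ring
      rw [h6, h5, h3, h2] at h4
      simpa using h4
    have hstep : ∀ i, N (i + 1) = N i := by
      intro i
      refine le_antisymm (h1 i) ?_
      obtain ⟨l', rfl⟩ : ∃ l', l = l' + 1 := ⟨l - 1, by omega⟩
      have e : i + ((l' + 1 : ℕ) : ℤ) = i + 1 + l' := by push_cast; ring
      rw [← hper i, e]
      exact hanti (i + 1) l'
    have hconst : ∀ i, N i = N 0 := by
      intro i
      induction i using Int.induction_on with
      | zero => rfl
      | succ n ih => rw [hstep, ih]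
      | pred n ih => rw [← ih, ← hstep (-(n : ℤ) - 1), sub_add_cancel]
    refine ⟨N 0, fun i => by rw [hN, hconst], m, l, hm, hl, ?_, h⟩
    rw [← h2 0, Finset.sum_congr rfl fun j _ => hconst _, Finset.sum_const, Finset.card_range,
      smul_eq_mul]
  · have hd : F.dim = 0 := by
      have := F.coker_P 0
      rw [cokerDim_eq_zero_of_le fun x => F.le_map_P (fun h => hx ⟨x, h⟩) 0] at this
      exact_mod_cast this.symm
    have hr : F.rank = 0 := by
      rw [hd, mul_zero] at hlm
      exact (Nat.mul_eq_zero.1 hlm.symm).resolve_left hm.ne'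
    refine ⟨0, fun i => ?_, m, l, hm, hl, ?_, h⟩
    · have := hU.cokerDim_quotP_le i
      rw [hd] at this
      simpa using this
    · have h3 := (U 0).finrank_quotient_le
      rw [finrank_V, hr] at h3
      rw [Nat.le_zero.1 h3, mul_zero, mul_zero]

end QuotientDim

/-- The quotient of an abelian `τ`-sheaf by a stable family of subspaces. -/
noncomputable def IsStable.quot (hinf : IsRationalPoint k inf) (hc : c.point ≠ inf) :
    AbelianTauSheaf inf c where
  rank := Module.finrank (FunField k Q L) (F.V 0 ⧸ U 0)
  dim := (hU.exists_dim hinf hc).choose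
  V i := F.V i ⧸ U i
  F i := (F.F i).map (U i).mkQ
  locallyFree i := by
    rw [hU.finrank_quot 0 i]; exact isLocallyFree_quot i
  P := hU.quotP
  P_le := hU.map_quotP_le
  P_injective := hU.quotP_injective
  tau := hU.quotTau
  tau_le := hU.mapSigma_quotTau_le
  tau_injective i := linearIndependent_of_span_range_eq_top (hU.finrank_quot i (i + 1)) _
    (hU.span_range_quotTau i)
  comm i m := by
    obtain ⟨m, rfl⟩ := Submodule.Quotient.mk_surjective _ m
    exact congrArg (U (i + 1 + 1)).mkQ (F.comm i m)
  periodic := by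
    obtain ⟨-, m, l, hm, hl, hlm, h⟩ := (hU.exists_dim hinf hc).choose_spec
    exact ⟨m, l, hm, hl, hlm, hU.map_iter_quotP h⟩
  coker_P := (hU.exists_dim hinf hc).choose_spec.1
  coker_tau i := (hU.cokerDim_quotTau i).trans ((hU.exists_dim hinf hc).choose_spec.1 i)
  coker_tau_graph i x := by
    refine pow_smul_mem_of_relDim_le (hU.mapSigma_quotTau_le i x) _ (D := F.dim) ?_ ?_
    · rintro h hh _ ⟨m, hm, rfl⟩
      rw [hU.mapSigma_quotTau]
      exact ⟨h • m, F.coker_tau_graph i x h hh m hm, rfl⟩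
    · rw [← (hU.exists_dim hinf hc).choose_spec.1 i, ← hU.cokerDim_quotTau]
      exact relDim_le_cokerDim _ _ x

/-- A simple abelian `τ`-sheaf has no nontrivial stable families of subspaces. -/
theorem IsSimple.eq_bot_or_eq_top (hF : F.IsSimple) (hinf : IsRationalPoint k inf)
    (hc : c.point ≠ inf) (hU : F.IsStable U) : (∀ i, U i = ⊥) ∨ ∀ i, U i = ⊤ := by
  have h0 : ∀ i j, Module.finrank (FunField k Q L) (U i) = Module.finrank (FunField k Q L) (U j) := by
    intro i j
    have h1 := (U i).finrank_quotient_add_finrank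
    have h2 := (U j).finrank_quotient_add_finrank
    rw [finrank_V] at h1 h2
    have := hU.finrank_quot i j
    omega
  rcases hF.2 (hU.quot hinf hc) (fun i => (U i).mkQ) ⟨fun _ => le_rfl, fun _ _ => rfl, fun _ _ => rfl⟩
    (fun _ => rfl) with h | ⟨f, -, hf, -⟩
  · right
    intro i
    refine Submodule.eq_top_of_finrank_eq ?_
    have h1 := (U i).finrank_quotient_add_finrank
    have h2 : Module.finrank (FunField k Q L) (F.V 0 ⧸ U 0) = 0 := h
    rw [hU.finrank_quot i 0, h2, zero_add] at h1
    exact h1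
  · left
    intro i
    refine Submodule.finrank_eq_zero.1 ?_
    have h1 := (U i).finrank_quotient_add_finrank
    have h2 := LinearMap.finrank_le_finrank_of_injective (hf i)
    change _ ≤ Module.finrank (FunField k Q L) (F.V i ⧸ U i) at h2
    omega

end AbelianTauSheaf


section

set_option linter.unusedSectionVars false

variable {k Q L : Type u} [Field k] [Fintype k] [Field Q] [Algebra k Q] [IsCurve k Q]
  [Field L] [Algebra k L] {inf : ValuationSubring Q} {c : Characteristic k Q L}

theorem EffDivisor.exists_poles (k : Type u) {Q : Type u} [Field k] [Fintype k] [Field Q]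
    [Algebra k Q] [IsCurve k Q] (S : Finset Q) :
    ∃ D : EffDivisor Q, ∀ s ∈ S, ∀ v, ∀ g ∈ D.ideal v, (g : Q) * s ∈ v := by
  classical
  induction S using Finset.induction_on with
  | empty => exact ⟨EffDivisor.poles k 1, fun s hs => absurd hs (Finset.notMem_empty s)⟩
  | insert a S _ ih =>
    obtain ⟨D, hD⟩ := ih
    refine ⟨D.add (EffDivisor.poles k a), fun s hs v g hg => ?_⟩
    have hg' : g ∈ D.ideal v * (EffDivisor.poles k a).ideal v := hg
    rcases Finset.mem_insert.1 hs with rfl | hs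
    · exact Ideal.mul_le_right hg'
    · exact hD s hs v g (Ideal.mul_le_left hg')

theorem Point.exists_isUniformizer {x : Point k Q L} (hx : x.ring ≠ ⊤) :
    ∃ π, IsUniformizer x.ring π := by
  obtain ⟨t, ht⟩ := exists_isSeparating_curve k Q
  exact TauSheaf.exists_isUniformizer (isSeparating_ofQ (L := L) ht) x.algebraMap_mem hx

/-- A point of the generic fibre of `C_L → C` and a nontrivial Frobenius translate of it cannot
both lie on the graph of the characteristic. -/
theorem Characteristic.graphIdeal_frob_iterate (c : Characteristic k Q L) {x : Point k Q L}
    (hx : x.toCurve = ⊤) {n : ℕ} (hn : 0 < n) (h : c.graphIdeal x ≠ ⊤) :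
    c.graphIdeal (Point.frob^[n] x) = ⊤ := by
  by_contra h'
  have key : ∀ y : Point k Q L, c.graphIdeal y ≠ ⊤ → ∀ a : c.point,
      ofQ k Q L (a : Q) - algebraMap L (FunField k Q L) (c.hom a) ∈ y.ring.nonunits := by
    intro y hy a
    rw [Characteristic.graphIdeal] at hy
    split_ifs at hy with hc
    · have hm : ofQ k Q L (a : Q) - algebraMap L (FunField k Q L) (c.hom a) ∈ y.ring :=
        sub_mem (ofQ_mem.2 (hc a.2)) (y.algebraMap_mem _)
      have h1 := IsLocalRing.le_maximalIdeal hy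
        (Ideal.subset_span (⟨a, rfl⟩ : (⟨_, hm⟩ : y.ring) ∈ {h : y.ring | ∃ a : c.point,
          (h : FunField k Q L) = ofQ k Q L (a : Q) - algebraMap L (FunField k Q L) (c.hom a)}))
      exact ValuationSubring.coe_mem_nonunits_iff.2 h1
    · exact absurd rfl hy
  have hpow : ∀ l : L, (sigma k Q L)^[n] (algebraMap L (FunField k Q L) l) =
      algebraMap L (FunField k Q L) (l ^ Fintype.card k ^ n) := by
    intro l
    clear hn h'
    induction n with
    | zero => simp
    | succ n ih => rw [Function.iterate_succ_apply', ih, sigma_algebraMap, ← pow_mul, ← pow_succ]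
  have h1 : ∀ a : c.point, c.hom a ^ Fintype.card k ^ n = c.hom a := by
    intro a
    have e1 := key x h a
    have e2 := key _ h' a
    rw [mem_nonunits_frob_iterate, ← RingHom.coe_pow, map_sub, RingHom.coe_pow, sigma_iterate_ofQ,
      hpow] at e2
    have e3 := sub_mem e1 e2
    rw [sub_sub_sub_cancel_left, ← map_sub] at e3
    by_contra hne
    exact algebraMap_notMem_nonunits x (sub_ne_zero.2 hne) e3
  have h2 : ∀ a : c.point, (a : Q) ^ Fintype.card k ^ n = a := by
    intro a
    by_contra hne
    have e1 := key x h (a ^ Fintype.card k ^ n - a)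
    rw [map_sub, map_pow, h1, sub_self, map_zero, sub_zero, ofQ_mem_nonunits, hx] at e1
    refine notMem_nonunits (v := (⊤ : ValuationSubring Q)) (sub_ne_zero.2 hne)
      (ValuationSubring.mem_top _) ?_
    simpa using e1
  obtain ⟨t, ht⟩ := exists_isSeparating_curve k Q
  have h3 : t ^ Fintype.card k ^ n = t := by
    rcases c.point.mem_or_inv_mem t with h | h
    · exact h2 ⟨t, h⟩
    · have := h2 ⟨_, h⟩
      rw [inv_pow] at this
      exact inv_injective this
  have hcard : 1 < Fintype.card k ^ n := Nat.one_lt_pow hn.ne' Fintype.one_lt_card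
  refine ht.transcendental ⟨Polynomial.X ^ Fintype.card k ^ n - Polynomial.X,
    FiniteField.X_pow_card_sub_X_ne_zero k hcard, ?_⟩
  rw [map_sub, map_pow, Polynomial.aeval_X, h3, sub_self]

end

namespace AbelianTauSheaf

set_option linter.unusedSectionVars false

variable {k Q L : Type u} [Field k] [Fintype k] [Field Q] [Algebra k Q] [IsCurve k Q]
  [Field L] [Algebra k L] {inf : ValuationSubring Q} {c : Characteristic k Q L}
  {F G : AbelianTauSheaf inf c} {f : GenericMap F G}

/-- `s • f i` is integral at `x`. -/
def IsIntegralAt (f : GenericMap F G) (s : Q) (i : ℤ) (x : Point k Q L) : Prop :=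
  ∀ m ∈ F.F i x, ofQ k Q L s • f i m ∈ G.F i x

theorem finite_not_isIntegralAt (f : GenericMap F G) (s : Q) (i : ℤ) :
    {x | ¬ IsIntegralAt f s i x}.Finite := by
  obtain ⟨b, -, hb⟩ := F.locallyFree i (Point.generic k Q L)
  refine (hb.union (Set.finite_iUnion fun j : Fin F.rank =>
    (G.isBounded i).fin_mem (ofQ k Q L s • f i (b j)))).subset fun x hx => ?_
  by_contra h
  simp only [Set.mem_union, Set.mem_iUnion, Set.mem_ofPred_eq, not_or, not_exists, not_not] at h
  refine hx fun m hm => ?_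
  rw [h.1] at hm
  induction hm using Submodule.span_induction with
  | mem m hm => obtain ⟨j, rfl⟩ := hm; exact h.2 j
  | zero => rw [map_zero, smul_zero]; exact zero_mem _
  | add m n _ _ hm hn => rw [map_add, smul_add]; exact add_mem hm hn
  | smul a m _ hm =>
    have : f i (a • m) = (a : FunField k Q L) • f i m := map_smul (f i) (a : FunField k Q L) m
    rw [this, smul_comm]
    exact smul_mem_stalk a.2 hm

theorem isIntegralAt_of_eq_top (f : GenericMap F G) (s : Q) (i : ℤ) {x : Point k Q L}
    (hx : x.ring = ⊤) : IsIntegralAt f s i x := fun _ _ => (G.isBounded i).generic hx _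

variable (hP : ∀ i (m : F.V i), f (i + 1) (F.P i m) = G.P i (f i m))
  (hτ : ∀ i (m : F.V i), f (i + 1) (F.tau i m) = G.tau i (f i m))

include hP in
theorem isIntegralAt_succ_iff (s : Q) (i : ℤ) {x : Point k Q L} (hx : x.toCurve ≠ inf) :
    IsIntegralAt f s (i + 1) x ↔ IsIntegralAt f s i x := by
  constructor
  · intro h m hm
    have h1 := h _ (F.P_mem hm)
    rw [hP, ← map_smul] at h1
    obtain ⟨m', hm', h2⟩ := G.le_map_P hx i h1
    exact G.P_injective i h2 ▸ hm'
  · intro h w hw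
    obtain ⟨m, hm, rfl⟩ := F.le_map_P hx i hw
    have h1 := G.P_mem (h m hm)
    rwa [map_smul, ← hP] at h1

include hτ in
theorem isIntegralAt_succ_iff_frob (s : Q) (i : ℤ) {x : Point k Q L} (hx : c.graphIdeal x = ⊤) :
    IsIntegralAt f s (i + 1) x ↔ IsIntegralAt f s i x.frob := by
  constructor
  · intro h m hm
    have h1 := G.le_mapSigma_tau hx i (h _ (F.tau_mem hm))
    rw [hτ] at h1
    have e : ofQ k Q L s • G.tau i (f i m) = G.tau i (ofQ k Q L s • f i m) := by
      rw [map_smulₛₗ, sigma_ofQ]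
    rw [e] at h1
    obtain ⟨b, hb, -⟩ := G.locallyFree i x.frob
    have hli := G.tau_injective i _ b b.linearIndependent
    let b' := basisOfLinearIndependentOfCardEqFinrank' _ hli (by rw [Fintype.card_fin, finrank_V])
    have hb' : ∀ j, b' j = G.tau i (b j) := fun j => by
      simp only [b', coe_basisOfLinearIndependentOfCardEqFinrank']
    generalize ofQ k Q L s • f i m = w at h1 ⊢
    have h2 : G.tau i w ∈ Submodule.span x.ring (Set.range b') := by
      refine Submodule.span_le.2 ?_ h1
      rintro _ ⟨m, hm, rfl⟩
      rw [SetLike.mem_coe, hb] at hm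
      induction hm using Submodule.span_induction with
      | mem m hm => obtain ⟨j, rfl⟩ := hm; exact Submodule.subset_span ⟨j, hb' j⟩
      | zero => rw [map_zero]; exact zero_mem _
      | add m n _ _ hm hn => rw [map_add]; exact add_mem hm hn
      | smul a m _ hm =>
        have : G.tau i (a • m) = sigma k Q L (a : FunField k Q L) • G.tau i m :=
          map_smulₛₗ (G.tau i) (a : FunField k Q L) m
        rw [this]
        exact smul_mem_stalk a.2 hm
    rw [hb]
    refine mem_span_of_repr b fun j => ?_
    have h3 := map_mem_of_mem_span (x := x) b' (b'.coord j) (a := 1) (fun l => by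
      rw [one_mul, Module.Basis.coord_apply, b'.repr_self]
      by_cases hij : l = j
      · subst hij; rw [Finsupp.single_eq_same]; exact x.ring.one_mem
      · rw [Finsupp.single_eq_of_ne' hij]; exact x.ring.zero_mem) h2
    have h4 : G.tau i w = ∑ j, sigma k Q L (b.repr w j) • b' j := by
      conv_lhs => rw [← b.sum_repr w, map_sum]
      exact Finset.sum_congr rfl fun j _ => by rw [map_smulₛₗ, hb']
    rw [one_mul, Module.Basis.coord_apply, h4, b'.repr_sum_self] at h3
    exact h3
  · intro h w hw
    have hw' := F.le_mapSigma_tau hx i hw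
    induction hw' using Submodule.span_induction with
    | mem w hw' =>
      obtain ⟨m, hm, rfl⟩ := hw'
      have h1 := G.tau_mem (h m hm)
      rwa [map_smulₛₗ, sigma_ofQ, ← hτ] at h1
    | zero => rw [map_zero, smul_zero]; exact zero_mem _
    | add m n h1 h2 hm hn =>
      rw [map_add, smul_add]
      exact add_mem (hm (Submodule.span_le.2 (by
        rintro _ ⟨m, hm, rfl⟩; exact F.tau_mem hm) h1)) (hn (Submodule.span_le.2 (by
        rintro _ ⟨m, hm, rfl⟩; exact F.tau_mem hm) h2))
    | smul a m h1 hm =>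
      have : f (i + 1) (a • m) = (a : FunField k Q L) • f (i + 1) m :=
        map_smul (f (i + 1)) (a : FunField k Q L) m
      rw [this, smul_comm]
      exact smul_mem_stalk a.2 (hm (Submodule.span_le.2 (by
        rintro _ ⟨m, hm, rfl⟩; exact F.tau_mem hm) h1))

include hP in
theorem isIntegralAt_iff_zero (s : Q) (i : ℤ) {x : Point k Q L} (hx : x.toCurve ≠ inf) :
    IsIntegralAt f s i x ↔ IsIntegralAt f s 0 x := by
  induction i using Int.induction_on with
  | zero => rfl
  | succ n ih => exact (isIntegralAt_succ_iff hP s _ hx).trans ih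
  | pred n ih =>
    refine Iff.trans ?_ ih
    have := isIntegralAt_succ_iff hP s (-(n : ℤ) - 1) hx
    rw [sub_add_cancel] at this
    exact this.symm

include hτ in
theorem isIntegralAt_iff_zero_of_inf (hinf : IsRationalPoint k inf) (hc : c.point ≠ inf) (s : Q)
    (i : ℤ) {x : Point k Q L} (hx : x.toCurve = inf) :
    IsIntegralAt f s i x ↔ IsIntegralAt f s 0 x := by
  obtain ⟨π, hπ⟩ := exists_isUniformizer_curve k hinf.1
  have hfrob : x.frob = x := Point.eq_of_toCurve_eq hinf hπ ((toCurve_frob x).trans hx) hx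
  have h : ∀ i, IsIntegralAt f s (i + 1) x ↔ IsIntegralAt f s i x := fun i => by
    rw [isIntegralAt_succ_iff_frob hτ s i (graphIdeal_eq_top hinf hc hx), hfrob]
  induction i using Int.induction_on with
  | zero => rfl
  | succ n ih => exact (h _).trans ih
  | pred n ih =>
    refine Iff.trans ?_ ih
    have := h (-(n : ℤ) - 1)
    rw [sub_add_cancel] at this
    exact this.symm

include hP hτ in
theorem isIntegralAt_of_toCurve_eq_top (hinf : IsRationalPoint k inf) {x : Point k Q L}
    (hx : x.toCurve = ⊤) : IsIntegralAt f 1 0 x := by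
  by_contra hbad
  have hne : x.ring ≠ ⊤ := fun h => hbad (isIntegralAt_of_eq_top f 1 0 h)
  have hiff : ∀ y : Point k Q L, y.toCurve = ⊤ → c.graphIdeal y = ⊤ →
      (IsIntegralAt f 1 0 y ↔ IsIntegralAt f 1 0 y.frob) := fun y hy hg => by
    rw [← isIntegralAt_succ_iff hP 1 0 (by rw [hy]; exact hinf.1.symm),
      isIntegralAt_succ_iff_frob hτ 1 0 hg]
  have hfin := finite_not_isIntegralAt f 1 0
  let e := frobEquiv k Q L
  have hcurve : ∀ n : ℕ, (Point.frob^[n] x).toCurve = ⊤ := fun n => by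
    induction n with
    | zero => exact hx
    | succ n ih => rw [Function.iterate_succ_apply', toCurve_frob, ih]
  have hcurve' : ∀ n : ℕ, (e.symm^[n] x).toCurve = ⊤ := fun n => by
    induction n with
    | zero => exact hx
    | succ n ih =>
      rw [Function.iterate_succ_apply', ← toCurve_frob]
      change (e (e.symm _)).toCurve = ⊤
      rw [e.apply_symm_apply, ih]
  have hinj : ∀ y : Point k Q L, y.toCurve = ⊤ → y.ring ≠ ⊤ → ∀ g : ℕ → Point k Q L,
      (∀ n, ¬ IsIntegralAt f 1 0 (g n)) → (∀ m n, m < n → g m ≠ g n) → False := by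
    intro y hy hy' g hg hg'
    have : Function.Injective g := by
      intro m n h
      rcases lt_trichotomy m n with hmn | hmn | hmn
      · exact absurd h (hg' _ _ hmn)
      · exact hmn
      · exact absurd h.symm (hg' _ _ hmn)
    exact (Set.infinite_range_of_injective this) (hfin.subset (by rintro _ ⟨n, rfl⟩; exact hg n))
  have hcancel : ∀ n (y : Point k Q L), Point.frob^[n] (e.symm^[n] y) = y := fun n y =>
    (Function.LeftInverse.iterate (f := e.symm) (g := e) e.apply_symm_apply n) y
  by_cases h1 : ∀ n, c.graphIdeal (Point.frob^[n] x) = ⊤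
  · refine hinj x hx hne (fun n => Point.frob^[n] x) (fun n => ?_) (fun m n hmn h => ?_)
    · induction n with
      | zero => exact hbad
      | succ n ih =>
        rw [Function.iterate_succ_apply', ← hiff _ (hcurve n) (h1 n)]
        exact ih
    · obtain ⟨d, rfl⟩ := Nat.exists_eq_add_of_lt hmn
      refine hne (eq_top_of_periodic hx (Nat.succ_pos d) ?_)
      have h2 : Point.frob^[m] x = Point.frob^[m] (Point.frob^[d + 1] x) := by
        rw [← Function.iterate_add_apply]; exact h
      exact ((frobEquiv k Q L).injective.iterate m h2).symm
  · obtain ⟨n, hn⟩ := not_forall.1 h1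
    have h2 : ∀ m, c.graphIdeal (e.symm^[m + 1] x) = ⊤ := by
      intro m
      by_contra h3
      have h4 := c.graphIdeal_frob_iterate (hcurve' (m + 1)) (n := n + (m + 1)) (by omega) h3
      rw [Function.iterate_add_apply, hcancel] at h4
      exact hn h4
    refine hinj x hx hne (fun n => e.symm^[n] x) (fun n => ?_) (fun m n hmn h => ?_)
    · induction n with
      | zero => exact hbad
      | succ n ih =>
        rw [hiff _ (hcurve' (n + 1)) (h2 n), Function.iterate_succ_apply']
        change ¬ IsIntegralAt f 1 0 (e (e.symm _))
        rw [e.apply_symm_apply]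
        exact ih
    · obtain ⟨d, rfl⟩ := Nat.exists_eq_add_of_lt hmn
      refine hne (eq_top_of_periodic hx (Nat.succ_pos d) ?_)
      have h3 : Point.frob^[m + d + 1] (e.symm^[m] x) =
        Point.frob^[m + d + 1] (e.symm^[m + d + 1] x) := congrArg _ h
      rw [hcancel, add_assoc, add_comm m, Function.iterate_add_apply, hcancel] at h3
      exact h3

include hP hτ in
/-- Every family of maps of the generic fibres which commutes with the `Π_i` and `τ_i` is a
quasi-morphism. -/
theorem isQuasiHom_of_comm (hinf : IsRationalPoint k inf) (hc : c.point ≠ inf) : IsQuasiHom f := by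
  classical
  have hfin := finite_not_isIntegralAt f 1 0
  have key : ∀ x : Point k Q L, ∃ s : Q, s ≠ 0 ∧
      (x.toCurve ≠ ⊤ → IsIntegralAt f s 0 x) := by
    intro x
    by_cases hx : x.toCurve = ⊤
    · exact ⟨1, one_ne_zero, fun h => absurd hx h⟩
    obtain ⟨g, hg⟩ := exists_isUniformizer_curve k hx
    have hxr : x.ring ≠ ⊤ := fun h => hx (by
      rw [Point.toCurve, h]; ext; simp [ValuationSubring.mem_comap])
    obtain ⟨ϖ, hϖ⟩ := Point.exists_isUniformizer hxr
    obtain ⟨b, hb, -⟩ := F.locallyFree 0 x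
    choose a ha0 ha using fun j => (G.isBounded 0).absorb x (f 0 (b j))
    choose n hn using fun j => hϖ.exists_pow_mul_mem (inv_ne_zero (ha0 j))
    have hgϖ : ofQ k Q L g / ϖ ∈ x.ring := hϖ.div_mem (ofQ_mem_nonunits.2 hg.mem)
    have hgx : ofQ k Q L g ∈ x.ring := ofQ_mem.2 (ValuationSubring.nonunits_subset hg.mem)
    refine ⟨g ^ (∑ j, n j), pow_ne_zero _ hg.ne_zero, fun _ m hm => ?_⟩
    rw [hb] at hm
    induction hm using Submodule.span_induction with
    | mem m hm =>
      obtain ⟨j, rfl⟩ := hm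
      obtain ⟨d, hd⟩ := Nat.exists_eq_add_of_le (Finset.single_le_sum (f := n)
        (fun _ _ => Nat.zero_le _) (Finset.mem_univ j))
      have h1 : ofQ k Q L (g ^ (∑ j, n j)) =
          ofQ k Q L g ^ d * ((ofQ k Q L g / ϖ) ^ n j * (ϖ ^ n j * (a j)⁻¹)) * a j := by
        have := ha0 j
        have := hϖ.ne_zero
        rw [hd, map_pow, div_pow]
        field_simp
        ring
      rw [h1, mul_smul]
      exact smul_mem_stalk (mul_mem (pow_mem hgx _) (mul_mem (pow_mem hgϖ _) (hn j))) (ha j)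
    | zero => rw [map_zero, smul_zero]; exact zero_mem _
    | add m n _ _ hm hn => rw [map_add, smul_add]; exact add_mem hm hn
    | smul a m _ hm =>
      have : f 0 (a • m) = (a : FunField k Q L) • f 0 m := map_smul (f 0) (a : FunField k Q L) m
      rw [this, smul_comm]
      exact smul_mem_stalk a.2 hm
  choose s hs0 hs using key
  obtain ⟨D, hD⟩ := EffDivisor.exists_poles k (hfin.toFinset.image fun x => (s x)⁻¹)
  refine ⟨D, (isHomTo_iff _ _).2 ⟨fun i x m hm => ?_, hP, hτ⟩⟩
  rw [mem_twist]
  intro g hg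
  have hiff : ∀ s, IsIntegralAt f s i x ↔ IsIntegralAt f s 0 x := fun s => by
    by_cases hx : x.toCurve = inf
    · exact isIntegralAt_iff_zero_of_inf hτ hinf hc s i hx
    · exact isIntegralAt_iff_zero hP s i hx
  by_cases hbad : IsIntegralAt f 1 0 x
  · have h1 := (hiff 1).2 hbad m hm
    rw [map_one, one_smul] at h1
    exact smul_mem_stalk (ofQ_mem.2 g.2) h1
  · have hx : x.toCurve ≠ ⊤ := fun h => hbad (isIntegralAt_of_toCurve_eq_top hP hτ hinf h)
    have h1 := (hiff (s x)).2 (hs x hx) m hm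
    have h2 := hD _ (Finset.mem_image_of_mem _ (hfin.mem_toFinset.2 hbad)) _ g hg
    have h3 := smul_mem_stalk (ofQ_mem.2 h2) h1
    rwa [smul_smul, ← map_mul, inv_mul_cancel_right₀ (hs0 x)] at h3

end AbelianTauSheaf


section EquivFamily

variable {R : Type u} [Ring R] {V : ℤ → Type u} [∀ i, AddCommGroup (V i)] [∀ i, Module R (V i)]

/-- The identifications of `V 0` with `V i` obtained from isomorphisms `V i ≃ V (i + 1)`. -/
def equivFamily (P : ∀ i, V i ≃ₗ[R] V (i + 1)) : ∀ i, V 0 ≃ₗ[R] V i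
  | .ofNat n => Nat.rec (motive := fun n => V 0 ≃ₗ[R] V (Int.ofNat n)) (LinearEquiv.refl R (V 0))
      (fun n e => e.trans (P (Int.ofNat n))) n
  | .negSucc n => Nat.rec (motive := fun n => V 0 ≃ₗ[R] V (Int.negSucc n)) (P (Int.negSucc 0)).symm
      (fun n e => e.trans (P (Int.negSucc (n + 1))).symm) n

theorem equivFamily_succ (P : ∀ i, V i ≃ₗ[R] V (i + 1)) (i : ℤ) (v : V 0) :
    equivFamily P (i + 1) v = P i (equivFamily P i v) := by
  match i with
  | .ofNat n => rfl
  | .negSucc 0 => exact ((P (Int.negSucc 0)).apply_symm_apply v).symm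
  | .negSucc (n + 1) =>
    exact ((P (Int.negSucc (n + 1))).apply_symm_apply (equivFamily P (Int.negSucc n) v)).symm

end EquivFamily

namespace AbelianTauSheaf

set_option linter.unusedSectionVars false

variable {k Q L : Type u} [Field k] [Fintype k] [Field Q] [Algebra k Q] [IsCurve k Q]
  [Field L] [Algebra k L] {inf : ValuationSubring Q} {c : Characteristic k Q L}

/-! ### The generic fibre as a module over a free algebra -/

/-- The generic fibre of `F_0`. -/
abbrev Fiber (F : AbelianTauSheaf inf c) : Type u := F.V 0

noncomputable instance (F : AbelianTauSheaf inf c) : Module Q F.Fiber :=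
  Module.compHom F.Fiber (ofQ k Q L)

/-- The endomorphism `Π_0⁻¹ ∘ τ_0` of the generic fibre. -/
noncomputable def frobFiber (F : AbelianTauSheaf inf c) : F.Fiber →ₗ[Q] F.Fiber where
  toFun m := (F.equivP 0).symm (F.tau 0 m)
  map_add' m n := by
    refine Eq.trans ?_ (map_add (F.equivP 0).symm _ _)
    exact congrArg _ (map_add (F.tau 0) m n)
  map_smul' a m := by
    refine Eq.trans ?_ (map_smul (F.equivP 0).symm (ofQ k Q L a) _)
    refine congrArg _ ((map_smulₛₗ (F.tau 0) (ofQ k Q L a) m).trans ?_)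
    rw [sigma_ofQ]

theorem P_frobFiber (F : AbelianTauSheaf inf c) (m : F.Fiber) :
    F.P 0 (F.frobFiber m) = F.tau 0 m := (F.equivP 0).apply_symm_apply _

/-- The free algebra acting on the generic fibres by multiplication with functions and by
`Π_0⁻¹ ∘ τ_0`. -/
abbrev TauAlgebra (k Q L : Type u) [Field k] [Field Q] [Algebra k Q] [IsCurve k Q] [Field L]
    [Algebra k L] : Type u := FreeAlgebra Q (Option (FunField k Q L))

/-- The action of the free algebra on the generic fibre. -/
noncomputable def fiberRep (F : AbelianTauSheaf inf c) :
    TauAlgebra k Q L →ₐ[Q] Module.End Q F.Fiber :=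
  FreeAlgebra.lift Q fun o => o.elim F.frobFiber fun a =>
    { toFun := fun m => a • m
      map_add' := smul_add a
      map_smul' := fun b m => smul_comm a (ofQ k Q L b) m }

noncomputable instance (F : AbelianTauSheaf inf c) : Module (TauAlgebra k Q L) F.Fiber :=
  Module.compHom F.Fiber F.fiberRep.toRingHom

theorem tauAlgebra_smul_def (F : AbelianTauSheaf inf c) (r : TauAlgebra k Q L) (m : F.Fiber) :
    r • m = F.fiberRep r m := rfl

instance (F : AbelianTauSheaf inf c) : IsScalarTower Q (TauAlgebra k Q L) F.Fiber where
  smul_assoc a r m := by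
    rw [tauAlgebra_smul_def, map_smul]; rfl

theorem ι_none_smul (F : AbelianTauSheaf inf c) (m : F.Fiber) :
    (FreeAlgebra.ι Q none : TauAlgebra k Q L) • m = F.frobFiber m := by
  rw [tauAlgebra_smul_def, fiberRep, FreeAlgebra.lift_ι_apply]; rfl

theorem ι_some_smul (F : AbelianTauSheaf inf c) (a : FunField k Q L) (m : F.Fiber) :
    (FreeAlgebra.ι Q (some a) : TauAlgebra k Q L) • m = a • m := by
  rw [tauAlgebra_smul_def, fiberRep, FreeAlgebra.lift_ι_apply]; rfl

/-- A linear map which commutes with `Π_0⁻¹ ∘ τ_0` is linear over the free algebra. -/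
noncomputable def fiberHom {F G : AbelianTauSheaf inf c} (g : F.V 0 →ₗ[FunField k Q L] G.V 0)
    (hg : ∀ m : F.Fiber, g (F.frobFiber m) = G.frobFiber (g m)) :
    F.Fiber →ₗ[TauAlgebra k Q L] G.Fiber where
  toFun m := g m
  map_add' := map_add g
  map_smul' r m := by
    rw [RingHom.id_apply]
    induction r using FreeAlgebra.induction generalizing m with
    | grade0 a =>
      rw [algebraMap_smul]
      refine Eq.trans (map_smul g (ofQ k Q L a) m) ?_
      exact (algebraMap_smul (TauAlgebra k Q L) a (g m : G.Fiber)).symm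
    | grade1 o =>
      cases o with
      | none => rw [ι_none_smul, hg]; exact (ι_none_smul G (g m)).symm
      | some a => rw [ι_some_smul]; exact (map_smul g a m).trans (ι_some_smul G a (g m)).symm
    | mul r s hr hs =>
      rw [mul_smul, hr, hs]
      exact (mul_smul r s (g m : G.Fiber)).symm
    | add r s hr hs =>
      rw [add_smul]
      refine (map_add g _ _).trans ?_
      rw [hr, hs]
      exact (add_smul r s (g m : G.Fiber)).symm

variable {F G : AbelianTauSheaf inf c} {f : GenericMap F G}

theorem comm_frobFiber (hP : ∀ i (m : F.V i), f (i + 1) (F.P i m) = G.P i (f i m))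
    (hτ : ∀ i (m : F.V i), f (i + 1) (F.tau i m) = G.tau i (f i m)) (m : F.Fiber) :
    f 0 (F.frobFiber m) = G.frobFiber (f 0 m) := by
  apply G.P_injective 0
  refine (hP 0 _).symm.trans ?_
  rw [P_frobFiber, hτ]
  exact (P_frobFiber G (f 0 m)).symm

theorem tau_equivFamily (F : AbelianTauSheaf inf c) (i : ℤ) (m : F.Fiber) :
    F.tau i (equivFamily F.equivP i m) = equivFamily F.equivP (i + 1) (F.frobFiber m) := by
  have hstep : ∀ i, F.tau i (equivFamily F.equivP i m) =
      equivFamily F.equivP (i + 1) (F.frobFiber m) ↔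
      F.tau (i + 1) (equivFamily F.equivP (i + 1) m) =
        equivFamily F.equivP (i + 1 + 1) (F.frobFiber m) := by
    intro i
    rw [equivFamily_succ F.equivP (i + 1), equivFamily_succ F.equivP i m, equivP_apply,
      equivP_apply, ← F.comm]
    exact (F.P_injective (i + 1)).eq_iff.symm
  induction i using Int.induction_on with
  | zero =>
    rw [equivFamily_succ]
    exact (P_frobFiber F m).symm
  | succ n ih => exact (hstep _).1 ih
  | pred n ih =>
    rw [hstep, sub_add_cancel]
    exact ih

/-- A linear map of the fibres over the free algebra extends to all generic fibres. -/
theorem exists_extend (g : F.Fiber →ₗ[TauAlgebra k Q L] G.Fiber) :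
    ∃ f : GenericMap F G, (∀ i (m : F.V i), f (i + 1) (F.P i m) = G.P i (f i m)) ∧
      (∀ i (m : F.V i), f (i + 1) (F.tau i m) = G.tau i (f i m)) ∧ ∀ m, f 0 m = g m := by
  let g₀ : F.V 0 →ₗ[FunField k Q L] G.V 0 :=
    { toFun := fun m => g m
      map_add' := map_add g
      map_smul' := fun a m => by
        have h := map_smul g (FreeAlgebra.ι Q (some a)) m
        rw [ι_some_smul] at h
        exact h.trans (ι_some_smul G a (g m)) }
  have hg : ∀ m : F.Fiber, g (F.frobFiber m) = G.frobFiber (g m) := fun m => by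
    rw [← ι_none_smul, map_smul, ι_none_smul]
  refine ⟨fun i => (equivFamily G.equivP i).toLinearMap ∘ₗ g₀ ∘ₗ
    (equivFamily F.equivP i).symm.toLinearMap, fun i m => ?_, fun i m => ?_, fun m => rfl⟩
  · obtain ⟨v, rfl⟩ := (equivFamily F.equivP i).surjective m
    change equivFamily G.equivP (i + 1) (g₀ ((equivFamily F.equivP (i + 1)).symm
      (F.equivP i (equivFamily F.equivP i v)))) =
      G.equivP i (equivFamily G.equivP i (g₀ ((equivFamily F.equivP i).symm _)))
    rw [← equivFamily_succ, LinearEquiv.symm_apply_apply, LinearEquiv.symm_apply_apply,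
      equivFamily_succ]
  · obtain ⟨v, rfl⟩ := (equivFamily F.equivP i).surjective m
    change equivFamily G.equivP (i + 1) (g₀ ((equivFamily F.equivP (i + 1)).symm
      (F.tau i (equivFamily F.equivP i v)))) =
      G.tau i (equivFamily G.equivP i (g₀ ((equivFamily F.equivP i).symm _)))
    rw [LinearEquiv.symm_apply_apply]
    refine Eq.trans ?_ (tau_equivFamily G i (g v)).symm
    rw [← hg, tau_equivFamily F i v]
    refine congrArg _ ?_
    rw [LinearEquiv.symm_apply_apply]
    rfl

theorem eq_of_apply_zero_eq {f g : GenericMap F G}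
    (hf : ∀ i (m : F.V i), f (i + 1) (F.P i m) = G.P i (f i m))
    (hg : ∀ i (m : F.V i), g (i + 1) (F.P i m) = G.P i (g i m)) (h : f 0 = g 0) : f = g := by
  funext i
  induction i using Int.induction_on with
  | zero => exact h
  | succ n ih =>
    ext m
    obtain ⟨v, rfl⟩ := (F.equivP n).surjective m
    rw [equivP_apply, hf, hg, ih]
  | pred n ih =>
    ext m
    apply G.P_injective
    rw [← hf, ← hg]
    generalize F.P _ m = w
    revert w
    rw [sub_add_cancel, ih]
    exact fun _ => rfl

/-- The algebra of quasi-endomorphisms is the algebra of endomorphisms of the generic fibre. -/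
noncomputable def qEndEquiv (F : AbelianTauSheaf inf c) (hinf : IsRationalPoint k inf)
    (hc : c.point ≠ inf) : F.QEnd ≃ₐ[Q] Module.End (TauAlgebra k Q L) F.Fiber := by
  let φ : F.QEnd →ₐ[Q] Module.End (TauAlgebra k Q L) F.Fiber :=
    { toFun := fun f => fiberHom (f.1 0) (comm_frobFiber (f := f.1)
        (by obtain ⟨D, hD⟩ := f.2; exact hD.comm_P) (by obtain ⟨D, hD⟩ := f.2; exact hD.comm_tau))
      map_one' := rfl
      map_mul' := fun _ _ => rfl
      map_zero' := rfl
      map_add' := fun _ _ => rfl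
      commutes' := fun _ => rfl }
  refine AlgEquiv.ofBijective φ ⟨?_, ?_⟩
  · intro f g h
    obtain ⟨D, hD⟩ := f.2
    obtain ⟨E, hE⟩ := g.2
    refine Subtype.ext (eq_of_apply_zero_eq hD.comm_P hE.comm_P ?_)
    ext m
    exact LinearMap.congr_fun h m
  · intro g
    obtain ⟨f, hP, hτ, h⟩ := exists_extend g
    exact ⟨⟨f, isQuasiHom_of_comm hP hτ hinf hc⟩, LinearMap.ext h⟩

theorem IsSimple.isSimpleModule (hF : F.IsSimple) (hinf : IsRationalPoint k inf)
    (hc : c.point ≠ inf) : IsSimpleModule (TauAlgebra k Q L) F.Fiber := by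
  have hnt : Nontrivial (F.V 0) := by
    have : 0 < Module.finrank (FunField k Q L) (F.V 0) := by
      rw [finrank_V]; exact Nat.pos_of_ne_zero hF.1
    exact Module.nontrivial_of_finrank_pos this
  have : Nontrivial F.Fiber := hnt
  rw [isSimpleModule_iff]
  refine { eq_bot_or_eq_top := fun N => ?_ }
  let N₀ : Submodule (FunField k Q L) (F.V 0) :=
    { carrier := N
      zero_mem' := N.zero_mem
      add_mem' := N.add_mem
      smul_mem' := fun a m hm => by
        have := N.smul_mem (FreeAlgebra.ι Q (some a)) hm
        rw [ι_some_smul] at this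
        exact this }
  have hN₀ : ∀ m : F.Fiber, m ∈ N₀ ↔ m ∈ N := fun m => Iff.rfl
  have hst : F.IsStable fun i => N₀.map (equivFamily F.equivP i).toLinearMap :=
    { map_P := fun i => by
        rw [← Submodule.map_comp]
        congr 1
        ext m
        exact (equivFamily_succ F.equivP i m).symm
      tau := by
        rintro i _ ⟨m, hm, rfl⟩
        refine ⟨F.frobFiber m, ?_, (tau_equivFamily F i m).symm⟩
        have := N.smul_mem (FreeAlgebra.ι Q none) hm
        rw [ι_none_smul] at this
        exact this }
  rcases hF.eq_bot_or_eq_top hinf hc hst with h | h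
  · left
    rw [eq_bot_iff]
    intro m hm
    have h1 : equivFamily F.equivP 0 m ∈ N₀.map (equivFamily F.equivP 0).toLinearMap := ⟨m, hm, rfl⟩
    rw [h 0] at h1
    exact h1
  · right
    rw [eq_top_iff]
    intro m _
    have h1 : equivFamily F.equivP 0 m ∈ N₀.map (equivFamily F.equivP 0).toLinearMap := by
      rw [h 0]; trivial
    obtain ⟨m', hm', h2⟩ := h1
    exact (equivFamily F.equivP 0).injective h2 ▸ hm'

theorem IsSimple.qEnd_isUnit (hF : F.IsSimple) (hinf : IsRationalPoint k inf) (hc : c.point ≠ inf) :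
    Nontrivial F.QEnd ∧ ∀ f : F.QEnd, f ≠ 0 → IsUnit f := by
  have := hF.isSimpleModule hinf hc
  have hnt := IsSimpleModule.nontrivial (TauAlgebra k Q L) F.Fiber
  let e := F.qEndEquiv hinf hc
  refine ⟨e.toEquiv.nontrivial, fun f hf => ?_⟩
  rw [← isUnit_map_iff e, Module.End.isUnit_iff]
  refine (LinearMap.bijective_or_eq_zero (e f)).resolve_right fun h => hf ?_
  exact (map_eq_zero_iff e e.injective).1 h

/-! ### Semisimple abelian `τ`-sheaves -/

theorem IsQuasiIsogeny.bijective (hf : IsQuasiIsogeny f) (i : ℤ) : Function.Bijective (f i) := by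
  obtain ⟨D, -, hinj, S, -, hS, h⟩ := hf
  refine ⟨hinj i, fun w => ?_⟩
  have h1 := h i (Point.generic k Q L) (by
    have : (Point.generic k Q L).toCurve = ⊤ := by
      ext; simp [Point.toCurve, Point.generic, ValuationSubring.mem_comap]
    rwa [this])
  have h2 : w ∈ D.twist (G.F i) (Point.generic k Q L) := fun g _ => (G.isBounded i).generic rfl _
  rw [← h1] at h2
  obtain ⟨m, -, hm⟩ := h2
  exact ⟨m, hm⟩

theorem IsQuasiIsogeny.nonempty_fiberEquiv (hf : IsQuasiIsogeny f) :
    Nonempty (F.Fiber ≃ₗ[TauAlgebra k Q L] G.Fiber) := by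
  have hb := hf.bijective 0
  obtain ⟨D, hD, -⟩ := hf
  exact ⟨LinearEquiv.ofBijective (fiberHom (f 0) (comm_frobFiber hD.comm_P hD.comm_tau)) hb⟩

theorem IsDirectSum.nonempty_fiberEquiv {n : ℕ} {S : AbelianTauSheaf inf c}
    {G : Fin n → AbelianTauSheaf inf c} (h : IsDirectSum S G) :
    Nonempty (S.Fiber ≃ₗ[TauAlgebra k Q L] ∀ j, (G j).Fiber) := by
  obtain ⟨incl, proj, hi, hp, h1, h2, h3⟩ := h
  refine ⟨LinearEquiv.ofBijective (LinearMap.pi fun j => fiberHom (proj j 0)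
    (comm_frobFiber (hp j).comm_P (hp j).comm_tau)) ⟨?_, fun w => ⟨∑ j, incl j 0 (w j), ?_⟩⟩⟩
  · rw [injective_iff_map_eq_zero]
    intro m hm
    have e : ∀ j, proj j 0 m = 0 := fun j => congrFun hm j
    have := h3 0 m
    simp only [e, map_zero, Finset.sum_const_zero] at this
    exact this.symm
  · funext j
    change proj j 0 (∑ j, incl j 0 (w j)) = w j
    rw [map_sum, Finset.sum_eq_single j]
    · exact h1 j 0 (w j)
    · exact fun j' _ hj => h2 j' j hj 0 (w j')
    · exact fun h => absurd (Finset.mem_univ j) h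

end AbelianTauSheaf

/-- A simple submodule of a finite product of simple modules is isomorphic to a factor. -/
theorem exists_equiv_factor {R : Type*} [Ring R] {n : ℕ} {M : Fin n → Type*}
    [∀ j, AddCommGroup (M j)] [∀ j, Module R (M j)] [∀ j, IsSimpleModule R (M j)]
    {N X : Type*} [AddCommGroup N] [Module R N] (e : N ≃ₗ[R] ∀ j, M j) [AddCommGroup X] [Module R X]
    [IsSimpleModule R X] (i : X →ₗ[R] N) (hi : Function.Injective i) :
    ∃ j, Nonempty (X ≃ₗ[R] M j) := by
  have hX := IsSimpleModule.nontrivial R X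
  obtain ⟨x, hx⟩ := exists_ne (0 : X)
  have h1 : e (i x) ≠ 0 := fun h => hx ((map_eq_zero_iff i hi).1 ((map_eq_zero_iff e e.injective).1 h))
  obtain ⟨j, hj⟩ := Function.ne_iff.1 h1
  let g : X →ₗ[R] M j := LinearMap.proj j ∘ₗ e.toLinearMap ∘ₗ i
  refine ⟨j, ⟨LinearEquiv.ofBijective g ((LinearMap.bijective_or_eq_zero g).resolve_right ?_)⟩⟩
  exact fun h => hj (LinearMap.congr_fun h x)

end TauSheaf

theorem mainTheorem4 {k Q L : Type u} [Field k] [Fintype k] [Field Q] [Algebra k Q]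
    [TauSheaf.IsCurve k Q] [Field L] [Algebra k L]
    (inf : ValuationSubring Q) (hinf : TauSheaf.IsRationalPoint k inf)
    (c : TauSheaf.Characteristic k Q L) (hc : c.point ≠ inf)
    (F : TauSheaf.AbelianTauSheaf inf c) :
    (F.IsSimple → Nontrivial F.QEnd ∧ ∀ f : F.QEnd, f ≠ 0 → IsUnit f) ∧
    ∀ (n : ℕ) (G : Fin n → TauSheaf.AbelianTauSheaf inf c), F.IsSimpleDecomposition G →
      (∀ j, Nontrivial (G j).QEnd ∧ ∀ f : (G j).QEnd, f ≠ 0 → IsUnit f) ∧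
      ∃ (m : ℕ) (j : Fin m → Fin n) (μ : Fin m → ℕ), (∀ ν, 0 < μ ν) ∧
        Nonempty (F.QEnd ≃ₐ[Q] ∀ ν, Matrix (Fin (μ ν)) (Fin (μ ν)) (G (j ν)).QEnd) := by
  refine ⟨fun hF => hF.qEnd_isUnit hinf hc, ?_⟩
  rintro n G ⟨hG, S, hS, f, hf⟩
  refine ⟨fun j => (hG j).qEnd_isUnit hinf hc, ?_⟩
  obtain ⟨e₁⟩ := hf.nonempty_fiberEquiv
  obtain ⟨e₂⟩ := hS.nonempty_fiberEquiv
  have hsimple := fun j => (hG j).isSimpleModule hinf hc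
  let R := TauSheaf.AbelianTauSheaf.TauAlgebra k Q L
  have : IsSemisimpleModule R F.Fiber := IsSemisimpleModule.congr (e₁.trans e₂)
  have : Module.Finite R F.Fiber := Module.Finite.equiv (e₁.trans e₂).symm
  obtain ⟨m, X, d, hX, hd, ⟨φ⟩⟩ := IsSemisimpleModule.exists_end_algEquiv_pi_matrix_end Q R F.Fiber
  choose j hj using fun ν => TauSheaf.exists_equiv_factor (e₁.trans e₂) (X ν).subtype
    (X ν).subtype_injective
  exact ⟨m, j, d, fun ν => Nat.pos_of_ne_zero (hd ν).out, ⟨(F.qEndEquiv hinf hc).trans <|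
    φ.trans <| AlgEquiv.piCongrRight fun ν => AlgEquiv.mapMatrix <|
      ((hj ν).some.conjAlgEquiv Q).trans ((G (j ν)).qEndEquiv hinf hc).symm⟩⟩
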